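/- For $n\ge 2$, an $n$-qubit unitary is *composed of $G$ two-qubit gates* if it is a product of $G$ gates, each an arbitrary element of $U(4)$ applied to an arbitrary pair of distinct qubits. For $n$-qubit unitaries $U,V$ let $$d_\diamond(U,V)=\max_\rho\bigl\|(U\otimes I)\rho(U\otimes I)^\dagger-(V\otimes I)\rho(V\otimes I)^\dagger\bigr\|_1,$$ where $\rho$ ranges over the density matrices on the $n$ qubits together with an arbitrary finite-dimensional auxiliary system. A query algorithm with $T$ queries starts in a fixed pure state of the $n$ qubits and a finite-dimensional auxiliary system, applies the unknown unitary $U$ (to the $n$ qubits) $T$ times, with fixed unitaries of the joint system interleaved, finally measures a finite POVM, and outputs an $n$-qubit unitary $\hat U$ determined by the outcome. It *learns $G$-gate unitaries to accuracy $\epsilon$* if, for every $n$-qubit unitary $U$ composed of $G$ two-qubit gates, $d_\diamond(\hat U,U)\le\epsilon$ with probability at least $2/3$. **Theorem 3.** (1) There are universal constants $C>0$ and $c>0$ such that for all $n\ge2$, $G\ge1$ and $\epsilon\in(0,1/4]$, every query algorithm that learns $n$-qubit $G$-gate unitaries to accuracy $\epsilon$ uses at least $$c\cdot\frac{2^{\min\{G/(2C),\,n/2\}}}{\epsilon}$$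 queries to $U$. (2) There is a universal constant $K>0$ such that for all $n\ge2$, $G\ge1$ and $\epsilon\in(0,1/4]$ there is a query algorithm that learns $n$-qubit $G$-gate unitaries to accuracy $\epsilon$ with at most $$K\cdot\frac{2^n\,G\,\log\bigl(\sqrt{2^n}\,G/\epsilon\bigr)}{\epsilon}$$ queries to $U$. -/

import Mathlib

namespace UnitaryLearning

open scoped Matrix Kronecker ComplexOrder

/-- Labels of the computational basis of `n` qubits. -/
abbrev Qubits (n : ℕ) : Type := Fin n → Fin 2

/-- `n`-qubit unitaries. -/
abbrev QUnitary (n : ℕ) : Type := Matrix.unitaryGroup (Qubits n) ℂ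

/-- The operator on `n` qubits that acts as the `4 × 4` matrix `g` on the ordered pair `(i, j)` of
qubits and as the identity on every other qubit. -/
def onPair {n : ℕ} (i j : Fin n) (g : Matrix (Fin 2 × Fin 2) (Fin 2 × Fin 2) ℂ) :
    Matrix (Qubits n) (Qubits n) ℂ :=
  Matrix.of fun x y =>
    if ∀ k : Fin n, k ≠ i → k ≠ j → x k = y k then g (x i, x j) (y i, y j) else 0

/-- `W` is a two-qubit gate: an arbitrary `4 × 4` unitary applied to an arbitrary pair of distinct
qubits. -/
def IsTwoQubitGate {n : ℕ} (W : Matrix (Qubits n) (Qubits n) ℂ) : Prop :=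
  ∃ i j : Fin n, i ≠ j ∧ ∃ g : Matrix.unitaryGroup (Fin 2 × Fin 2) ℂ,
    W = onPair i j (g : Matrix (Fin 2 × Fin 2) (Fin 2 × Fin 2) ℂ)

/-- `U` is composed of `G` two-qubit gates. -/
def IsCircuit {n : ℕ} (G : ℕ) (U : QUnitary n) : Prop :=
  ∃ gates : List (Matrix (Qubits n) (Qubits n) ℂ),
    gates.length = G ∧ (∀ W ∈ gates, IsTwoQubitGate W) ∧
      gates.prod = (U : Matrix (Qubits n) (Qubits n) ℂ)

/-- The trace norm `‖A‖₁ = tr √(Aᴴ A)`, that is, the sum of the singular values of `A`. -/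
noncomputable def traceNorm {ι : Type} [Fintype ι] [DecidableEq ι] (A : Matrix ι ι ℂ) : ℝ :=
  ∑ k, √((Matrix.isHermitian_conjTranspose_mul_self A).eigenvalues k)

/-- Density matrices. -/
def IsDensity {ι : Type} [Fintype ι] (ρ : Matrix ι ι ℂ) : Prop :=
  ρ.PosSemidef ∧ ρ.trace = 1

/-- `(U ⊗ I) ρ (U ⊗ I)ᴴ`, the unitary channel of `U` extended by the identity on an
`m`-dimensional system. -/
noncomputable def extendedChannel {n m : ℕ} (U : QUnitary n)
    (ρ : Matrix (Qubits n × Fin m) (Qubits n × Fin m) ℂ) :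
    Matrix (Qubits n × Fin m) (Qubits n × Fin m) ℂ :=
  ((U : Matrix (Qubits n) (Qubits n) ℂ) ⊗ₖ (1 : Matrix (Fin m) (Fin m) ℂ)) * ρ *
    ((U : Matrix (Qubits n) (Qubits n) ℂ) ⊗ₖ (1 : Matrix (Fin m) (Fin m) ℂ))ᴴ

/-- The diamond distance `max_ρ ‖(U ⊗ I) ρ (U ⊗ I)ᴴ - (V ⊗ I) ρ (V ⊗ I)ᴴ‖₁` (without a factor
`1/2`), over all density matrices on all finite-dimensional extensions of the `n`-qubit space. -/
noncomputable def dDiamond {n : ℕ} (U V : QUnitary n) : ℝ :=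
  sSup {r : ℝ | ∃ (m : ℕ) (ρ : Matrix (Qubits n × Fin m) (Qubits n × Fin m) ℂ),
    IsDensity ρ ∧ r = traceNorm (extendedChannel U ρ - extendedChannel V ρ)}

/-- A quantum algorithm that queries an unknown `n`-qubit unitary a fixed number of times and
outputs a description of an `n`-qubit unitary. It has an auxiliary system of arbitrary finite
dimension, starts in a fixed pure state, applies an arbitrary fixed unitary of the joint system
after each query, and at the end measures an arbitrary finite POVM; the outcome determines the
output. -/
structure QueryAlgorithm (n : ℕ) where
  /-- labels of a basis of the auxiliary system -/
  Anc : Type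
  [fintypeAnc : Fintype Anc]
  [decEqAnc : DecidableEq Anc]
  /-- number of queries -/
  queries : ℕ
  /-- initial state -/
  init : Qubits n × Anc → ℂ
  init_norm : ∑ x, ‖init x‖ ^ 2 = 1
  /-- `step t` is applied after query number `t` (counted from `0`) -/
  step : ℕ → Matrix.unitaryGroup (Qubits n × Anc) ℂ
  /-- measurement outcomes -/
  Out : Type
  [fintypeOut : Fintype Out]
  /-- the final measurement -/
  povm : Out → Matrix (Qubits n × Anc) (Qubits n × Anc) ℂ
  povm_posSemidef : ∀ o, (povm o).PosSemidef
  povm_sum : ∑ o, povm o = 1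
  /-- the unitary that is output on each outcome -/
  guess : Out → QUnitary n

attribute [instance] QueryAlgorithm.fintypeAnc QueryAlgorithm.decEqAnc QueryAlgorithm.fintypeOut

namespace QueryAlgorithm

variable {n : ℕ}

/-- The joint state after `t` queries to `U`. -/
noncomputable def state (A : QueryAlgorithm n) (U : QUnitary n) : ℕ → (Qubits n × A.Anc → ℂ)
  | 0 => A.init
  | t + 1 =>
      (A.step t : Matrix (Qubits n × A.Anc) (Qubits n × A.Anc) ℂ) *ᵥ
        (((U : Matrix (Qubits n) (Qubits n) ℂ) ⊗ₖ (1 : Matrix A.Anc A.Anc ℂ)) *ᵥ A.state U t)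

/-- The probability of outcome `o` (Born rule) when the unknown unitary is `U`. -/
noncomputable def prob (A : QueryAlgorithm n) (U : QUnitary n) (o : A.Out) : ℝ :=
  (star (A.state U A.queries) ⬝ᵥ (A.povm o *ᵥ A.state U A.queries)).re

open scoped Classical in
/-- The probability that the output is within diamond distance `ε` of the unknown unitary `U`. -/
noncomputable def successProb (A : QueryAlgorithm n) (ε : ℝ) (U : QUnitary n) : ℝ :=
  ∑ o, if dDiamond (A.guess o) U ≤ ε then A.prob U o else 0

/-- `A` learns every `n`-qubit unitary composed of `G` two-qubit gates to accuracy `ε` in diamond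
distance with probability at least `2/3`. -/
def Learns (A : QueryAlgorithm n) (G : ℕ) (ε : ℝ) : Prop :=
  ∀ U : QUnitary n, IsCircuit G U → 2 / 3 ≤ A.successProb ε U

end QueryAlgorithm

end UnitaryLearning

/-! Lower bound. The hard instances hide a search problem inside small circuits. For a string `κ` of
`2h` bits, take the diagonal unitary that is trivial unless the first `2h` qubits read `κ`, and then
multiplies by `e^{iθ}` or `e^{-iθ}`, `θ = 4ε`, according to whether two further qubits agree.
Because both signs occur on the marked block, this differs from the identity by more than a global
phase, and no output can be `ε`-close to both. A commutator of controlled bit flips with a two-qubit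
phase, with Toffoli ladders on dirty ancillas, builds it from `124h + 1` gates without extra qubits
(`isGateProduct_markedPhase`). By the hybrid argument a run on the `κ`-th instance leaves the run on
the identity by at most `θ` times the sum over queries of the root of the weight on `κ`. The weights
of one query sum to `1` over the `4^h` strings, so averaging and Cauchy–Schwarz give `2^h ≤ 24 ε T`
(`card_le_of_markedPhase`), and `h` can be taken within an additive constant of `min(G/124, n/2)`.

Upper bound. Rounding the gates gives a finite net of circuits with `log |N| = O(G log x)`, where `x
= √(2^n) G / ε` (`exists_circuit_net`). The learner picks an element of the net by repeated
refinement. If `V` is known to be within `r` of `U` up to phase, then `P` queries interleaved with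
`V⁻¹` produce the Choi state of `(V⁻¹U)^P`. For `P` of order `1/r`, candidates whose powers nearly
agree were already within `r/2` of each other (`phaseClose_of_pow`). So constant accuracy on the
power halves the radius, and the total cost over the stages is a geometric sum dominated by the last
one, of order `1/ε` queries per sample.

Each stage measures `m` copies one at a time in one fixed measurement and takes the maximum
likelihood candidate (`sum_maximumLikelihood_le`). The measurement, half computational basis and
half random vectors of fourth roots of unity, separates any two pure states with a Bhattacharyya gap
proportional to one minus their fidelity, with no loss in dimension
(`bhattacharyya_phaseMeasurement_le`); this is a fourth-moment argument. The factor `2^n` comes only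
from comparing operator norm with the Hilbert–Schmidt overlap of Choi states, so `m` of order `2^n G
log x` beats the union bound over the net.

Two technical layers connect this with the formal model. Adaptive sampling is turned into a single
unitary run by deferring all measurements (`Simulable`, `Preparable`). Also, the true `U` is only
near the net, which costs `2T‖U - V‖` in probability; the net is fine enough, polynomially in `1/x`,
for this to be negligible. -/

namespace UnitaryLearning
open scoped Matrix Kronecker ComplexOrder Matrix.Norms.L2Operator

/-! ### Euclidean norms of vectors and operator norms of matrices -/

section VectorNorm
variable {ι κ : Type} [Fintype ι] [Fintype κ]

/-- The Euclidean norm of a complex vector. -/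
noncomputable def vnorm (v : ι → ℂ) : ℝ := ‖(WithLp.toLp 2 v : EuclideanSpace ℂ ι)‖

lemma vnorm_sq (v : ι → ℂ) : vnorm v ^ 2 = ∑ i, ‖v i‖ ^ 2 := by
  simp [vnorm, EuclideanSpace.norm_sq_eq]

lemma vnorm_nonneg (v : ι → ℂ) : 0 ≤ vnorm v := norm_nonneg _

lemma vnorm_zero : vnorm (0 : ι → ℂ) = 0 := by simp [vnorm]

lemma vnorm_add_le (v w : ι → ℂ) : vnorm (v + w) ≤ vnorm v + vnorm w := by
  simpa [vnorm] using norm_add_le (WithLp.toLp 2 v : EuclideanSpace ℂ ι) (WithLp.toLp 2 w)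

lemma vnorm_smul (c : ℂ) (v : ι → ℂ) : vnorm (c • v) = ‖c‖ * vnorm v := by
  simp [vnorm, norm_smul]

lemma dotProduct_eq_inner (v w : ι → ℂ) :
    star v ⬝ᵥ w = inner ℂ (WithLp.toLp 2 v : EuclideanSpace ℂ ι) (WithLp.toLp 2 w) := by
  simp [EuclideanSpace.inner_eq_star_dotProduct, dotProduct_comm]

lemma norm_dotProduct_le (v w : ι → ℂ) : ‖star v ⬝ᵥ w‖ ≤ vnorm v * vnorm w := by
  rw [dotProduct_eq_inner]
  exact norm_inner_le_norm _ _

lemma dotProduct_self_eq (v : ι → ℂ) : star v ⬝ᵥ v = ((vnorm v ^ 2 : ℝ) : ℂ) := by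
  rw [dotProduct_eq_inner, vnorm, inner_self_eq_norm_sq_to_K]
  norm_cast

lemma vnorm_mulVec_le [DecidableEq κ] (A : Matrix ι κ ℂ) (v : κ → ℂ) :
    vnorm (A *ᵥ v) ≤ ‖A‖ * vnorm v :=
  Matrix.l2_opNorm_mulVec A (WithLp.toLp 2 v)

lemma opNorm_le_of_vnorm [DecidableEq ι] (A : Matrix ι ι ℂ) {c : ℝ} (hc : 0 ≤ c)
    (h : ∀ v, vnorm (A *ᵥ v) ≤ c * vnorm v) : ‖A‖ ≤ c := by
  rw [Matrix.cstar_norm_def]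
  refine ContinuousLinearMap.opNorm_le_bound _ hc fun v => ?_
  exact h v.ofLp

lemma star_mulVec_dotProduct_mulVec [DecidableEq κ] {S : Matrix ι κ ℂ} (hS : Sᴴ * S = 1)
    (v w : κ → ℂ) : star (S *ᵥ v) ⬝ᵥ (S *ᵥ w) = star v ⬝ᵥ w := by
  rw [Matrix.star_mulVec, ← Matrix.dotProduct_mulVec, Matrix.mulVec_mulVec, hS, Matrix.one_mulVec]

lemma vnorm_mulVec_of_isometry [DecidableEq κ] {S : Matrix ι κ ℂ} (hS : Sᴴ * S = 1)
    (v : κ → ℂ) : vnorm (S *ᵥ v) = vnorm v := by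
  have h := star_mulVec_dotProduct_mulVec hS v v
  rw [dotProduct_self_eq, dotProduct_self_eq] at h
  have h2 : vnorm (S *ᵥ v) ^ 2 = vnorm v ^ 2 := by exact_mod_cast h
  exact (sq_eq_sq₀ (vnorm_nonneg _) (vnorm_nonneg _)).1 h2

lemma unitary_conjTranspose_mul [DecidableEq ι] (U : Matrix.unitaryGroup ι ℂ) :
    (U : Matrix ι ι ℂ)ᴴ * (U : Matrix ι ι ℂ) = 1 := Matrix.UnitaryGroup.star_mul_self U

lemma vnorm_unitary_mulVec [DecidableEq ι] (U : Matrix.unitaryGroup ι ℂ) (v : ι → ℂ) :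
    vnorm ((U : Matrix ι ι ℂ) *ᵥ v) = vnorm v :=
  vnorm_mulVec_of_isometry (unitary_conjTranspose_mul U) v

lemma opNorm_unitary_le [DecidableEq ι] (U : Matrix.unitaryGroup ι ℂ) :
    ‖(U : Matrix ι ι ℂ)‖ ≤ 1 :=
  opNorm_le_of_vnorm _ zero_le_one fun v => by rw [vnorm_unitary_mulVec, one_mul]

/-- Tensoring with the identity, as a homomorphism of star algebras. -/
noncomputable def kroneckerOneHom (ι κ : Type) [Fintype ι] [Fintype κ] [DecidableEq ι]
    [DecidableEq κ] : Matrix ι ι ℂ →⋆ₐ[ℂ] Matrix (ι × κ) (ι × κ) ℂ where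
  toFun A := A ⊗ₖ (1 : Matrix κ κ ℂ)
  map_one' := Matrix.one_kronecker_one
  map_mul' A B := by rw [← Matrix.mul_kronecker_mul, one_mul]
  map_zero' := Matrix.zero_kronecker _
  map_add' A B := Matrix.add_kronecker _ _ _
  commutes' c := by
    rw [Algebra.algebraMap_eq_smul_one, Matrix.smul_kronecker, Matrix.one_kronecker_one,
      Algebra.algebraMap_eq_smul_one]
  map_star' A := by
    simp [Matrix.star_eq_conjTranspose, Matrix.conjTranspose_kronecker]

lemma opNorm_kronecker_one_le [DecidableEq ι] [DecidableEq κ] (A : Matrix ι ι ℂ) :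
    ‖A ⊗ₖ (1 : Matrix κ κ ℂ)‖ ≤ ‖A‖ :=
  NonUnitalStarAlgHom.norm_apply_le (kroneckerOneHom ι κ) A

lemma kronecker_one_isometry [DecidableEq ι] [DecidableEq κ] {A : Matrix ι ι ℂ}
    (hA : Aᴴ * A = 1) : (A ⊗ₖ (1 : Matrix κ κ ℂ))ᴴ * (A ⊗ₖ (1 : Matrix κ κ ℂ)) = 1 := by
  rw [Matrix.conjTranspose_kronecker, ← Matrix.mul_kronecker_mul, hA]
  simp

end VectorNorm

/-! ### Trace norm -/

section TraceNorm
variable {ι : Type} [Fintype ι] [DecidableEq ι]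

/-- Singular value decomposition by hand: with `v j` the eigenvectors of `Aᴴ * A` and `w j` the
normalized `A v j` for nonzero singular values, each singular value is `⟨w j, A v j⟩`, which expands
over the rank-one terms. Cauchy–Schwarz over `j` and Bessel's inequality for both orthonormal
families finish. -/
lemma traceNorm_sum_vecMulVec_le {κ : Type} (s : Finset κ) (a b : κ → ι → ℂ) :
    traceNorm (∑ k ∈ s, Matrix.vecMulVec (a k) (star (b k))) ≤
      ∑ k ∈ s, vnorm (a k) * vnorm (b k) := by
  set A : Matrix ι ι ℂ := ∑ k ∈ s, Matrix.vecMulVec (a k) (star (b k)) with hA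
  set H := Matrix.isHermitian_conjTranspose_mul_self A
  set ev := H.eigenvalues with hev
  have hev0 : ∀ j, 0 ≤ ev j := (Matrix.posSemidef_conjTranspose_mul_self A).eigenvalues_nonneg
  set v : ι → ι → ℂ := fun j => (H.eigenvectorBasis j).ofLp with hv
  have hvv : ∀ i j, star (v i) ⬝ᵥ v j = if i = j then 1 else 0 := by
    intro i j
    rw [dotProduct_eq_inner]
    exact orthonormal_iff_ite.1 H.eigenvectorBasis.orthonormal i j
  have hAA : ∀ i j, star (A *ᵥ v i) ⬝ᵥ (A *ᵥ v j) = if i = j then (ev j : ℂ) else 0 := by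
    intro i j
    rw [Matrix.star_mulVec, ← Matrix.dotProduct_mulVec, Matrix.mulVec_mulVec]
    have := H.mulVec_eigenvectorBasis j
    rw [show (Aᴴ * A) *ᵥ v j = (ev j) • v j from this]
    rw [dotProduct_smul, hvv]
    split_ifs <;> simp
  let J := {j : ι // ev j ≠ 0}
  let w : J → EuclideanSpace ℂ ι := fun j =>
    WithLp.toLp 2 (((√(ev j) : ℝ) : ℂ)⁻¹ • (A *ᵥ v j))
  have hsq : ∀ j, ((√(ev j) : ℝ) : ℂ) * ((√(ev j) : ℝ) : ℂ) = ev j := by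
    intro j; rw [← Complex.ofReal_mul, Real.mul_self_sqrt (hev0 j)]
  have hs0 : ∀ j : J, ((√(ev j) : ℝ) : ℂ) ≠ 0 := by
    intro j
    have := j.2
    exact_mod_cast (Real.sqrt_ne_zero (hev0 j)).2 this
  have hw : Orthonormal ℂ w := by
    rw [orthonormal_iff_ite]
    intro i j
    simp only [w]
    rw [← dotProduct_eq_inner, star_smul, smul_dotProduct, dotProduct_smul, hAA]
    by_cases hij : i = j
    · subst hij
      simp only [if_true, smul_eq_mul]
      have h1 := hs0 i
      rw [← hsq i]
      simp only [star_inv₀, Complex.star_def, Complex.conj_ofReal]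
      field_simp
    · have : (i : ι) ≠ j := fun h => hij (Subtype.ext h)
      simp [hij, this]
  have hvo : Orthonormal ℂ (fun j : J => H.eigenvectorBasis j) :=
    H.eigenvectorBasis.orthonormal.comp _ Subtype.val_injective
  have key : ∀ j : J, √(ev j) ≤ ∑ k ∈ s,
      ‖inner ℂ (w j) (WithLp.toLp 2 (a k))‖ * ‖inner ℂ (H.eigenvectorBasis j) (WithLp.toLp 2 (b k))‖ := by
    intro j
    have h1 : star (w j).ofLp ⬝ᵥ (A *ᵥ v j) = ((√(ev j) : ℝ) : ℂ) := by
      simp only [w]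
      rw [star_smul, smul_dotProduct, hAA]
      have h1 := hs0 j
      rw [if_pos rfl, ← hsq j]
      simp only [star_inv₀, Complex.star_def, Complex.conj_ofReal, smul_eq_mul]
      field_simp
    have h2 : star (w j).ofLp ⬝ᵥ (A *ᵥ v j) = ∑ k ∈ s,
        inner ℂ (w j) (WithLp.toLp 2 (a k)) * star (inner ℂ (H.eigenvectorBasis j) (WithLp.toLp 2 (b k))) := by
      have hAx : ∀ x, A *ᵥ x = ∑ k ∈ s, Matrix.vecMulVec (a k) (star (b k)) *ᵥ x := by
        intro x
        rw [hA, Matrix.sum_mulVec]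
      rw [hAx, dotProduct_sum]
      refine Finset.sum_congr rfl fun k _ => ?_
      rw [Matrix.vecMulVec_mulVec]
      have e1 : inner ℂ (w j) (WithLp.toLp 2 (a k)) = star (w j).ofLp ⬝ᵥ a k := by
        rw [dotProduct_eq_inner]
      have e2 : star (inner ℂ (H.eigenvectorBasis j) (WithLp.toLp 2 (b k))) = star (b k) ⬝ᵥ v j := by
        rw [dotProduct_eq_inner, Complex.star_def, inner_conj_symm]
      rw [e1, e2, op_smul_eq_smul, dotProduct_smul, smul_eq_mul, mul_comm]
    have h3 : √(ev j) = ‖star (w j).ofLp ⬝ᵥ (A *ᵥ v j)‖ := by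
      rw [h1, Complex.norm_real, Real.norm_of_nonneg (Real.sqrt_nonneg _)]
    rw [h3, h2]
    refine (norm_sum_le _ _).trans (le_of_eq ?_)
    refine Finset.sum_congr rfl fun k _ => ?_
    rw [norm_mul, norm_star]
  have hsum : traceNorm A = ∑ j : J, √(ev j) := by
    rw [← Finset.sum_subtype (Finset.univ.filter fun j => ev j ≠ 0) (by simp)
      (fun j => √(ev j))]
    symm
    apply Finset.sum_filter_of_ne
    intro j _ hj h0
    exact hj (by rw [h0, Real.sqrt_zero])
  rw [hsum]
  calc ∑ j : J, √(ev j) ≤ ∑ j : J, ∑ k ∈ s,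
      ‖inner ℂ (w j) (WithLp.toLp 2 (a k))‖ *
        ‖inner ℂ (H.eigenvectorBasis j) (WithLp.toLp 2 (b k))‖ := Finset.sum_le_sum fun j _ => key j
    _ = ∑ k ∈ s, ∑ j : J, ‖inner ℂ (w j) (WithLp.toLp 2 (a k))‖ *
        ‖inner ℂ (H.eigenvectorBasis j) (WithLp.toLp 2 (b k))‖ := Finset.sum_comm
    _ ≤ _ := by
      refine Finset.sum_le_sum fun k _ => ?_
      refine (Real.sum_mul_le_sqrt_mul_sqrt _ _ _).trans ?_
      refine mul_le_mul ?_ ?_ (Real.sqrt_nonneg _) (vnorm_nonneg _)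
      · exact Real.sqrt_le_iff.2 ⟨vnorm_nonneg _, hw.sum_inner_products_le _⟩
      · exact Real.sqrt_le_iff.2 ⟨vnorm_nonneg _, hvo.sum_inner_products_le _⟩

lemma frobenius_le_traceNorm_sq (A : Matrix ι ι ℂ) :
    ∑ i, ∑ j, ‖A i j‖ ^ 2 ≤ traceNorm A ^ 2 := by
  set H := Matrix.isHermitian_conjTranspose_mul_self A
  have hev0 : ∀ j, 0 ≤ H.eigenvalues j :=
    (Matrix.posSemidef_conjTranspose_mul_self A).eigenvalues_nonneg
  have h1 := H.trace_eq_sum_eigenvalues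
  have h2 : (Aᴴ * A).trace = ((∑ i, ∑ j, ‖A i j‖ ^ 2 : ℝ) : ℂ) := by
    rw [Finset.sum_comm]
    simp only [Matrix.trace, Matrix.diag_apply, Matrix.mul_apply, Matrix.conjTranspose_apply]
    push_cast
    refine Finset.sum_congr rfl fun i _ => Finset.sum_congr rfl fun j _ => ?_
    rw [Complex.star_def, ← Complex.normSq_eq_conj_mul_self, Complex.normSq_eq_norm_sq]
    push_cast; rfl
  have h3 : ∑ i, ∑ j, ‖A i j‖ ^ 2 = ∑ j, H.eigenvalues j := by
    refine Complex.ofReal_injective ?_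
    rw [← h2, h1]
    push_cast
    rfl
  rw [h3]
  calc ∑ j, H.eigenvalues j = ∑ j, √(H.eigenvalues j) ^ 2 :=
        Finset.sum_congr rfl fun j _ => (Real.sq_sqrt (hev0 j)).symm
    _ ≤ (∑ j, √(H.eigenvalues j)) ^ 2 :=
        Finset.sum_sq_le_sq_sum_of_nonneg fun j _ => Real.sqrt_nonneg _
    _ = _ := rfl

lemma traceNorm_nonneg (A : Matrix ι ι ℂ) : 0 ≤ traceNorm A :=
  Finset.sum_nonneg fun _ _ => Real.sqrt_nonneg _

end TraceNorm
end UnitaryLearning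

namespace UnitaryLearning
open scoped Matrix Kronecker ComplexOrder Matrix.Norms.L2Operator

/-! ### Diamond distance against operator norm up to phase -/

section Diamond
variable {n : ℕ}

lemma conj_vecMulVec {ι : Type} [Fintype ι] (X : Matrix ι ι ℂ) (v : ι → ℂ) :
    X * Matrix.vecMulVec v (star v) * Xᴴ = Matrix.vecMulVec (X *ᵥ v) (star (X *ᵥ v)) := by
  rw [Matrix.mul_vecMulVec, Matrix.vecMulVec_mul, Matrix.star_mulVec]

/-- The phase `c` is invisible to the channel, so `V` may be replaced by `c • V`. On each pure
component the difference telescopes into two rank-one terms, `(X - Y)φ (Xφ)ᴴ + Yφ ((X - Y)φ)ᴴ`,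
which gives the factor 2. -/
lemma traceNorm_extendedChannel_sub_le (U V : QUnitary n) {c : ℂ} (hc : ‖c‖ = 1) {m : ℕ}
    {ρ : Matrix (Qubits n × Fin m) (Qubits n × Fin m) ℂ} (hρ : IsDensity ρ) :
    traceNorm (extendedChannel U ρ - extendedChannel V ρ) ≤
      2 * ‖(U : Matrix (Qubits n) (Qubits n) ℂ) - c • (V : Matrix (Qubits n) (Qubits n) ℂ)‖ := by
  obtain ⟨hpos, htr⟩ := hρ
  obtain ⟨N, φ, hφ⟩ := Matrix.posSemidef_iff_eq_sum_vecMulVec.1 hpos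
  set X := (U : Matrix (Qubits n) (Qubits n) ℂ) ⊗ₖ (1 : Matrix (Fin m) (Fin m) ℂ) with hX
  set Y := (c • (V : Matrix (Qubits n) (Qubits n) ℂ)) ⊗ₖ (1 : Matrix (Fin m) (Fin m) ℂ) with hY
  have hcc : c * star c = 1 := by
    rw [Complex.star_def, Complex.mul_conj, Complex.normSq_eq_norm_sq, hc]; simp
  have hVY : extendedChannel V ρ = Y * ρ * Yᴴ := by
    rw [hY, Matrix.smul_kronecker, Matrix.conjTranspose_smul]
    simp only [Matrix.smul_mul, Matrix.mul_smul, smul_smul]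
    rw [mul_comm (star c), hcc, one_smul]
    rfl
  have hXiso : Xᴴ * X = 1 := kronecker_one_isometry (unitary_conjTranspose_mul U)
  have hYiso : Yᴴ * Y = 1 := by
    refine kronecker_one_isometry ?_
    rw [Matrix.conjTranspose_smul, Matrix.smul_mul, Matrix.mul_smul, smul_smul,
      unitary_conjTranspose_mul, mul_comm, hcc, one_smul]
  have hXY : ‖X - Y‖ ≤ ‖(U : Matrix (Qubits n) (Qubits n) ℂ) - c • (V : Matrix (Qubits n) (Qubits n) ℂ)‖ := by
    have : X - Y = ((U : Matrix (Qubits n) (Qubits n) ℂ) - c • (V : Matrix (Qubits n) (Qubits n) ℂ))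
        ⊗ₖ (1 : Matrix (Fin m) (Fin m) ℂ) :=
      (map_sub (kroneckerOneHom (Qubits n) (Fin m)) _ _).symm
    rw [this]
    exact opNorm_kronecker_one_le _
  set D := ‖(U : Matrix (Qubits n) (Qubits n) ℂ) - c • (V : Matrix (Qubits n) (Qubits n) ℂ)‖
  have hnorm : ∑ k, vnorm (φ k) ^ 2 = 1 := by
    have h1 : ρ.trace = ∑ k, ((vnorm (φ k) ^ 2 : ℝ) : ℂ) := by
      rw [hφ, Matrix.trace_sum]
      refine Finset.sum_congr rfl fun k _ => ?_
      rw [Matrix.trace_vecMulVec, dotProduct_comm, dotProduct_self_eq]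
    rw [htr] at h1
    exact_mod_cast h1.symm
  have hdecomp : extendedChannel U ρ - extendedChannel V ρ =
      ∑ k : Fin N ⊕ Fin N, Matrix.vecMulVec
        (Sum.elim (fun k => (X - Y) *ᵥ φ k) (fun k => Y *ᵥ φ k) k)
        (star (Sum.elim (fun k => X *ᵥ φ k) (fun k => (X - Y) *ᵥ φ k) k)) := by
    rw [hVY, show extendedChannel U ρ = X * ρ * Xᴴ from rfl, hφ, Fintype.sum_sum_type]
    simp only [Sum.elim_inl, Sum.elim_inr]
    rw [← Finset.sum_add_distrib, Finset.mul_sum, Finset.mul_sum, Finset.sum_mul, Finset.sum_mul,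
      ← Finset.sum_sub_distrib]
    refine Finset.sum_congr rfl fun k _ => ?_
    rw [conj_vecMulVec, conj_vecMulVec, Matrix.sub_mulVec, star_sub, Matrix.vecMulVec_sub,
      Matrix.sub_vecMulVec]
    abel
  rw [hdecomp]
  refine (traceNorm_sum_vecMulVec_le _ _ _).trans ?_
  rw [Fintype.sum_sum_type]
  simp only [Sum.elim_inl, Sum.elim_inr]
  rw [← Finset.sum_add_distrib]
  calc _ ≤ ∑ k, 2 * D * vnorm (φ k) ^ 2 := by
        refine Finset.sum_le_sum fun k _ => ?_
        rw [vnorm_mulVec_of_isometry hXiso, vnorm_mulVec_of_isometry hYiso]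
        have h1 : vnorm ((X - Y) *ᵥ φ k) ≤ D * vnorm (φ k) :=
          (vnorm_mulVec_le _ _).trans (mul_le_mul_of_nonneg_right hXY (vnorm_nonneg _))
        nlinarith [vnorm_nonneg (φ k)]
    _ = 2 * D := by rw [← Finset.mul_sum, hnorm, mul_one]

lemma dDiamond_le (U V : QUnitary n) {c : ℂ} (hc : ‖c‖ = 1) :
    dDiamond U V ≤
      2 * ‖(U : Matrix (Qubits n) (Qubits n) ℂ) - c • (V : Matrix (Qubits n) (Qubits n) ℂ)‖ := by
  refine Real.sSup_le ?_ (by positivity)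
  rintro r ⟨m, ρ, hρ, rfl⟩
  exact traceNorm_extendedChannel_sub_le U V hc hρ

/-- A real `sSup` is informative only for bounded sets; the previous estimate with phase 1 supplies
the bound. -/
lemma traceNorm_le_dDiamond (U V : QUnitary n) {m : ℕ}
    {ρ : Matrix (Qubits n × Fin m) (Qubits n × Fin m) ℂ} (hρ : IsDensity ρ) :
    traceNorm (extendedChannel U ρ - extendedChannel V ρ) ≤ dDiamond U V := by
  refine le_csSup ⟨2 * ‖(U : Matrix (Qubits n) (Qubits n) ℂ) -
    (1 : ℂ) • (V : Matrix (Qubits n) (Qubits n) ℂ)‖, ?_⟩ ⟨m, ρ, hρ, rfl⟩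
  rintro r ⟨m, ρ, hρ, rfl⟩
  exact traceNorm_extendedChannel_sub_le U V (by simp) hρ

end Diamond

/-! ### Runs of an algorithm and the hybrid argument -/

section States
variable {n : ℕ} {Anc : Type} [Fintype Anc] [DecidableEq Anc]

/-- The joint state after `t` queries, for a given initial state and given interleaved unitaries. -/
noncomputable def runState (init : Qubits n × Anc → ℂ)
    (step : ℕ → Matrix.unitaryGroup (Qubits n × Anc) ℂ) (U : QUnitary n) :
    ℕ → (Qubits n × Anc → ℂ)
  | 0 => init
  | t + 1 =>
      (step t : Matrix (Qubits n × Anc) (Qubits n × Anc) ℂ) *ᵥ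
        (((U : Matrix (Qubits n) (Qubits n) ℂ) ⊗ₖ (1 : Matrix Anc Anc ℂ)) *ᵥ
          runState init step U t)

lemma QueryAlgorithm.state_eq_runState (A : QueryAlgorithm n) (U : QUnitary n) (t : ℕ) :
    A.state U t = runState A.init A.step U t := by
  induction t with
  | zero => rfl
  | succ t ih => rw [QueryAlgorithm.state, runState, ih]

variable (init : Qubits n × Anc → ℂ) (step : ℕ → Matrix.unitaryGroup (Qubits n × Anc) ℂ)

lemma vnorm_runState (U : QUnitary n) (t : ℕ) :
    vnorm (runState init step U t) = vnorm init := by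
  induction t with
  | zero => rfl
  | succ t ih =>
    rw [runState, vnorm_unitary_mulVec, vnorm_mulVec_of_isometry
      (kronecker_one_isometry (unitary_conjTranspose_mul U)), ih]

/-- The hybrid argument. -/
lemma vnorm_runState_sub_le (U V : QUnitary n) (t : ℕ) :
    vnorm (runState init step U t - runState init step V t) ≤
      ∑ s ∈ Finset.range t, vnorm ((((U : Matrix (Qubits n) (Qubits n) ℂ) -
        (V : Matrix (Qubits n) (Qubits n) ℂ)) ⊗ₖ (1 : Matrix Anc Anc ℂ)) *ᵥ
          runState init step V s) := by
  induction t with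
  | zero => simp [runState, vnorm_zero]
  | succ t ih =>
    rw [Finset.sum_range_succ, runState, runState, ← Matrix.mulVec_sub, vnorm_unitary_mulVec]
    have h : ((U : Matrix (Qubits n) (Qubits n) ℂ) ⊗ₖ (1 : Matrix Anc Anc ℂ)) *ᵥ
          runState init step U t - ((V : Matrix (Qubits n) (Qubits n) ℂ) ⊗ₖ (1 : Matrix Anc Anc ℂ)) *ᵥ
          runState init step V t =
        ((U : Matrix (Qubits n) (Qubits n) ℂ) ⊗ₖ (1 : Matrix Anc Anc ℂ)) *ᵥ
          (runState init step U t - runState init step V t) +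
        (((U : Matrix (Qubits n) (Qubits n) ℂ) -
        (V : Matrix (Qubits n) (Qubits n) ℂ)) ⊗ₖ (1 : Matrix Anc Anc ℂ)) *ᵥ
          runState init step V t := by
      have e : ((U : Matrix (Qubits n) (Qubits n) ℂ) -
        (V : Matrix (Qubits n) (Qubits n) ℂ)) ⊗ₖ (1 : Matrix Anc Anc ℂ) =
          (U : Matrix (Qubits n) (Qubits n) ℂ) ⊗ₖ (1 : Matrix Anc Anc ℂ) -
          (V : Matrix (Qubits n) (Qubits n) ℂ) ⊗ₖ (1 : Matrix Anc Anc ℂ) :=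
        map_sub (kroneckerOneHom (Qubits n) Anc) _ _
      rw [e, Matrix.mulVec_sub, Matrix.sub_mulVec]
      abel
    rw [h]
    refine (vnorm_add_le _ _).trans (add_le_add ?_ le_rfl)
    rw [vnorm_mulVec_of_isometry (kronecker_one_isometry (unitary_conjTranspose_mul U))]
    exact ih

end States

/-! ### Stability of outcome probabilities -/

section Measurement
open scoped MatrixOrder
variable {ι Out : Type} [Fintype ι] [DecidableEq ι] [Fintype Out]

/-- The outcome probabilities of a set `S` of outcomes are Lipschitz in the state. -/
lemma sum_prob_sub_le (E : Out → Matrix ι ι ℂ) (hE : ∀ o, (E o).PosSemidef) (hsum : ∑ o, E o = 1)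
    (S : Finset Out) {v w : ι → ℂ} (hv : vnorm v = 1) (hw : vnorm w = 1) :
    ∑ o ∈ S, (star v ⬝ᵥ (E o *ᵥ v)).re - ∑ o ∈ S, (star w ⬝ᵥ (E o *ᵥ w)).re ≤
      2 * vnorm (v - w) := by
  set F := ∑ o ∈ S, E o with hF
  have hre : ∀ u : ι → ℂ, ∑ o ∈ S, (star u ⬝ᵥ (E o *ᵥ u)).re = (star u ⬝ᵥ (F *ᵥ u)).re := by
    intro u
    rw [hF, Matrix.sum_mulVec, dotProduct_sum, Complex.re_sum]
  have hF0 : 0 ≤ F := by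
    rw [Matrix.le_iff, sub_zero]
    exact Matrix.posSemidef_sum _ fun o _ => hE o
  have hF1 : F ≤ 1 := by
    classical
    rw [Matrix.le_iff, ← hsum, hF, ← Finset.sum_sdiff (Finset.subset_univ S), add_sub_cancel_right]
    exact Matrix.posSemidef_sum _ fun o _ => hE o
  have hFn : ‖F‖ ≤ 1 := by
    exact (CStarAlgebra.norm_le_one_iff_of_nonneg F hF0).2 hF1
  rw [hre, hre, ← Complex.sub_re]
  have h : star v ⬝ᵥ (F *ᵥ v) - star w ⬝ᵥ (F *ᵥ w) =
      star v ⬝ᵥ (F *ᵥ (v - w)) + star (v - w) ⬝ᵥ (F *ᵥ w) := by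
    rw [Matrix.mulVec_sub, dotProduct_sub, star_sub, sub_dotProduct]
    ring
  rw [h]
  refine (Complex.re_le_norm _).trans ((norm_add_le _ _).trans ?_)
  have b1 : ‖star v ⬝ᵥ (F *ᵥ (v - w))‖ ≤ vnorm (v - w) := by
    refine (norm_dotProduct_le _ _).trans ?_
    rw [hv, one_mul]
    refine (vnorm_mulVec_le _ _).trans ?_
    nlinarith [vnorm_nonneg (v - w)]
  have b2 : ‖star (v - w) ⬝ᵥ (F *ᵥ w)‖ ≤ vnorm (v - w) := by
    refine (norm_dotProduct_le _ _).trans ?_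
    have := (vnorm_mulVec_le F w)
    rw [hw, mul_one] at this
    nlinarith [vnorm_nonneg (v - w)]
  linarith

end Measurement
end UnitaryLearning

namespace UnitaryLearning
open scoped Matrix Kronecker ComplexOrder Matrix.Norms.L2Operator

/-! ### Elementary gates and the Toffoli gate -/

section Gates
variable {n : ℕ}

/-- The two-qubit matrix that applies `M p` to the second qubit when the first one is `p`. -/
def ctrlMat (M : Fin 2 → Matrix (Fin 2) (Fin 2) ℂ) : Matrix (Fin 2 × Fin 2) (Fin 2 × Fin 2) ℂ :=
  Matrix.of fun p q => if p.1 = q.1 then M p.1 p.2 q.2 else 0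

lemma ctrlMat_mem_unitaryGroup {M : Fin 2 → Matrix (Fin 2) (Fin 2) ℂ}
    (hM : ∀ p, M p * (M p)ᴴ = 1) : ctrlMat M ∈ Matrix.unitaryGroup (Fin 2 × Fin 2) ℂ := by
  rw [Matrix.mem_unitaryGroup_iff]
  ext ⟨p, s⟩ ⟨q, t⟩
  have h := congrFun (congrFun (hM p) s) t
  simp only [Matrix.mul_apply, Matrix.conjTranspose_apply] at h
  rw [Matrix.mul_apply, Fintype.sum_prod_type, Finset.sum_eq_single p]
  · by_cases hpq : p = q
    · subst hpq
      simpa [ctrlMat, Matrix.one_apply] using h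
    · have : ¬ q = p := fun h => hpq h.symm
      simp [ctrlMat, hpq, this]
  · intro r _ hr
    have : ¬ p = r := fun h => hr h.symm
    simp [ctrlMat, this]
  · simp

/-- Apply to qubit `t` a matrix that may depend on the basis state. -/
def targetOp (t : Fin n) (g : Qubits n → Matrix (Fin 2) (Fin 2) ℂ) :
    Matrix (Qubits n) (Qubits n) ℂ :=
  Matrix.of fun x y => if ∀ k, k ≠ t → x k = y k then g x (x t) (y t) else 0

lemma targetOp_mulVec (t : Fin n) (g : Qubits n → Matrix (Fin 2) (Fin 2) ℂ) (ψ : Qubits n → ℂ)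
    (x : Qubits n) :
    (targetOp t g *ᵥ ψ) x = ∑ s, g x (x t) s * ψ (Function.update x t s) := by
  rw [Matrix.mulVec, dotProduct]
  symm
  refine Fintype.sum_of_injective (fun s => Function.update x t s)
    (Function.update_injective x t) _ _ ?_ ?_
  · intro y hy
    rw [targetOp, Matrix.of_apply, if_neg, zero_mul]
    intro h
    refine hy ⟨y t, ?_⟩
    funext k
    by_cases hk : k = t
    · subst hk; simp
    · simp [hk, h k hk]
  · intro s
    rw [targetOp, Matrix.of_apply, if_pos]
    · simp
    · intro k hk
      simp [hk]

lemma targetOp_mul (t : Fin n) (g h : Qubits n → Matrix (Fin 2) (Fin 2) ℂ)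
    (hh : ∀ x s, h (Function.update x t s) = h x) :
    targetOp t g * targetOp t h = targetOp t fun x => g x * h x := by
  refine Matrix.ext_of_mulVec_single fun y => ?_
  generalize (Pi.single y (1 : ℂ) : Qubits n → ℂ) = ψ
  funext x
  rw [← Matrix.mulVec_mulVec]
  simp only [targetOp_mulVec, hh, Function.update_self, Function.update_idem, Matrix.mul_apply,
    Finset.sum_mul, Finset.mul_sum]
  rw [Finset.sum_comm]
  simp only [mul_assoc]

/-- Relabelling of the computational basis. -/
def permOp (f : Qubits n → Qubits n) : Matrix (Qubits n) (Qubits n) ℂ :=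
  Matrix.of fun x y => if f x = y then 1 else 0

lemma permOp_mulVec (f : Qubits n → Qubits n) (ψ : Qubits n → ℂ) (x : Qubits n) :
    (permOp f *ᵥ ψ) x = ψ (f x) := by
  simp [Matrix.mulVec, dotProduct, permOp]

/-- These operators act on amplitudes by precomposition, so the order is reversed. -/
lemma permOp_mul (f g : Qubits n → Qubits n) : permOp f * permOp g = permOp (g ∘ f) := by
  refine Matrix.ext_of_mulVec_single fun y => ?_
  generalize (Pi.single y (1 : ℂ) : Qubits n → ℂ) = ψ
  funext x
  rw [← Matrix.mulVec_mulVec]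
  simp [permOp_mulVec]

/-- The hypotheses say that `f` undoes itself even if qubit `t` is changed in between. Conjugation
then only changes the state that controls the operation on `t`. -/
lemma permOp_mul_targetOp_mul (f : Qubits n → Qubits n) (t : Fin n)
    (g : Qubits n → Matrix (Fin 2) (Fin 2) ℂ) (hf : ∀ x s, f (Function.update (f x) t s) =
      Function.update x t s) (hft : ∀ x, f x t = x t) :
    permOp f * targetOp t g * permOp f = targetOp t (g ∘ f) := by
  refine Matrix.ext_of_mulVec_single fun y => ?_
  generalize (Pi.single y (1 : ℂ) : Qubits n → ℂ) = ψ
  funext x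
  rw [mul_assoc, ← Matrix.mulVec_mulVec, ← Matrix.mulVec_mulVec, permOp_mulVec, targetOp_mulVec,
    targetOp_mulVec]
  simp [permOp_mulVec, hf, hft]

lemma permOp_mul_diagonal (f : Qubits n → Qubits n) (u : Qubits n → ℂ) :
    permOp f * Matrix.diagonal u = Matrix.diagonal (u ∘ f) * permOp f := by
  ext x y
  rw [Matrix.mul_diagonal, Matrix.diagonal_mul]
  by_cases h : f x = y
  · subst h; simp [permOp]
  · simp [permOp, h]

lemma permOp_id : permOp (id : Qubits n → Qubits n) = 1 := by
  ext x y
  simp [permOp, Matrix.one_apply]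

/-- `W` is a product of `G` two-qubit gates. -/
def IsGateProduct (G : ℕ) (W : Matrix (Qubits n) (Qubits n) ℂ) : Prop :=
  ∃ gates : List (Matrix (Qubits n) (Qubits n) ℂ),
    gates.length = G ∧ (∀ W ∈ gates, IsTwoQubitGate W) ∧ gates.prod = W

lemma IsGateProduct.mul {G H : ℕ} {V W : Matrix (Qubits n) (Qubits n) ℂ} (hV : IsGateProduct G V)
    (hW : IsGateProduct H W) : IsGateProduct (G + H) (V * W) := by
  obtain ⟨l, rfl, hl, rfl⟩ := hV
  obtain ⟨m, rfl, hm, rfl⟩ := hW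
  refine ⟨l ++ m, by simp, ?_, by simp⟩
  intro W hW
  rcases List.mem_append.1 hW with h | h
  exacts [hl W h, hm W h]

lemma IsTwoQubitGate.isGateProduct {W : Matrix (Qubits n) (Qubits n) ℂ} (hW : IsTwoQubitGate W) :
    IsGateProduct 1 W := ⟨[W], by simp, by simpa using hW, by simp⟩

lemma isTwoQubitGate_targetOp {i t : Fin n} (hit : i ≠ t) (M : Fin 2 → Matrix (Fin 2) (Fin 2) ℂ)
    (hM : ∀ p, M p * (M p)ᴴ = 1) : IsTwoQubitGate (targetOp t fun x => M (x i)) := by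
  refine ⟨i, t, hit, ⟨ctrlMat M, ctrlMat_mem_unitaryGroup hM⟩, ?_⟩
  ext x y
  simp only [targetOp, onPair, ctrlMat, Matrix.of_apply]
  by_cases h : ∀ k, k ≠ t → x k = y k
  · rw [if_pos h, if_pos (fun k _ hk => h k hk), if_pos (h i hit)]
  · rw [if_neg h]
    split_ifs with h1 h2
    · refine absurd (fun k hk => ?_) h
      by_cases hki : k = i
      · rw [hki]; exact h2
      · exact h1 k hki hk
    · rfl
    · rfl

lemma targetOp_diagonal (t : Fin n) (u : Qubits n → Fin 2 → ℂ) :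
    targetOp t (fun x => Matrix.diagonal (u x)) = Matrix.diagonal fun x => u x (x t) := by
  refine Matrix.ext_of_mulVec_single fun y => ?_
  generalize (Pi.single y (1 : ℂ) : Qubits n → ℂ) = ψ
  funext x
  rw [targetOp_mulVec, Matrix.mulVec_diagonal, Finset.sum_eq_single (x t)]
  · simp
  · intro s _ hs
    rw [Matrix.diagonal_apply_ne _ hs.symm, zero_mul]
  · simp

lemma isTwoQubitGate_diagonal {i t : Fin n} (hit : i ≠ t) (u : Fin 2 → Fin 2 → ℂ)
    (hu : ∀ p q, ‖u p q‖ = 1) : IsTwoQubitGate (Matrix.diagonal fun x : Qubits n => u (x i) (x t)) := by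
  rw [← targetOp_diagonal t fun x => u (x i)]
  refine isTwoQubitGate_targetOp hit (fun p => Matrix.diagonal (u p)) fun p => ?_
  rw [Matrix.diagonal_conjTranspose, Matrix.diagonal_mul_diagonal, ← Matrix.diagonal_one]
  congr 1
  funext q
  rw [Pi.star_apply, Complex.star_def, Complex.mul_conj, Complex.normSq_eq_norm_sq, hu]
  simp

lemma isTwoQubitGate_one (hn : 2 ≤ n) : IsTwoQubitGate (1 : Matrix (Qubits n) (Qubits n) ℂ) := by
  have h := isTwoQubitGate_diagonal (n := n) (i := ⟨0, by omega⟩) (t := ⟨1, by omega⟩)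
    (by simp [Fin.ext_iff]) (fun _ _ => 1) (by simp)
  simpa using h

/-- Pad with identity gates, which exist because there are two distinct qubits. All later gate
counts can therefore be upper bounds. -/
lemma IsGateProduct.mono (hn : 2 ≤ n) {G H : ℕ} (hGH : G ≤ H) {W : Matrix (Qubits n) (Qubits n) ℂ}
    (hW : IsGateProduct G W) : IsGateProduct H W := by
  obtain ⟨k, rfl⟩ := Nat.exists_eq_add_of_le hGH
  clear hGH
  induction k with
  | zero => exact hW
  | succ k ih =>
    have := ih.mul (isTwoQubitGate_one hn).isGateProduct
    rwa [mul_one] at this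

/-- The matrix of the bit flip to the power `s`. -/
def flipMat (s : Fin 2) : Matrix (Fin 2) (Fin 2) ℂ :=
  Matrix.of fun p q => if q = p + s then 1 else 0

lemma flipMat_mul_conjTranspose (s : Fin 2) : flipMat s * (flipMat s)ᴴ = 1 := by
  ext p q
  fin_cases s <;> fin_cases p <;> fin_cases q <;>
    simp [flipMat, Matrix.mul_apply]

lemma targetOp_flipMat (t : Fin n) (f : Qubits n → Fin 2) :
    targetOp t (fun x => flipMat (f x)) =
      permOp fun x => Function.update x t (x t + f x) := by
  refine Matrix.ext_of_mulVec_single fun y => ?_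
  generalize (Pi.single y (1 : ℂ) : Qubits n → ℂ) = ψ
  funext x
  rw [targetOp_mulVec, permOp_mulVec]
  simp [flipMat]

/-- The matrices of `1` and of the square root of the bit flip. -/
noncomputable def sqrtFlip (s : Fin 2) : Matrix (Fin 2) (Fin 2) ℂ :=
  if s = 0 then 1 else !![(1 + Complex.I) / 2, (1 - Complex.I) / 2;
    (1 - Complex.I) / 2, (1 + Complex.I) / 2]

lemma sqrtFlip_mul_conjTranspose (s : Fin 2) : sqrtFlip s * (sqrtFlip s)ᴴ = 1 := by
  have hI : Complex.I ^ 2 = -1 := Complex.I_sq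
  ext p q
  fin_cases s <;> fin_cases p <;> fin_cases q <;>
    simp [sqrtFlip, Matrix.mul_apply, Fin.sum_univ_two, Complex.conj_ofNat] <;> ring_nf <;>
    simp [hI] <;> norm_num

lemma sqrtFlip_conjTranspose_mul (s : Fin 2) : (sqrtFlip s)ᴴ * sqrtFlip s = 1 :=
  mul_eq_one_comm.1 (sqrtFlip_mul_conjTranspose s)

/-- Writing `V` for the root of the flip, the left side is `V` to the power `p + q - (p xor q) =
2pq`, and `V²` is the flip. -/
lemma sqrtFlip_identity (p q : Fin 2) :
    sqrtFlip p * (sqrtFlip (p + q))ᴴ * sqrtFlip q = flipMat (q * p) := by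
  have hI : Complex.I ^ 2 = -1 := Complex.I_sq
  have h0 : sqrtFlip 0 = 1 := by simp [sqrtFlip]
  have hf0 : flipMat 0 = 1 := by
    ext p q
    fin_cases p <;> fin_cases q <;> simp [flipMat]
  have h11 : (1 : Fin 2) + 1 = 0 := rfl
  fin_cases p <;> fin_cases q
  · simp [h0, hf0]
  · simp [h0, hf0, sqrtFlip_conjTranspose_mul]
  · simp [h0, hf0, sqrtFlip_mul_conjTranspose]
  · simp only [Fin.mk_one, h11, h0]
    ext p q
    fin_cases p <;> fin_cases q <;>
    simp [sqrtFlip, flipMat, Matrix.mul_apply, Fin.sum_univ_two] <;> ring_nf <;> simp [hI] <;> norm_num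

/-- A bit flip controlled by a function of one qubit. -/
lemma isGateProduct_controlledFlip {c t : Fin n} (hct : c ≠ t) (χ : Fin 2 → Fin 2) :
    IsGateProduct 1 (permOp fun x : Qubits n => Function.update x t (x t + χ (x c))) := by
  rw [← targetOp_flipMat]
  exact (isTwoQubitGate_targetOp hct (fun p => flipMat (χ p))
    fun p => flipMat_mul_conjTranspose _).isGateProduct

/-- A Toffoli gate. -/
lemma isGateProduct_toffoli {c b t : Fin n} (hct : c ≠ t) (hbt : b ≠ t) (hcb : c ≠ b)
    (χ : Fin 2 → Fin 2) :
    IsGateProduct 5 (permOp fun x : Qubits n => Function.update x t (x t + χ (x c) * x b)) := by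
  set f : Qubits n → Qubits n := fun x => Function.update x b (x b + χ (x c)) with hf
  have h2 : ∀ p : Fin 2, p + p = 0 := by decide
  have hF := isGateProduct_controlledFlip hcb χ
  have hA := (isTwoQubitGate_targetOp hbt sqrtFlip sqrtFlip_mul_conjTranspose).isGateProduct
  have hB := (isTwoQubitGate_targetOp hbt (fun p => (sqrtFlip p)ᴴ)
    (fun p => by rw [Matrix.conjTranspose_conjTranspose, sqrtFlip_conjTranspose_mul])).isGateProduct
  have hC := (isTwoQubitGate_targetOp hct (fun p => sqrtFlip (χ p))
    (fun p => sqrtFlip_mul_conjTranspose _)).isGateProduct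
  -- Conjugating the inverse root by the controlled flip replaces its control `b` by the sum of `b`
  -- and `χ(c)`; `sqrtFlip_identity` then collapses the three roots into a flip controlled by the
  -- product.
  have hall := (hA.mul ((hF.mul hB).mul hF)).mul hC
  convert hall using 1
  rw [permOp_mul_targetOp_mul, targetOp_mul, targetOp_mul, ← targetOp_flipMat]
  · congr 1
    funext x
    simp only [Function.comp, Function.update_self]
    rw [sqrtFlip_identity]
  · intro x s
    simp [hct]
  · intro x s
    simp [Function.comp, hct, hbt]
  · intro x s
    funext k
    by_cases hkt : k = t
    · subst hkt; simp [hbt.symm]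
    · by_cases hkb : k = b
      · subst hkb
        simp [hkt, hct, hcb, add_assoc, h2]
      · simp [hkt, hkb]
  · intro x
    simp [hbt.symm]

end Gates
end UnitaryLearning

namespace UnitaryLearning
open scoped Matrix Kronecker ComplexOrder Matrix.Norms.L2Operator

/-! ### Multiply controlled flips with dirty ancillas -/

section Ladder
variable {n : ℕ} (c d : ℕ → Fin n) (χ : ℕ → Fin 2 → Fin 2)

/-- The conjunction of the first `i + 1` controls. -/
def conj (i : ℕ) (x : Qubits n) : Fin 2 := ∏ l ∈ Finset.range (i + 1), χ l (x (c l))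

/-- Add to the `j`-th target the product of the `j`-th control and the previous target. -/
def rung (j : ℕ) (x : Qubits n) : Qubits n :=
  Function.update x (d (j + 1)) (x (d (j + 1)) + χ (j + 1) (x (c (j + 1))) * x (d j))

/-- A ladder of Toffoli gates with dirty ancillas. -/
def ladder : ℕ → Qubits n → Qubits n
  | 0 => fun x => Function.update x (d 0) (x (d 0) + χ 0 (x (c 0)))
  | j + 1 => rung c d χ j ∘ ladder j ∘ rung c d χ j

variable {c d}

lemma conj_congr {i : ℕ} {x y : Qubits n} (h : ∀ l ≤ i, x (c l) = y (c l)) :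
    conj c χ i x = conj c χ i y :=
  Finset.prod_congr rfl fun l hl => by rw [h l (by simpa [Nat.lt_succ_iff] using hl)]

/-- The outer rungs add to `d (j + 1)` the `(j + 1)`-st control times `d j`, once before and once
after the inner ladder has added `conj j` to `d j`. Modulo 2 the unknown content of `d j` cancels,
and the control times `conj j` remains; so the ancillas may start in any state. -/
lemma ladder_apply (j : ℕ) (hcd : ∀ i ≤ j, ∀ l ≤ j, c i ≠ d l)
    (hd : ∀ i ≤ j, ∀ l ≤ j, d i = d l → i = l) (x : Qubits n) :
    (∀ i ≤ j, ladder c d χ j x (d i) = x (d i) + conj c χ i x) ∧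
      ∀ y, (∀ i ≤ j, y ≠ d i) → ladder c d χ j x y = x y := by
  induction j generalizing x with
  | zero =>
    refine ⟨fun i hi => ?_, fun y hy => ?_⟩
    · obtain rfl : i = 0 := by omega
      simp [ladder, conj]
    · simp [ladder, hy 0 le_rfl]
  | succ j ih =>
    have ih' := fun x => ih (fun i hi l hl => hcd i (by omega) l (by omega))
      (fun i hi l hl => hd i (by omega) l (by omega)) x
    set x₁ := rung c d χ j x with hx₁
    set x₂ := ladder c d χ j x₁ with hx₂
    have hL : ladder c d χ (j + 1) x = rung c d χ j x₂ := rfl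
    have e1 : ∀ y, y ≠ d (j + 1) → x₁ y = x y := fun y hy => by simp [hx₁, rung, hy]
    have e1' : x₁ (d (j + 1)) = x (d (j + 1)) + χ (j + 1) (x (c (j + 1))) * x (d j) := by
      simp [hx₁, rung]
    have hdd : ∀ i ≤ j, d i ≠ d (j + 1) := fun i hi h => by
      have := hd i (by omega) (j + 1) le_rfl h
      omega
    have e2 : ∀ i ≤ j, x₂ (d i) = x (d i) + conj c χ i x := fun i hi => by
      rw [hx₂, (ih' x₁).1 i hi, e1 _ (hdd i hi), conj_congr χ fun l hl =>
        e1 _ (hcd l (by omega) (j + 1) le_rfl)]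
    have e3 : ∀ y, (∀ i ≤ j, y ≠ d i) → x₂ y = x₁ y := fun y hy => (ih' x₁).2 y hy
    have e4 : x₂ (c (j + 1)) = x (c (j + 1)) := by
      rw [e3 _ fun i hi => hcd (j + 1) le_rfl i (by omega), e1 _ (hcd (j + 1) le_rfl (j + 1) le_rfl)]
    refine ⟨fun i hi => ?_, fun y hy => ?_⟩
    · rw [hL]
      rcases Nat.lt_or_ge j i with h | h
      · obtain rfl : i = j + 1 := by omega
        rw [rung, Function.update_self, e3 _ fun i hi => (hdd i hi).symm, e1', e4, e2 j le_rfl]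
        have hP : conj c χ (j + 1) x = conj c χ j x * χ (j + 1) (x (c (j + 1))) :=
          Finset.prod_range_succ _ _
        rw [hP]
        generalize χ (j + 1) (x (c (j + 1))) = p
        generalize x (d (j + 1)) = q
        generalize x (d j) = r
        generalize conj c χ j x = s
        revert p q r s
        decide
      · rw [rung, Function.update_of_ne (hdd i h), e2 i h]
    · rw [hL, rung, Function.update_of_ne (hy _ le_rfl), e3 _ fun i hi => hy i (by omega),
        e1 _ (hy _ le_rfl)]

lemma isGateProduct_ladder (j : ℕ) (hcd : ∀ i ≤ j, ∀ l ≤ j, c i ≠ d l)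
    (hd : ∀ i ≤ j, ∀ l ≤ j, d i = d l → i = l) :
    IsGateProduct (1 + 10 * j) (permOp (ladder c d χ j)) := by
  induction j with
  | zero => exact isGateProduct_controlledFlip (hcd 0 le_rfl 0 le_rfl) (χ 0)
  | succ j ih =>
    have h1 := ih (fun i hi l hl => hcd i (by omega) l (by omega))
      (fun i hi l hl => hd i (by omega) l (by omega))
    have h2 : IsGateProduct 5 (permOp (rung c d χ j)) :=
      isGateProduct_toffoli (hcd _ le_rfl _ le_rfl) (fun h => by
        have := hd j (by omega) (j + 1) le_rfl h
        omega) (hcd _ le_rfl _ (by omega)) (χ (j + 1))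
    have h3 := (h2.mul h1).mul h2
    rw [permOp_mul, permOp_mul] at h3
    have e : 1 + 10 * (j + 1) = 5 + (1 + 10 * j) + 5 := by ring
    rw [e]
    exact h3

/-- A bit flip of the last target, controlled by `j + 1` qubits; the other targets are used as
ancillas and are restored. -/
lemma isGateProduct_multiControlledFlip (hn : 2 ≤ n) (j : ℕ) (hcd : ∀ i ≤ j, ∀ l ≤ j, c i ≠ d l)
    (hd : ∀ i ≤ j, ∀ l ≤ j, d i = d l → i = l) :
    IsGateProduct (20 * (j + 1))
      (permOp fun x => Function.update x (d j) (x (d j) + conj c χ j x)) := by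
  cases j with
  | zero =>
    have h : IsGateProduct (20 * (0 + 1)) (permOp (ladder c d χ 0)) :=
      (isGateProduct_ladder χ 0 hcd hd).mono hn (by norm_num)
    convert h using 2
    funext x
    simp [ladder, conj]
  | succ j =>
    have hcd' : ∀ i ≤ j, ∀ l ≤ j, c i ≠ d l := fun i hi l hl => hcd i (by omega) l (by omega)
    have hd' : ∀ i ≤ j, ∀ l ≤ j, d i = d l → i = l :=
      fun i hi l hl => hd i (by omega) l (by omega)
    -- The shorter ladder repeats what the longer one did to the targets before the last, and so
    -- restores them. The controls are never targets, hence both ladders see the same conjunctions.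
    have h := ((isGateProduct_ladder χ (j + 1) hcd hd).mul
      (isGateProduct_ladder χ j hcd' hd')).mono hn (show _ ≤ 20 * (j + 1 + 1) by omega)
    rw [permOp_mul] at h
    convert h using 2
    funext x y
    have hA := ladder_apply χ (j + 1) hcd hd x
    have hB := ladder_apply χ j hcd' hd' (ladder c d χ (j + 1) x)
    simp only [Function.comp]
    by_cases hy : ∃ i ≤ j, y = d i
    · obtain ⟨i, hi, rfl⟩ := hy
      have hne : d i ≠ d (j + 1) := fun h => by
        have := hd i (by omega) (j + 1) le_rfl h
        omega
      rw [Function.update_of_ne hne, hB.1 i hi, hA.1 i (by omega),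
        conj_congr χ (y := x) fun l hl => hA.2 _ fun i hi => hcd l (by omega) i hi]
      generalize conj c χ i x = p
      generalize x (d i) = q
      revert p q
      decide
    · push Not at hy
      rw [hB.2 y hy]
      by_cases hyt : y = d (j + 1)
      · subst hyt
        rw [hA.1 _ le_rfl, Function.update_self]
      · rw [Function.update_of_ne hyt, hA.2]
        intro i hi
        rcases Nat.lt_or_ge j i with h | h
        · obtain rfl : i = j + 1 := by omega
          exact hyt
        · exact hy i h

end Ladder
end UnitaryLearning

namespace UnitaryLearning
open scoped Matrix Kronecker ComplexOrder Matrix.Norms.L2Operator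

/-! ### Circuits for the hard instances -/

section HardFamily
variable {n : ℕ}

/-- The phase `e^{iθ}` on the basis state `11` of two qubits. -/
noncomputable def cornerPhase (θ : ℝ) (p q : Fin 2) : ℂ :=
  if p = 1 ∧ q = 1 then Complex.exp (θ * Complex.I) else 1

lemma norm_cornerPhase (θ : ℝ) (p q : Fin 2) : ‖cornerPhase θ p q‖ = 1 := by
  unfold cornerPhase
  split_ifs
  · exact Complex.norm_exp_ofReal_mul_I θ
  · simp

/-- The exponent is the mixed second difference of `θ` times the indicator of `11`. It vanishes
unless both bits are flipped; if both are, the four points exhaust the square, and `11` carries the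
plus sign exactly when `p = q`. -/
lemma cornerPhase_commutator (θ : ℝ) (p q : Fin 2) (P Q : Prop) [Decidable P] [Decidable Q] :
    cornerPhase θ p q * cornerPhase θ (p + if P then 1 else 0) (q + if Q then 1 else 0) *
      (cornerPhase (-θ) (p + if P then 1 else 0) q * cornerPhase (-θ) p (q + if Q then 1 else 0)) =
    if P ∧ Q then (if p = q then Complex.exp (θ * Complex.I) else Complex.exp (-(θ * Complex.I)))
      else 1 := by
  have h : Complex.exp (θ * Complex.I) * Complex.exp (-(θ * Complex.I)) = 1 := by
    rw [← Complex.exp_add]; simp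
  have h11 : (1 : Fin 2) + 1 = 0 := rfl
  by_cases hP : P <;> by_cases hQ : Q <;> fin_cases p <;> fin_cases q <;>
    simp [cornerPhase, hP, hQ, h, h11]
  rw [mul_mul_mul_comm, h, one_mul]

/-- The `i`-th qubit. -/
def qubit (hn : 0 < n) (i : ℕ) : Fin n := ⟨i % n, Nat.mod_lt _ hn⟩

lemma qubit_inj (hn : 0 < n) {i j : ℕ} (hi : i < n) (hj : j < n)
    (h : qubit hn i = qubit hn j) : i = j := by
  have := congrArg Fin.val h
  simpa [qubit, Nat.mod_eq_of_lt hi, Nat.mod_eq_of_lt hj] using this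

lemma conj_indicator (c : ℕ → Fin n) (κ : ℕ → Fin 2) (j : ℕ) (x : Qubits n)
    [∀ j, Decidable (∀ l ∈ Finset.range (j + 1), x (c l) = κ l)] :
    conj c (fun l s => if s = κ l then 1 else 0) j x =
      if ∀ l ∈ Finset.range (j + 1), x (c l) = κ l then 1 else 0 := by
  induction j with
  | zero => simp [conj]
  | succ j ih =>
    have hP : conj c (fun l s => if s = κ l then 1 else 0) (j + 1) x =
        conj c (fun l s => if s = κ l then 1 else 0) j x *
          (if x (c (j + 1)) = κ (j + 1) then 1 else 0) := Finset.prod_range_succ _ _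
    rw [hP, ih]
    have hiff : (∀ l ∈ Finset.range (j + 1 + 1), x (c l) = κ l) ↔
        (∀ l ∈ Finset.range (j + 1), x (c l) = κ l) ∧ x (c (j + 1)) = κ (j + 1) := by
      simp only [Finset.range_add_one (n := j + 1), Finset.forall_mem_insert, and_comm]
    by_cases h1 : ∀ l ∈ Finset.range (j + 1), x (c l) = κ l <;>
      by_cases h2 : x (c (j + 1)) = κ (j + 1)
    · rw [if_pos h1, if_pos h2, if_pos (hiff.2 ⟨h1, h2⟩)]; rfl
    · rw [if_neg h2, if_neg (fun h => h2 (hiff.1 h).2), if_pos h1]; rfl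
    · rw [if_neg h1, if_neg (fun h => h1 (hiff.1 h).1), if_pos h2]; rfl
    · rw [if_neg h1, if_neg (fun h => h1 (hiff.1 h).1), if_neg h2]; rfl

/-- The diagonal of a unitary that acts only on the marked basis states. -/
noncomputable def markedPhase {K : Type} [DecidableEq K] (mark : Qubits n → K) (a b : Fin n) (θ : ℝ)
    (κ : K) (x : Qubits n) : ℂ :=
  if mark x = κ then
    (if x a = x b then Complex.exp (θ * Complex.I) else Complex.exp (-(θ * Complex.I))) else 1

/-- Half of the marked qubits control a flip of `a`, the other half a flip of `b`, and a group
commutator of these flips with a two-qubit phase acts only where both controls fire. -/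
lemma isGateProduct_markedPhase (hn : 0 < n) (h : ℕ) (hh : 2 * h + 2 ≤ n) (θ : ℝ)
    (κ : Fin (2 * h) → Fin 2) :
    IsGateProduct (124 * h + 1) (Matrix.diagonal (markedPhase
      (fun (x : Qubits n) (l : Fin (2 * h)) => x (qubit hn l)) (qubit hn (2 * h))
        (qubit hn (2 * h + 1)) θ κ)) := by
  classical
  have hn2 : 2 ≤ n := by omega
  have hinj : ∀ i j, i < n → j < n → qubit hn i = qubit hn j → i = j :=
    fun i j hi hj => qubit_inj hn hi hj
  set a := qubit hn (2 * h) with ha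
  set b := qubit hn (2 * h + 1) with hb
  have hab : a ≠ b := fun e => by
    have := hinj _ _ (by omega) (by omega) e
    omega
  rcases Nat.eq_zero_or_pos h with rfl | hpos
  · have := (isTwoQubitGate_diagonal hab (fun p q => if p = q then Complex.exp (θ * Complex.I)
      else Complex.exp (-(θ * Complex.I))) (fun p q => by
        split_ifs
        · exact Complex.norm_exp_ofReal_mul_I θ
        · have := Complex.norm_exp_ofReal_mul_I (-θ)
          simpa using this)).isGateProduct
    convert this using 2
    funext x
    rw [markedPhase, if_pos]
    exact funext fun l => l.elim0
  obtain ⟨j, rfl⟩ : ∃ j, h = j + 1 := ⟨h - 1, by omega⟩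
  set κ' : ℕ → Fin 2 := fun l => if hl : l < 2 * (j + 1) then κ ⟨l, hl⟩ else 0 with hκ'
  set c₁ : ℕ → Fin n := fun i => qubit hn i with hc₁
  set c₂ : ℕ → Fin n := fun i => qubit hn (j + 1 + i) with hc₂
  -- Each half of the marked qubits serves as the dirty ancillas for the flip controlled by the
  -- other half. This is why the string has even length and no further qubits are needed.
  set d₁ : ℕ → Fin n := fun i => qubit hn (if i = j then 2 * (j + 1) else j + 1 + i) with hd₁
  set d₂ : ℕ → Fin n := fun i => qubit hn (if i = j then 2 * (j + 1) + 1 else i) with hd₂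
  have e₁ : d₁ j = a := by simp [hd₁, ha]
  have e₂ : d₂ j = b := by simp [hd₂, hb]
  have hM₁ := isGateProduct_multiControlledFlip (c := c₁) (d := d₁)
    (fun l s => if s = κ' l then 1 else 0) hn2 j
    (by
      intro i hi l hl e
      have := hinj _ _ (by omega) (by split_ifs <;> omega) e
      split_ifs at this <;> omega)
    (by
      intro i hi l hl e
      have := hinj _ _ (by split_ifs <;> omega) (by split_ifs <;> omega) e
      split_ifs at this <;> omega)
  have hM₂ := isGateProduct_multiControlledFlip (c := c₂) (d := d₂)
    (fun l s => if s = κ' (j + 1 + l) then 1 else 0) hn2 j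
    (by
      intro i hi l hl e
      have := hinj _ _ (by omega) (by split_ifs <;> omega) e
      split_ifs at this <;> omega)
    (by
      intro i hi l hl e
      have := hinj _ _ (by split_ifs <;> omega) (by split_ifs <;> omega) e
      split_ifs at this <;> omega)
  simp only [conj_indicator] at hM₁
  simp only [conj_indicator c₂ fun l => κ' (j + 1 + l)] at hM₂
  rw [e₁] at hM₁
  rw [e₂] at hM₂
  set P : Qubits n → Prop := fun x => ∀ l ∈ Finset.range (j + 1), x (c₁ l) = κ' l with hP
  set Q : Qubits n → Prop := fun x => ∀ l ∈ Finset.range (j + 1), x (c₂ l) = κ' (j + 1 + l) with hQ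
  set w₁ : Qubits n → Qubits n := fun x => Function.update x a (x a + if P x then 1 else 0) with hw₁
  set w₂ : Qubits n → Qubits n := fun x => Function.update x b (x b + if Q x then 1 else 0) with hw₂
  replace hM₁ : IsGateProduct (20 * (j + 1)) (permOp w₁) := hM₁
  replace hM₂ : IsGateProduct (20 * (j + 1)) (permOp w₂) := hM₂
  have hca : ∀ i < 2 * (j + 1), qubit hn i ≠ a := fun i hi e => by
    have := hinj _ _ (by omega) (by omega) e
    omega
  have hcb : ∀ i < 2 * (j + 1), qubit hn i ≠ b := fun i hi e => by
    have := hinj _ _ (by omega) (by omega) e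
    omega
  have hPw : ∀ x y : Qubits n, (∀ i < 2 * (j + 1), x (qubit hn i) = y (qubit hn i)) → (P x ↔ P y) := by
    intro x y hxy
    refine forall₂_congr fun l hl => ?_
    rw [Finset.mem_range] at hl
    rw [hxy l (by omega)]
  have hQw : ∀ x y : Qubits n, (∀ i < 2 * (j + 1), x (qubit hn i) = y (qubit hn i)) → (Q x ↔ Q y) := by
    intro x y hxy
    refine forall₂_congr fun l hl => ?_
    rw [Finset.mem_range] at hl
    rw [hxy (j + 1 + l) (by omega)]
  have hw₁c : ∀ x, ∀ i < 2 * (j + 1), w₁ x (qubit hn i) = x (qubit hn i) := fun x i hi => by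
    simp [hw₁, hca i hi]
  have hw₂c : ∀ x, ∀ i < 2 * (j + 1), w₂ x (qubit hn i) = x (qubit hn i) := fun x i hi => by
    simp [hw₂, hcb i hi]
  have h2 : ∀ p q : Prop, [Decidable p] → [Decidable q] → (p ↔ q) → ∀ s : Fin 2,
      s + (if p then 1 else 0) + (if q then 1 else 0) = s := by
    intro p q _ _ hpq s
    by_cases hp : p
    · rw [if_pos hp, if_pos (hpq.1 hp)]; revert s; decide
    · rw [if_neg hp, if_neg (fun h => hp (hpq.2 h))]; simp
  have hw₁₁ : w₁ ∘ w₁ = id := by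
    funext x y
    have := h2 (P x) (P (w₁ x)) ((hPw _ _ (hw₁c x)).symm) (x a)
    by_cases hy : y = a
    · subst hy
      simpa [hw₁] using this
    · simp [hw₁, hy]
  have hw₂₂ : w₂ ∘ w₂ = id := by
    funext x y
    have := h2 (Q x) (Q (w₂ x)) ((hQw _ _ (hw₂c x)).symm) (x b)
    by_cases hy : y = b
    · subst hy
      simpa [hw₂] using this
    · simp [hw₂, hy]
  set φ : ℝ → Qubits n → ℂ := fun θ x => cornerPhase θ (x a) (x b) with hφ
  have hφg : ∀ θ, IsGateProduct 1 (Matrix.diagonal (φ θ)) := fun θ =>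
    (isTwoQubitGate_diagonal hab (cornerPhase θ) (norm_cornerPhase θ)).isGateProduct
  have hall := (((((((((hφg θ).mul hM₁).mul hM₂).mul (hφg θ)).mul hM₂).mul (hφg (-θ))).mul
    hM₁).mul hM₂).mul (hφg (-θ))).mul hM₂
  -- Four phases and six multiply controlled flips: `120 h + 4`, which is at most `124 h + 1` once
  -- `h ≥ 1`.
  have hcount := hall.mono hn2 (show _ ≤ 124 * (j + 1) + 1 by omega)
  convert hcount using 1
  have hcomm : w₁ ∘ w₂ = w₂ ∘ w₁ := by
    funext x y
    have e1 : P (w₂ x) ↔ P x := hPw _ _ (hw₂c x)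
    have e2 : Q (w₁ x) ↔ Q x := hQw _ _ (hw₁c x)
    have e3 : w₂ x a = x a := by simp [hw₂, hab]
    have e4 : w₁ x b = x b := by simp [hw₁, hab.symm]
    have l1 : w₁ (w₂ x) = Function.update (w₂ x) a (x a + if P x then 1 else 0) := by
      simp only [hw₁, e3]
      simp only [e1]
    have l2 : w₂ (w₁ x) = Function.update (w₁ x) b (x b + if Q x then 1 else 0) := by
      simp only [hw₂, e4]
      simp only [e2]
    simp only [Function.comp]
    rw [l1, l2]
    simp only [hw₁, hw₂]
    rw [Function.update_comm hab]
  have k1 : permOp w₁ * permOp w₁ = 1 := by rw [permOp_mul, hw₁₁, permOp_id]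
  have k2 : permOp w₂ * permOp w₂ = 1 := by rw [permOp_mul, hw₂₂, permOp_id]
  have k3 : permOp w₁ * permOp w₂ = permOp w₂ * permOp w₁ := by rw [permOp_mul, permOp_mul, hcomm]
  have c1 : ∀ u : Qubits n → ℂ, permOp w₁ * Matrix.diagonal u * permOp w₁ =
      Matrix.diagonal (u ∘ w₁) := fun u => by rw [permOp_mul_diagonal, mul_assoc, k1, mul_one]
  have c2 : ∀ u : Qubits n → ℂ, permOp w₂ * Matrix.diagonal u * permOp w₂ =
      Matrix.diagonal (u ∘ w₂) := fun u => by rw [permOp_mul_diagonal, mul_assoc, k2, mul_one]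
  -- Bracketed in this way the word is a product of conjugated diagonals, with entry `φ θ x · φ θ
  -- (w₂ (w₁ x)) · φ (-θ) (w₁ x) · φ (-θ) (w₂ x)` at `x`, the commutator of
  -- `cornerPhase_commutator`.
  have hprod : Matrix.diagonal (φ θ) * permOp w₁ * permOp w₂ * Matrix.diagonal (φ θ) * permOp w₂ *
      Matrix.diagonal (φ (-θ)) * permOp w₁ * permOp w₂ * Matrix.diagonal (φ (-θ)) * permOp w₂ =
      Matrix.diagonal (φ θ) * (permOp w₁ * (permOp w₂ * Matrix.diagonal (φ θ) * permOp w₂) *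
      Matrix.diagonal (φ (-θ)) * permOp w₁) * (permOp w₂ * Matrix.diagonal (φ (-θ)) * permOp w₂) := by
    simp only [mul_assoc]
  have hprod2 : permOp w₁ * Matrix.diagonal (φ θ ∘ w₂) * Matrix.diagonal (φ (-θ)) * permOp w₁ =
      Matrix.diagonal ((fun x => (φ θ ∘ w₂) x * φ (-θ) x) ∘ w₁) := by
    rw [← c1, mul_assoc (permOp w₁), Matrix.diagonal_mul_diagonal]
  rw [hprod, c2, c2, hprod2, Matrix.diagonal_mul_diagonal, Matrix.diagonal_mul_diagonal]
  congr 1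
  funext x
  have e3 : w₂ x a = x a := by simp [hw₂, hab]
  have e4 : w₁ x b = x b := by simp [hw₁, hab.symm]
  have e5 : w₁ x a = x a + if P x then 1 else 0 := by simp [hw₁]
  have e6 : w₂ x b = x b + if Q x then 1 else 0 := by simp [hw₂]
  have e7 : w₂ (w₁ x) a = x a + if P x then 1 else 0 := by
    rw [← e5]; simp [hw₂, hab]
  have e8 : w₂ (w₁ x) b = x b + if Q x then 1 else 0 := by
    have : w₂ (w₁ x) = w₁ (w₂ x) := (congrFun hcomm x).symm
    rw [this, ← e6]; simp [hw₁, hab.symm]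
  simp only [Function.comp, hφ, e3, e4, e5, e6, e7, e8]
  have hc := cornerPhase_commutator θ (x a) (x b) (P x) (Q x)
  rw [← mul_assoc] at hc
  rw [← mul_assoc, hc, markedPhase]
  have hmark : ((fun l : Fin (2 * (j + 1)) => x (qubit hn l)) = κ) ↔ (P x ∧ Q x) := by
    constructor
    · intro e
      have e' : ∀ l (hl : l < 2 * (j + 1)), x (qubit hn l) = κ' l := fun l hl => by
        rw [hκ']
        simp only [hl, dif_pos]
        exact congrFun e ⟨l, hl⟩
      refine ⟨fun l hl => ?_, fun l hl => ?_⟩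
      · rw [Finset.mem_range] at hl
        exact e' l (by omega)
      · rw [Finset.mem_range] at hl
        exact e' (j + 1 + l) (by omega)
    · rintro ⟨hp, hq⟩
      funext l
      have hl := l.2
      have : x (qubit hn l) = κ' l := by
        rcases Nat.lt_or_ge (l : ℕ) (j + 1) with h | h
        · exact hp l (Finset.mem_range.2 h)
        · have := hq (l - (j + 1)) (Finset.mem_range.2 (by omega))
          simp only [hc₂] at this
          rwa [Nat.add_sub_cancel' h] at this
      rw [this, hκ']
      simp only [hl, dif_pos]
  by_cases hm : P x ∧ Q x
  · rw [if_pos hm, if_pos (hmark.2 hm)]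
  · rw [if_neg hm, if_neg (fun e => hm (hmark.1 e))]

end HardFamily
end UnitaryLearning

namespace UnitaryLearning
open scoped Matrix Kronecker ComplexOrder Matrix.Norms.L2Operator

/-! ### Separating the hard instances from the identity -/

section Distinguish
variable {n : ℕ}

lemma norm_entry_le_traceNorm {ι : Type} [Fintype ι] [DecidableEq ι] (A : Matrix ι ι ℂ) (i j : ι) :
    ‖A i j‖ ≤ traceNorm A := by
  refine le_of_sq_le_sq ?_ (traceNorm_nonneg A)
  refine le_trans ?_ (frobenius_le_traceNorm_sq A)
  calc ‖A i j‖ ^ 2 ≤ ∑ l, ‖A i l‖ ^ 2 :=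
        Finset.single_le_sum (f := fun l => ‖A i l‖ ^ 2) (fun _ _ => sq_nonneg _) (Finset.mem_univ j)
    _ ≤ _ := Finset.single_le_sum (f := fun i => ∑ l, ‖A i l‖ ^ 2)
        (fun _ _ => Finset.sum_nonneg fun _ _ => sq_nonneg _) (Finset.mem_univ i)

/-- A diagonal unitary moves the uniform superposition of two basis states. -/
lemma norm_sub_one_le_of_dDiamond {W H : QUnitary n} {u : Qubits n → ℂ}
    (hH : (H : Matrix (Qubits n) (Qubits n) ℂ) = Matrix.diagonal u) {ε : ℝ}
    (h1 : dDiamond W 1 ≤ ε) (h2 : dDiamond W H ≤ ε) {x y : Qubits n} (hxy : x ≠ y) :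
    ‖u x * star (u y) - 1‖ ≤ 4 * ε := by
  set φ : Qubits n × Fin 1 → ℂ := fun p => if p.1 = x ∨ p.1 = y then 1 else 0 with hφ
  set ρ : Matrix (Qubits n × Fin 1) (Qubits n × Fin 1) ℂ :=
    (1 / 2 : ℝ) • Matrix.vecMulVec φ (star φ) with hρ
  have hd : IsDensity ρ := by
    constructor
    · exact (Matrix.posSemidef_vecMulVec_self_star φ).smul (by norm_num : (0 : ℝ) ≤ 1 / 2)
    · rw [hρ, Matrix.trace_smul, Matrix.trace_vecMulVec, dotProduct, Fintype.sum_prod_type]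
      simp only [hφ, Pi.star_apply, Finset.univ_unique, Finset.sum_singleton]
      have : ∀ z : Qubits n, (if z = x ∨ z = y then (1 : ℂ) else 0) *
          star (if z = x ∨ z = y then (1 : ℂ) else 0) = (if z = x then 1 else 0) +
            (if z = y then 1 else 0) := by
        intro z
        by_cases hx : z = x
        · subst hx; simp [hxy]
        · by_cases hy : z = y
          · subst hy; simp [hx]
          · simp [hx, hy]
      simp only [this, Finset.sum_add_distrib, Finset.sum_ite_eq', Finset.mem_univ, if_true]
      rw [Complex.real_smul]
      push_cast
      norm_num
  have e1 := (norm_entry_le_traceNorm (extendedChannel W ρ - extendedChannel 1 ρ) (x, 0) (y, 0)).trans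
    ((traceNorm_le_dDiamond W 1 hd).trans h1)
  have e2 := (norm_entry_le_traceNorm (extendedChannel W ρ - extendedChannel H ρ) (x, 0) (y, 0)).trans
    ((traceNorm_le_dDiamond W H hd).trans h2)
  have hρxy : ρ (x, 0) (y, 0) = 1 / 2 := by
    simp [hρ, hφ, Matrix.vecMulVec_apply]
  have c1 : extendedChannel (1 : QUnitary n) ρ (x, 0) (y, 0) = 1 / 2 := by
    simp [extendedChannel, hρxy]
  have c2 : extendedChannel H ρ (x, 0) (y, 0) = u x * (1 / 2) * star (u y) := by
    rw [extendedChannel, hH, ← Matrix.diagonal_one, Matrix.diagonal_kronecker_diagonal,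
      Matrix.diagonal_conjTranspose, Matrix.mul_diagonal, Matrix.diagonal_mul, hρxy]
    simp
  -- The contribution of `W` to this off-diagonal entry is common to both differences and cancels;
  -- only the relative phase of `x` and `y` under `H` is left.
  have key : ‖u x * (1 / 2) * star (u y) - 1 / 2‖ ≤ 2 * ε := by
    have : u x * (1 / 2) * star (u y) - 1 / 2 =
        (extendedChannel W ρ - extendedChannel 1 ρ) (x, 0) (y, 0) -
          (extendedChannel W ρ - extendedChannel H ρ) (x, 0) (y, 0) := by
      rw [Matrix.sub_apply, Matrix.sub_apply, c1, c2]
      ring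
    rw [this]
    exact (norm_sub_le _ _).trans (by linarith)
  have h3 : u x * star (u y) - 1 = 2 * (u x * (1 / 2) * star (u y) - 1 / 2) := by ring
  rw [h3, norm_mul]
  simp only [Complex.norm_ofNat]
  linarith

end Distinguish

/-! ### Successful learning forces distant final states -/

namespace QueryAlgorithm
variable {n : ℕ} (A : QueryAlgorithm n)

open scoped Classical in
lemma successProb_eq (ε : ℝ) (U : QUnitary n) :
    A.successProb ε U = ∑ o ∈ Finset.univ.filter (fun o => dDiamond (A.guess o) U ≤ ε), A.prob U o := by
  rw [successProb, Finset.sum_filter]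

lemma prob_nonneg (U : QUnitary n) (o : A.Out) : 0 ≤ A.prob U o :=
  (A.povm_posSemidef o).re_dotProduct_nonneg _

lemma vnorm_state (U : QUnitary n) (t : ℕ) : vnorm (A.state U t) = 1 := by
  rw [state_eq_runState, vnorm_runState]
  have := vnorm_sq A.init
  rw [A.init_norm] at this
  exact (pow_eq_one_iff_of_nonneg (vnorm_nonneg _) two_ne_zero).1 this

lemma sum_prob (U : QUnitary n) : ∑ o, A.prob U o = 1 := by
  simp only [prob]
  rw [← Complex.re_sum, ← dotProduct_sum, ← Matrix.sum_mulVec, A.povm_sum, Matrix.one_mulVec,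
    dotProduct_self_eq, vnorm_state]
  simp

/-- Two unitaries that are learned but have no common approximation lead to distant states. -/
lemma one_sixth_le_vnorm_sub {ε : ℝ} {U V : QUnitary n} (hU : 2 / 3 ≤ A.successProb ε U)
    (hV : 2 / 3 ≤ A.successProb ε V)
    (hUV : ∀ W, ¬(dDiamond W U ≤ ε ∧ dDiamond W V ≤ ε)) :
    1 / 6 ≤ vnorm (A.state V A.queries - A.state U A.queries) := by
  classical
  rw [successProb_eq] at hU hV
  set S := Finset.univ.filter (fun o => dDiamond (A.guess o) U ≤ ε) with hS
  set S' := Finset.univ.filter (fun o => dDiamond (A.guess o) V ≤ ε) with hS'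
  have hdisj : Disjoint S S' := by
    rw [Finset.disjoint_filter]
    exact fun o _ h1 h2 => hUV _ ⟨h1, h2⟩
  have h1 : ∑ o ∈ S, A.prob U o + ∑ o ∈ S', A.prob U o ≤ 1 := by
    -- The two success events are disjoint, so the event for `V` has probability at most 1/3 under
    -- `U` and at least 2/3 under `V`; a gap of 1/3 needs distance 1/6.
    rw [← Finset.sum_union hdisj, ← A.sum_prob U]
    exact Finset.sum_le_univ_sum_of_nonneg fun o => A.prob_nonneg U o
  have h2 := sum_prob_sub_le A.povm A.povm_posSemidef A.povm_sum S' (A.vnorm_state V A.queries)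
    (A.vnorm_state U A.queries)
  have h3 : ∑ o ∈ S', A.prob V o - ∑ o ∈ S', A.prob U o ≤
    2 * vnorm (A.state V A.queries - A.state U A.queries) := h2
  linarith

end QueryAlgorithm

/-! ### The query lower bound -/

section LowerBound
variable {n : ℕ}

lemma norm_exp_mul_I_sub_one_le (θ : ℝ) : ‖Complex.exp (θ * Complex.I) - 1‖ ≤ |θ| := by
  rw [mul_comm, Complex.norm_exp_I_mul_ofReal_sub_one, norm_mul, Real.norm_eq_abs, Real.norm_eq_abs]
  have := Real.abs_sin_le_abs (x := θ / 2)
  rw [abs_div] at this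
  norm_num at this ⊢
  linarith

lemma norm_markedPhase_sub_one_le {K : Type} [DecidableEq K] (mark : Qubits n → K) (a b : Fin n)
    (θ : ℝ) (κ : K) (x : Qubits n) :
    ‖markedPhase mark a b θ κ x - 1‖ ≤ if mark x = κ then |θ| else 0 := by
  unfold markedPhase
  split_ifs
  · exact norm_exp_mul_I_sub_one_le θ
  · have := norm_exp_mul_I_sub_one_le (-θ)
    rw [abs_neg] at this
    simpa using this
  · simp

/-- The search lower bound: run the algorithm on the identity and record how much weight each query
puts on each mark. Telling the instance `κ` from the identity needs weight on `κ`, but each query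
has only total weight 1 to share among all marks. -/
lemma card_le_of_markedPhase {K : Type} [Fintype K] [DecidableEq K] (mark : Qubits n → K)
    (a b : Fin n) (hmark : ∀ κ, ∃ x y, mark x = κ ∧ mark y = κ ∧ x a = x b ∧ y a ≠ y b)
    {ε : ℝ} (hε : 0 < ε) (hε' : ε ≤ 1 / 4) (A : QueryAlgorithm n) (H : K → QUnitary n)
    (hH : ∀ κ, (H κ : Matrix (Qubits n) (Qubits n) ℂ) =
      Matrix.diagonal (markedPhase mark a b (4 * ε) κ))
    (hA1 : 2 / 3 ≤ A.successProb ε 1) (hA : ∀ κ, 2 / 3 ≤ A.successProb ε (H κ)) :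
    (Fintype.card K : ℝ) ≤ 24 * ε * A.queries * √(Fintype.card K) := by
  set θ := 4 * ε with hθ
  have hθ0 : 0 < θ := by positivity
  have hθ1 : θ ≤ 1 := by linarith
  -- Closeness to both unitaries would give `|e^{2iθ} - 1| = 2 sin θ ≤ 4ε`. The choice `θ = 4ε ≤ 1`
  -- excludes this, since `sin θ ≥ 2θ/π > θ/2`.
  have hsin : 2 * ε < Real.sin θ := by
    have h1 := Real.mul_le_sin hθ0.le (by linarith [Real.pi_gt_three] : θ ≤ Real.pi / 2)
    have h2 : 1 / 2 < 2 / Real.pi := by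
      rw [div_lt_div_iff₀ (by norm_num) Real.pi_pos]
      linarith [Real.pi_lt_four]
    nlinarith
  have hsep : ∀ κ W, ¬(dDiamond W 1 ≤ ε ∧ dDiamond W (H κ) ≤ ε) := by
    rintro κ W ⟨h1, h2⟩
    obtain ⟨x, y, hx, hy, hxe, hye⟩ := hmark κ
    have hne : x ≠ y := by rintro rfl; exact hye hxe
    have h3 := norm_sub_one_le_of_dDiamond (hH κ) h1 h2 hne
    simp only [markedPhase, hx, hy, if_true, hxe, hye, if_false] at h3
    rw [Complex.star_def, ← Complex.exp_conj] at h3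
    simp only [map_neg, map_mul, Complex.conj_ofReal, Complex.conj_I, mul_neg, neg_neg] at h3
    rw [← Complex.exp_add] at h3
    have e : (θ : ℂ) * Complex.I + θ * Complex.I = Complex.I * ((2 * θ : ℝ) : ℂ) := by
      push_cast; ring
    rw [e, Complex.norm_exp_I_mul_ofReal_sub_one, mul_div_cancel_left₀ _ (two_ne_zero),
      Real.norm_of_nonneg (by nlinarith)] at h3
    linarith
  have hdist : ∀ κ, 1 / 6 ≤ vnorm (A.state (H κ) A.queries - A.state 1 A.queries) :=
    fun κ => A.one_sixth_le_vnorm_sub hA1 (hA κ) (hsep κ)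
  set w : ℕ → K → ℝ := fun t κ => ∑ p : Qubits n × A.Anc,
    if mark p.1 = κ then ‖A.state 1 t p‖ ^ 2 else 0 with hw
  have hw0 : ∀ t κ, 0 ≤ w t κ := fun t κ => Finset.sum_nonneg fun p _ => by split_ifs <;> positivity
  have hw1 : ∀ t, ∑ κ, w t κ = 1 := by
    intro t
    rw [hw]
    simp only
    rw [Finset.sum_comm]
    simp only [Finset.sum_ite_eq, Finset.mem_univ, if_true]
    rw [← vnorm_sq, A.vnorm_state]
    norm_num
  have hstep : ∀ κ t, vnorm ((((H κ : Matrix (Qubits n) (Qubits n) ℂ) -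
        ((1 : QUnitary n) : Matrix (Qubits n) (Qubits n) ℂ)) ⊗ₖ (1 : Matrix A.Anc A.Anc ℂ)) *ᵥ
          A.state 1 t) ≤ θ * √(w t κ) := by
    intro κ t
    refine le_of_sq_le_sq ?_ (by positivity)
    rw [mul_pow, Real.sq_sqrt (hw0 t κ), vnorm_sq, hw, Finset.mul_sum]
    refine Finset.sum_le_sum fun p _ => ?_
    have e : (H κ : Matrix (Qubits n) (Qubits n) ℂ) -
        ((1 : QUnitary n) : Matrix (Qubits n) (Qubits n) ℂ) =
        Matrix.diagonal fun x => markedPhase mark a b θ κ x - 1 := by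
      rw [hH, Submonoid.coe_one, ← Matrix.diagonal_one, Matrix.diagonal_sub]
    rw [e, ← Matrix.diagonal_one, Matrix.diagonal_kronecker_diagonal, Matrix.mulVec_diagonal,
      norm_mul, mul_pow, mul_one]
    have h := norm_markedPhase_sub_one_le mark a b θ κ p.1
    split_ifs at h ⊢
    · rw [abs_of_pos hθ0] at h
      gcongr
    · have : ‖markedPhase mark a b θ κ p.1 - 1‖ = 0 := le_antisymm h (norm_nonneg _)
      rw [this]; simp
  have hhyb : ∀ κ, 1 / 6 ≤ ∑ t ∈ Finset.range A.queries, θ * √(w t κ) := by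
    intro κ
    refine (hdist κ).trans ?_
    rw [A.state_eq_runState, A.state_eq_runState]
    refine (vnorm_runState_sub_le _ _ _ _ _).trans (Finset.sum_le_sum fun t _ => ?_)
    rw [← A.state_eq_runState]
    exact hstep κ t
  have hsum := Finset.sum_le_sum fun κ (_ : κ ∈ (Finset.univ : Finset K)) => hhyb κ
  rw [Finset.sum_comm, Finset.sum_const, nsmul_eq_mul, Finset.card_univ] at hsum
  -- Cauchy–Schwarz against the constant 1, with total weight 1; this is the quadratic saving of
  -- quantum search, and the reason for `n/2` in the exponent.
  have hcs : ∀ t, ∑ κ, θ * √(w t κ) ≤ θ * √(Fintype.card K) := by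
    intro t
    rw [← Finset.mul_sum]
    refine mul_le_mul_of_nonneg_left ?_ hθ0.le
    have h := Real.sum_mul_le_sqrt_mul_sqrt (Finset.univ : Finset K) (fun _ => 1) fun κ => √(w t κ)
    simp only [one_mul, one_pow, Finset.sum_const, nsmul_eq_mul, mul_one, Finset.card_univ,
      Real.sq_sqrt (hw0 t _), hw1, Real.sqrt_one] at h
    exact h
  have hfin := hsum.trans (Finset.sum_le_sum fun t _ => hcs t)
  rw [Finset.sum_const, nsmul_eq_mul, Finset.card_range, hθ] at hfin
  linarith

/-- Learning `G`-gate unitaries takes exponentially many queries. -/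
theorem query_lower_bound {n G : ℕ} (hn : 2 ≤ n) (hG : 1 ≤ G) {ε : ℝ} (hε : 0 < ε)
    (hε' : ε ≤ 1 / 4) (A : QueryAlgorithm n) (hA : A.Learns G ε) :
    1 / 96 * ((2 : ℝ) ^ min ((G : ℝ) / (2 * 62)) ((n : ℝ) / 2) / ε) ≤ (A.queries : ℝ) := by
  -- The largest `h` allowed by `2h + 2 ≤ n` and `124 h + 1 ≤ G`.
  set h := min ((n - 2) / 2) ((G - 1) / 124) with hh
  have hh1 : 2 * h + 2 ≤ n := by omega
  have hh2 : 124 * h + 1 ≤ G := by omega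
  have hn0 : 0 < n := by omega
  set a := qubit hn0 (2 * h) with ha
  set b := qubit hn0 (2 * h + 1) with hb
  have hab : a ≠ b := fun e => by
    have := qubit_inj hn0 (by omega) (by omega) e
    omega
  set mark : Qubits n → (Fin (2 * h) → Fin 2) := fun x l => x (qubit hn0 l) with hmark
  have hunit : ∀ κ, Matrix.diagonal (markedPhase mark a b (4 * ε) κ) ∈
      Matrix.unitaryGroup (Qubits n) ℂ := by
    intro κ
    rw [Matrix.mem_unitaryGroup_iff, Matrix.star_eq_conjTranspose, Matrix.diagonal_conjTranspose,
      Matrix.diagonal_mul_diagonal, ← Matrix.diagonal_one]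
    congr 1
    funext x
    have : ‖markedPhase mark a b (4 * ε) κ x‖ = 1 := by
      unfold markedPhase
      split_ifs
      · exact Complex.norm_exp_ofReal_mul_I _
      · have := Complex.norm_exp_ofReal_mul_I (-(4 * ε))
        push_cast at this ⊢
        simpa using this
      · simp
    rw [Pi.star_apply, Complex.star_def, Complex.mul_conj, Complex.normSq_eq_norm_sq, this]
    simp
  have hcirc : ∀ κ, IsCircuit G (⟨_, hunit κ⟩ : QUnitary n) := fun κ =>
    (isGateProduct_markedPhase hn0 h hh1 (4 * ε) κ).mono hn hh2
  have hone : IsCircuit G (1 : QUnitary n) :=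
    (isTwoQubitGate_one hn).isGateProduct.mono hn hG
  have hcard := card_le_of_markedPhase mark a b (fun κ => by
    refine ⟨fun i => if hi : (i : ℕ) < 2 * h then κ ⟨i, hi⟩ else 0,
      fun i => if hi : (i : ℕ) < 2 * h then κ ⟨i, hi⟩ else if i = a then 1 else 0, ?_, ?_, ?_, ?_⟩
    · funext l
      have hl := l.2
      have : (qubit hn0 l : ℕ) = l := Nat.mod_eq_of_lt (by omega)
      simp [hmark, this]
    · funext l
      have hl := l.2
      have : (qubit hn0 l : ℕ) = l := Nat.mod_eq_of_lt (by omega)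
      simp [hmark, this]
    · have h1 : (a : ℕ) = 2 * h := Nat.mod_eq_of_lt (by omega)
      have h2 : (b : ℕ) = 2 * h + 1 := Nat.mod_eq_of_lt (by omega)
      simp [h1, h2]
    · have h1 : (a : ℕ) = 2 * h := Nat.mod_eq_of_lt (by omega)
      have h2 : (b : ℕ) = 2 * h + 1 := Nat.mod_eq_of_lt (by omega)
      simp [h1, h2, hab.symm]) hε hε' A (fun κ => ⟨_, hunit κ⟩) (fun κ => rfl) (hA 1 hone)
    (fun κ => hA _ (hcirc κ))
  have hK : (Fintype.card (Fin (2 * h) → Fin 2) : ℝ) = ((2 : ℝ) ^ h) ^ 2 := by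
    rw [Fintype.card_fun, Fintype.card_fin, Fintype.card_fin, ← pow_mul, mul_comm h 2]
    norm_cast
  rw [hK, Real.sqrt_sq (by positivity), pow_two] at hcard
  have h2h : (2 : ℝ) ^ h ≤ 24 * ε * A.queries := le_of_mul_le_mul_right hcard (by positivity)
  -- Rounding down costs at most 2 in the exponent; the factor 4 and the earlier 24 give the
  -- constant 96.
  have hexp : (2 : ℝ) ^ min ((G : ℝ) / (2 * 62)) ((n : ℝ) / 2) ≤ 2 ^ h * 4 := by
    have e : (2 : ℝ) ^ h * 4 = (2 : ℝ) ^ ((h : ℝ) + 2) := by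
      rw [Real.rpow_add (by norm_num), Real.rpow_natCast]
      norm_num
    rw [e]
    refine Real.rpow_le_rpow_of_exponent_le (by norm_num) ?_
    rcases min_choice ((n - 2) / 2) ((G - 1) / 124) with hc | hc
    · refine (min_le_right _ _).trans ?_
      have h1 : n ≤ 2 * h + 4 := by omega
      have h2 : (n : ℝ) ≤ 2 * h + 4 := by exact_mod_cast h1
      linarith
    · refine (min_le_left _ _).trans ?_
      have h1 : G ≤ 124 * h + 248 := by omega
      have h2 : (G : ℝ) ≤ 124 * h + 248 := by exact_mod_cast h1
      linarith
  rw [← mul_div_assoc, div_le_iff₀ hε]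
  linarith

end LowerBound
end UnitaryLearning

namespace UnitaryLearning
open scoped Matrix Kronecker ComplexOrder Matrix.Norms.L2Operator

/-! ### Extending isometries to unitaries -/

section Completion

/-- An isometry extends to a unitary along an injection of the index types. -/
lemma exists_unitary_extending {I K : Type} [Fintype I] [DecidableEq I] [Fintype K] [DecidableEq K]
    (e : K ↪ I) {J : Matrix I K ℂ} (hJ : Jᴴ * J = 1) :
    ∃ B : Matrix.unitaryGroup I ℂ, ∀ i k, (B : Matrix I I ℂ) i (e k) = J i k := by
  classical
  let v : I → EuclideanSpace ℂ I := fun i =>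
    if h : ∃ k, e k = i then WithLp.toLp 2 (fun j => J j h.choose) else 0
  have hv : ∀ k, v (e k) = WithLp.toLp 2 (fun j => J j k) := by
    intro k
    have h : ∃ k', e k' = e k := ⟨k, rfl⟩
    have h2 : h.choose = k := e.injective h.choose_spec
    simp only [v, dif_pos h, h2]
  have ho : Orthonormal ℂ ((Set.range e).domRestrict v) := by
    rw [orthonormal_iff_ite]
    rintro ⟨_, k, rfl⟩ ⟨_, l, rfl⟩
    change inner ℂ (v (e k)) (v (e l)) = _
    rw [hv, hv, ← dotProduct_eq_inner]
    have h := congrFun (congrFun hJ k) l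
    rw [Matrix.mul_apply, Matrix.one_apply] at h
    have h3 : ((⟨e k, k, rfl⟩ : Set.range e) = ⟨e l, l, rfl⟩) ↔ k = l := by
      refine ⟨fun h => e.injective (congrArg Subtype.val h), ?_⟩
      rintro rfl
      rfl
    rw [if_congr h3 rfl rfl, ← h]
    rfl
  obtain ⟨b, hb⟩ := ho.exists_orthonormalBasis_extension_of_card_eq (by simp)
  refine ⟨⟨Matrix.of fun i j => (b j).ofLp i, ?_⟩, fun i k => ?_⟩
  · rw [Matrix.mem_unitaryGroup_iff']
    ext i j
    rw [Matrix.mul_apply, Matrix.one_apply, ← orthonormal_iff_ite.1 b.orthonormal i j,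
      ← WithLp.toLp_ofLp 2 (b i), ← WithLp.toLp_ofLp 2 (b j), ← dotProduct_eq_inner]
    rfl
  · change (b (e k)).ofLp i = _
    rw [hb _ ⟨k, rfl⟩, hv]

end Completion

/-! ### States that can be prepared with a given number of queries -/

section Preparation
variable {n : ℕ}

lemma runState_congr {F : Type} [Fintype F] [DecidableEq F] (init : Qubits n × F → ℂ)
    {step step' : ℕ → Matrix.unitaryGroup (Qubits n × F) ℂ} (U : QUnitary n) {t : ℕ}
    (h : ∀ s < t, step s = step' s) : runState init step U t = runState init step' U t := by
  induction t with
  | zero => rfl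
  | succ t ih =>
    rw [runState, runState, h t (Nat.lt_succ_self t), ih fun s hs => h s (by omega)]

/-- A unitary can be applied to the final state. -/
lemma exists_runState_mulVec {F : Type} [Fintype F] [DecidableEq F] {init : Qubits n × F → ℂ}
    (hinit : vnorm init = 1) (step : ℕ → Matrix.unitaryGroup (Qubits n × F) ℂ) (t : ℕ)
    (R : Matrix.unitaryGroup (Qubits n × F) ℂ) :
    ∃ (init' : Qubits n × F → ℂ) (step' : ℕ → Matrix.unitaryGroup (Qubits n × F) ℂ),
      vnorm init' = 1 ∧ ∀ U, runState init' step' U t =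
        (R : Matrix (Qubits n × F) (Qubits n × F) ℂ) *ᵥ runState init step U t := by
  cases t with
  | zero => exact ⟨(R : Matrix (Qubits n × F) (Qubits n × F) ℂ) *ᵥ init, step,
    by rw [vnorm_unitary_mulVec, hinit], fun U => rfl⟩
  | succ t =>
    refine ⟨init, fun s => if s = t then R * step s else step s, hinit, fun U => ?_⟩
    rw [runState, runState, runState_congr (step' := step) init U fun s hs => if_neg hs.ne]
    simp [mul_assoc]

set_option linter.unusedSectionVars false

/-- The isometry that sends basis vectors to basis vectors along an injection. -/
def injOp {I K : Type} [DecidableEq I] (e : K ↪ I) : Matrix I K ℂ :=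
  Matrix.of fun p q => if p = e q then 1 else 0

section InjOp
variable {I K L : Type} [Fintype I] [DecidableEq I] [Fintype K] [DecidableEq K] (e : K ↪ I)

lemma mul_injOp_apply (M : Matrix L I ℂ) (l : L) (q : K) : (M * injOp e) l q = M l (e q) := by
  simp [Matrix.mul_apply, injOp]

lemma injOp_isometry : (injOp e)ᴴ * injOp e = 1 := by
  ext p q
  rw [mul_injOp_apply, Matrix.conjTranspose_apply, Matrix.one_apply, injOp, Matrix.of_apply]
  simp only [e.injective.eq_iff, @eq_comm _ q p]
  split_ifs <;> simp

lemma injOp_mulVec_apply (v : K → ℂ) (q : K) : (injOp e *ᵥ v) (e q) = v q := by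
  simp [Matrix.mulVec, dotProduct, injOp, e.injective.eq_iff]

lemma injOp_mulVec_of_notMem (v : K → ℂ) {p : I} (hp : p ∉ Set.range e) :
    (injOp e *ᵥ v) p = 0 := by
  rw [Matrix.mulVec, dotProduct]
  refine Finset.sum_eq_zero fun q _ => ?_
  have : ¬(p = e q) := fun h => hp ⟨q, h.symm⟩
  simp only [injOp, Matrix.of_apply, if_neg this, zero_mul]

end InjOp

/-- The embedding of an auxiliary system into a larger one. -/
def embedOp (n : ℕ) {Anc F : Type} [DecidableEq F] (ι : Anc ↪ F) :
    Matrix (Qubits n × F) (Qubits n × Anc) ℂ :=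
  injOp ((Function.Embedding.refl (Qubits n)).prodMap ι)

variable {Anc F : Type} [Fintype Anc] [DecidableEq Anc] [Fintype F] [DecidableEq F]

lemma embedOp_mulVec_apply (ι : Anc ↪ F) (v : Qubits n × Anc → ℂ) (x : Qubits n) (a : Anc) :
    (embedOp n ι *ᵥ v) (x, ι a) = v (x, a) :=
  injOp_mulVec_apply ((Function.Embedding.refl (Qubits n)).prodMap ι) v (x, a)

lemma embedOp_mulVec_of_notMem (ι : Anc ↪ F) (v : Qubits n × Anc → ℂ) (x : Qubits n) {f : F}
    (hf : f ∉ Set.range ι) : (embedOp n ι *ᵥ v) (x, f) = 0 := by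
  refine injOp_mulVec_of_notMem _ v ?_
  rintro ⟨⟨y, b⟩, h⟩
  exact hf ⟨b, congrArg Prod.snd h⟩

lemma ext_embedOp (ι : Anc ↪ F) {v w : Qubits n × F → ℂ} (h1 : ∀ x a, v (x, ι a) = w (x, ι a))
    (h2 : ∀ x, ∀ f ∉ Set.range ι, v (x, f) = w (x, f)) : v = w := by
  funext ⟨x, f⟩
  by_cases hf : f ∈ Set.range ι
  · obtain ⟨a, rfl⟩ := hf
    exact h1 x a
  · exact h2 x f hf

lemma embedOp_isometry (ι : Anc ↪ F) : (embedOp n ι)ᴴ * embedOp n ι = 1 :=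
  injOp_isometry _

lemma kronecker_one_mulVec_apply (U : Matrix (Qubits n) (Qubits n) ℂ) (v : Qubits n × F → ℂ)
    (x : Qubits n) (f : F) :
    ((U ⊗ₖ (1 : Matrix F F ℂ)) *ᵥ v) (x, f) = ∑ y, U x y * v (y, f) := by
  rw [Matrix.mulVec, dotProduct, Fintype.sum_prod_type]
  refine Finset.sum_congr rfl fun y _ => ?_
  simp [Matrix.one_apply]

lemma kronecker_one_mulVec_embedOp (U : Matrix (Qubits n) (Qubits n) ℂ) (ι : Anc ↪ F)
    (v : Qubits n × Anc → ℂ) : (U ⊗ₖ (1 : Matrix F F ℂ)) *ᵥ (embedOp n ι *ᵥ v) =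
      embedOp n ι *ᵥ ((U ⊗ₖ (1 : Matrix Anc Anc ℂ)) *ᵥ v) := by
  refine ext_embedOp ι (fun x a => ?_) fun x f hf => ?_
  · simp only [kronecker_one_mulVec_apply, embedOp_mulVec_apply]
  · simp only [kronecker_one_mulVec_apply, embedOp_mulVec_of_notMem ι _ _ hf, mul_zero,
      Finset.sum_const_zero]

/-- The family of states `ψ` can be prepared with `T` queries, in every sufficiently large
auxiliary system. -/
def Preparable (T : ℕ) (ψ : QUnitary n → Qubits n × Anc → ℂ) : Prop :=
  ∃ M : ℕ, ∀ (F : Type) [Fintype F] [DecidableEq F], M ≤ Fintype.card F → ∀ ι : Anc ↪ F,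
    ∃ (init : Qubits n × F → ℂ) (step : ℕ → Matrix.unitaryGroup (Qubits n × F) ℂ),
      vnorm init = 1 ∧ ∀ U, runState init step U T = embedOp n ι *ᵥ ψ U

lemma preparable_const {φ : Qubits n × Anc → ℂ} (hφ : vnorm φ = 1) :
    Preparable 0 fun _ => φ :=
  ⟨0, fun _ _ _ _ ι => ⟨embedOp n ι *ᵥ φ, fun _ => 1,
    by rw [vnorm_mulVec_of_isometry (embedOp_isometry ι), hφ], fun _ => rfl⟩⟩

variable {Anc' : Type} [Fintype Anc'] [DecidableEq Anc']

/-- Since preparation is demanded in all large auxiliary systems, both `Anc` and `Anc'` can be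
embedded in one `F` from the start. There the isometry extends to a unitary, which is absorbed into
the last step or, with no queries, into the initial state. -/
lemma Preparable.isometry {T : ℕ} {ψ : QUnitary n → Qubits n × Anc → ℂ} (h : Preparable T ψ)
    {S : Matrix (Qubits n × Anc') (Qubits n × Anc) ℂ} (hS : Sᴴ * S = 1) :
    Preparable T fun U => S *ᵥ ψ U := by
  obtain ⟨M, hM⟩ := h
  refine ⟨max M (Fintype.card Anc), fun F _ _ hF ι' => ?_⟩
  obtain ⟨ι⟩ := Function.Embedding.nonempty_of_card_le ((le_max_right _ _).trans hF)
  obtain ⟨init, step, hinit, hrun⟩ := hM F ((le_max_left _ _).trans hF) ι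
  have hJ : (embedOp n ι' * S)ᴴ * (embedOp n ι' * S) = 1 := by
    rw [Matrix.conjTranspose_mul, Matrix.mul_assoc, ← Matrix.mul_assoc (embedOp n ι')ᴴ,
      embedOp_isometry, Matrix.one_mul, hS]
  obtain ⟨R, hR⟩ := exists_unitary_extending ((Function.Embedding.refl (Qubits n)).prodMap ι) hJ
  obtain ⟨init', step', hinit', hrun'⟩ := exists_runState_mulVec hinit step T R
  refine ⟨init', step', hinit', fun U => ?_⟩
  rw [hrun', hrun, Matrix.mulVec_mulVec, Matrix.mulVec_mulVec]
  congr 1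
  ext p q
  rw [embedOp, mul_injOp_apply]
  exact hR p q

/-- A query commutes with enlarging the auxiliary system. The step that must follow it is set to the
identity. -/
lemma Preparable.query {T : ℕ} {ψ : QUnitary n → Qubits n × Anc → ℂ} (h : Preparable T ψ) :
    Preparable (T + 1) fun U =>
      ((U : Matrix (Qubits n) (Qubits n) ℂ) ⊗ₖ (1 : Matrix Anc Anc ℂ)) *ᵥ ψ U := by
  obtain ⟨M, hM⟩ := h
  refine ⟨M, fun F _ _ hF ι => ?_⟩
  obtain ⟨init, step, hinit, hrun⟩ := hM F hF ι
  refine ⟨init, fun s => if s = T then 1 else step s, hinit, fun U => ?_⟩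
  rw [runState, runState_congr (step' := step) init U fun s hs => if_neg hs.ne, hrun,
    ← kronecker_one_mulVec_embedOp]
  simp

end Preparation
end UnitaryLearning

namespace UnitaryLearning
open scoped Matrix Kronecker ComplexOrder Matrix.Norms.L2Operator

/-! ### Operators controlled by a register -/

section BlockOp
variable {I J K L B : Type} [Fintype B] [DecidableEq B]

/-- An operator controlled by a label in `B`. -/
def blockOp (e₁ : K ≃ J × B) (e₂ : I ≃ L × B) (M : B → Matrix L J ℂ) : Matrix I K ℂ :=
  (Matrix.blockDiagonal M).submatrix e₂ e₁

lemma blockOp_isometry [Fintype I] [Fintype L] [DecidableEq J] [DecidableEq K] (e₁ : K ≃ J × B)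
    (e₂ : I ≃ L × B) {M : B → Matrix L J ℂ} (hM : ∀ b, (M b)ᴴ * M b = 1) :
    (blockOp e₁ e₂ M)ᴴ * blockOp e₁ e₂ M = 1 := by
  rw [blockOp, Matrix.conjTranspose_submatrix, Matrix.submatrix_mul_equiv,
    Matrix.blockDiagonal_conjTranspose, ← Matrix.blockDiagonal_mul]
  have : (fun b => (M b)ᴴ * M b) = 1 := funext hM
  rw [this, Matrix.blockDiagonal_one, Matrix.submatrix_one_equiv]

lemma blockOp_mulVec [Fintype J] [Fintype K] (e₁ : K ≃ J × B) (e₂ : I ≃ L × B) (M : B → Matrix L J ℂ)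
    (v : K → ℂ) (i : I) :
    (blockOp e₁ e₂ M *ᵥ v) i =
      ∑ j, M (e₂ i).2 (e₂ i).1 j * v (e₁.symm (j, (e₂ i).2)) := by
  rw [Matrix.mulVec, dotProduct, ← Equiv.sum_comp e₁.symm, Fintype.sum_prod_type]
  refine Finset.sum_congr rfl fun j _ => ?_
  rw [Finset.sum_eq_single (e₂ i).2]
  · simp [blockOp, Matrix.blockDiagonal_apply]
  · intro b _ hb
    simp [blockOp, Matrix.blockDiagonal_apply, hb.symm]
  · simp

end BlockOp

/-! ### Adaptive sampling with deferred measurements -/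

section Simulation
variable {n : ℕ} {Out : Type} [Fintype Out] [DecidableEq Out]

/-- With `T` queries one can sample an outcome whose distribution is `p U` when the unknown unitary
is `U`. -/
def Simulable (T : ℕ) (p : QUnitary n → Out → ℝ) : Prop :=
  ∃ (A : Type) (_ : Fintype A) (_ : DecidableEq A) (ψ : QUnitary n → Qubits n × (Out × A) → ℂ),
    Preparable T ψ ∧ ∀ U o, p U o = ∑ x, ∑ a, ‖ψ U (x, (o, a))‖ ^ 2

lemma simulable_const (o₀ : Out) :
    Simulable 0 fun (_ : QUnitary n) o => if o = o₀ then 1 else 0 := by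
  refine ⟨Unit, inferInstance, inferInstance,
    fun _ p => if p = (0, (o₀, ())) then 1 else 0, preparable_const ?_, fun U o => ?_⟩
  · have h := vnorm_sq (fun p : Qubits n × (Out × Unit) => if p = (0, (o₀, ())) then (1 : ℂ) else 0)
    have h2 : ∀ p : Qubits n × (Out × Unit), ‖(if p = (0, (o₀, ())) then (1 : ℂ) else 0)‖ ^ 2 =
        if p = (0, (o₀, ())) then 1 else 0 := fun p => by split_ifs <;> simp
    simp only [h2, Finset.sum_ite_eq', Finset.mem_univ, if_true] at h
    exact (pow_eq_one_iff_of_nonneg (vnorm_nonneg _) two_ne_zero).1 h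
  · rw [Finset.sum_eq_single 0]
    · by_cases ho : o = o₀ <;> simp [ho]
    · intro x _ hx
      simp [hx]
    · simp

/-- Write the function value into a new register and keep the old outcome in the auxiliary system;
keeping it makes the map injective on basis states, hence an isometry. -/
lemma Simulable.map {T : ℕ} {p : QUnitary n → Out → ℝ} (h : Simulable T p) {Out' : Type}
    [Fintype Out'] [DecidableEq Out'] (g : Out → Out') :
    Simulable T fun U o' => ∑ o, if g o = o' then p U o else 0 := by
  obtain ⟨A, _, _, ψ, hψ, hp⟩ := h
  let e : Qubits n × (Out × A) ↪ Qubits n × (Out' × (Out × A)) :=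
    ⟨fun q => (q.1, (g q.2.1, q.2)), fun q r hqr => by
      simp only [Prod.mk.injEq] at hqr
      exact Prod.ext hqr.1 hqr.2.2⟩
  refine ⟨Out × A, inferInstance, inferInstance, _, hψ.isometry (injOp_isometry e), fun U o' => ?_⟩
  have hv : ∀ x o a, (injOp e *ᵥ ψ U) (x, (o', (o, a))) = if g o = o' then ψ U (x, (o, a)) else 0 := by
    intro x o a
    split_ifs with h
    · have := injOp_mulVec_apply e (ψ U) (x, (o, a))
      rw [← this, ← h]
      rfl
    · refine injOp_mulVec_of_notMem e _ ?_
      rintro ⟨⟨y, b, c⟩, hq⟩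
      have hq' : (y, (g b, (b, c))) = (x, (o', (o, a))) := hq
      simp only [Prod.mk.injEq] at hq'
      exact h (by rw [← hq'.2.1, hq'.2.2.1])
  simp only [Fintype.sum_prod_type, hv]
  rw [Finset.sum_comm]
  refine Finset.sum_congr rfl fun o _ => ?_
  split_ifs with h
  · exact hp U o
  · simp

lemma Simulable.congr_equiv {T : ℕ} {p : QUnitary n → Out → ℝ} (h : Simulable T p) {Out' : Type}
    [Fintype Out'] [DecidableEq Out'] (e : Out ≃ Out') :
    Simulable T fun U o' => p U (e.symm o') := by
  convert h.map e using 3 with U o'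
  rw [Finset.sum_eq_single (e.symm o')]
  · simp
  · intro o _ ho
    rw [if_neg]
    rintro rfl
    simp at ho
  · simp

variable {F Ω : Type} [Fintype F] [DecidableEq F] [Fintype Ω] [DecidableEq Ω]

/-- Continue with a second procedure that depends on the outcome of the first one. -/
lemma Simulable.bind {T : ℕ} {p : QUnitary n → Out → ℝ} (h : Simulable T p)
    {init : Qubits n × F → ℂ} (hinit : vnorm init = 1)
    (step : Out → ℕ → Matrix.unitaryGroup (Qubits n × F) ℂ) (P : ℕ)
    {Φ : Matrix Ω (Qubits n × F) ℂ} (hΦ : Φᴴ * Φ = 1) :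
    Simulable (T + P) fun U (o : Out × Ω) =>
      p U o.1 * ‖(Φ *ᵥ runState init (step o.1) U P) o.2‖ ^ 2 := by
  obtain ⟨A, _, _, ψ, hψ, hp⟩ := h
  let e₁ : Qubits n × (Out × A) ≃ Unit × (Out × (Qubits n × A)) :=
    { toFun := fun q => ((), (q.2.1, (q.1, q.2.2)))
      invFun := fun q => (q.2.2.1, (q.2.1, q.2.2.2))
      left_inv := fun _ => rfl
      right_inv := fun _ => rfl }
  let e₂ : Qubits n × (Out × (F × (Qubits n × A))) ≃ (Qubits n × F) × (Out × (Qubits n × A)) :=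
    { toFun := fun q => ((q.1, q.2.2.1), (q.2.1, q.2.2.2))
      invFun := fun q => (q.1.1, (q.2.1, (q.1.2, q.2.2)))
      left_inv := fun _ => rfl
      right_inv := fun _ => rfl }
  let e₃ : Qubits n × ((Out × Ω) × (Qubits n × A)) ≃ (Qubits n × Ω) × (Out × (Qubits n × A)) :=
    { toFun := fun q => ((q.1, q.2.1.2), (q.2.1.1, q.2.2))
      invFun := fun q => (q.1.1, ((q.2.1, q.1.2), q.2.2))
      left_inv := fun _ => rfl
      right_inv := fun _ => rfl }
  -- The first state's qubit register is parked in the auxiliary system, because queries act on the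
  -- qubit register, which the second procedure now needs. The outcome register acts as the control
  -- of the new steps.
  have hrun : ∀ t, Preparable (T + t) fun U (q : Qubits n × (Out × (F × (Qubits n × A)))) =>
      runState init (step q.2.1) U t (q.1, q.2.2.1) * ψ U (q.2.2.2.1, (q.2.1, q.2.2.2.2)) := by
    intro t
    induction t with
    | zero =>
      have hS : ∀ b : Out × (Qubits n × A), (Matrix.of fun (i : Qubits n × F) (_ : Unit) => init i)ᴴ *
          (Matrix.of fun (i : Qubits n × F) (_ : Unit) => init i) = 1 := by
        intro b
        ext i j
        have := dotProduct_self_eq init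
        rw [hinit] at this
        simpa [Matrix.mul_apply, dotProduct] using this
      refine cast (congrArg (Preparable T) ?_) (hψ.isometry (blockOp_isometry e₁ e₂ hS))
      funext U q
      rw [blockOp_mulVec]
      simp [e₁, e₂, runState]
    | succ t ih =>
      refine cast (congrArg (Preparable (T + t + 1)) ?_) (ih.query.isometry (blockOp_isometry e₂ e₂
        (fun b => unitary_conjTranspose_mul (step b.1 t))))
      funext U ⟨x, o, f, r⟩
      rw [blockOp_mulVec]
      simp only [e₂, Equiv.coe_fn_mk, Equiv.coe_fn_symm_mk, runState]
      rw [Matrix.mulVec, dotProduct, Finset.sum_mul]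
      symm
      refine Finset.sum_congr rfl fun j _ => ?_
      rw [mul_assoc, kronecker_one_mulVec_apply, ← Prod.mk.eta (p := j), kronecker_one_mulVec_apply,
        Finset.sum_mul]
      simp only [mul_assoc]
  -- The new outcome is written into the auxiliary system, and the qubit register is reset to the
  -- zero string.
  set Φ' : Matrix (Qubits n × Ω) (Qubits n × F) ℂ :=
    Matrix.of fun i j => if i.1 = 0 then Φ i.2 j else 0 with hΦ'
  have hΦ'iso : ∀ b : Out × (Qubits n × A), Φ'ᴴ * Φ' = 1 := by
    intro b
    rw [← hΦ]
    ext i j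
    rw [Matrix.mul_apply, Matrix.mul_apply, Fintype.sum_prod_type, Finset.sum_eq_single 0]
    · simp [hΦ']
    · intro x _ hx
      simp [hΦ', hx]
    · simp
  refine ⟨Qubits n × A, inferInstance, inferInstance, _,
    (hrun P).isometry (blockOp_isometry e₂ e₃ hΦ'iso), ?_⟩
  rintro U ⟨o, ω⟩
  have hval : ∀ x r, (blockOp e₂ e₃ (fun _ => Φ') *ᵥ
      fun q : Qubits n × (Out × (F × (Qubits n × A))) =>
      runState init (step q.2.1) U P (q.1, q.2.2.1) * ψ U (q.2.2.2.1, (q.2.1, q.2.2.2.2)))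
      (x, ((o, ω), r)) = if x = 0 then (Φ *ᵥ runState init (step o) U P) ω * ψ U (r.1, (o, r.2))
        else 0 := by
    intro x r
    rw [blockOp_mulVec]
    simp only [e₂, e₃, Equiv.coe_fn_mk, Equiv.coe_fn_symm_mk, hΦ', Matrix.of_apply]
    split_ifs
    · rw [Matrix.mulVec, dotProduct, Finset.sum_mul]
      simp only [mul_assoc]
    · simp
  simp only [hval]
  rw [Finset.sum_eq_single 0]
  · simp only [if_true, norm_mul, mul_pow, hp, Fintype.sum_prod_type]
    rw [mul_comm, Finset.mul_sum]
    simp only [Finset.mul_sum]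
  · intro x _ hx
    simp [hx]
  · simp

/-- Repeat a procedure, which may depend on an earlier outcome, `m` times. -/
lemma Simulable.bind_iterate {T : ℕ} {p : QUnitary n → Out → ℝ} (h : Simulable T p)
    {init : Qubits n × F → ℂ} (hinit : vnorm init = 1)
    (step : Out → ℕ → Matrix.unitaryGroup (Qubits n × F) ℂ) (P : ℕ)
    {Φ : Matrix Ω (Qubits n × F) ℂ} (hΦ : Φᴴ * Φ = 1) (m : ℕ) :
    Simulable (T + m * P) fun U (o : Out × (Fin m → Ω)) =>
      p U o.1 * ∏ i, ‖(Φ *ᵥ runState init (step o.1) U P) (o.2 i)‖ ^ 2 := by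
  induction m with
  | zero =>
    have h2 := h.congr_equiv (Equiv.prodUnique Out (Fin 0 → Ω)).symm
    convert h2 using 1
    · simp
    · funext U o
      simp
  | succ m ih =>
    let e : (Out × (Fin m → Ω)) × Ω ≃ Out × (Fin (m + 1) → Ω) :=
      { toFun := fun q => (q.1.1, Fin.snoc q.1.2 q.2)
        invFun := fun q => ((q.1, Fin.init q.2), q.2 (Fin.last m))
        left_inv := fun q => by simp
        right_inv := fun q => by simp }
    have h2 := (ih.bind hinit (fun o => step o.1) P hΦ).congr_equiv e
    convert h2 using 1
    · ring
    · funext U o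
      rw [Fin.prod_univ_castSucc]
      simp only [e, Equiv.coe_fn_symm_mk, mul_assoc]
      rfl

/-- A simulable family of distributions comes from a query algorithm. Its success probability at
`U` is compared with the distribution at a nearby `V`. -/
lemma Simulable.exists_queryAlgorithm {T : ℕ} {p : QUnitary n → Out → ℝ} (h : Simulable T p)
    (o₀ : Out) (guess : Out → QUnitary n) :
    ∃ A : QueryAlgorithm n, A.queries = T ∧ ∀ ε U V (S : Finset Out),
      (∀ o ∈ S, dDiamond (guess o) U ≤ ε) →
        ∑ o ∈ S, p V o - 2 * (T * ‖(V : Matrix (Qubits n) (Qubits n) ℂ) - U‖) ≤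
          A.successProb ε U := by
  classical
  obtain ⟨B, _, _, ψ, ⟨M, hM⟩, hp⟩ := h
  let ι : Out × B ↪ (Out × B) ⊕ Fin M := ⟨Sum.inl, Sum.inl_injective⟩
  obtain ⟨init, step, hinit, hrun⟩ := hM ((Out × B) ⊕ Fin M) (by simp) ι
  -- The summand `Fin M` only makes the system large enough. Its basis states get the default
  -- outcome `o₀`, so that the projections sum to the identity; this can only increase
  -- probabilities, and a lower bound is all that is needed.
  let label : Qubits n × ((Out × B) ⊕ Fin M) → Out := fun q => Sum.elim (fun r => r.1) (fun _ => o₀) q.2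
  let E : Out → Matrix (Qubits n × ((Out × B) ⊕ Fin M)) (Qubits n × ((Out × B) ⊕ Fin M)) ℂ :=
    fun o => Matrix.diagonal fun q => if label q = o then 1 else 0
  let A : QueryAlgorithm n :=
    { Anc := (Out × B) ⊕ Fin M
      queries := T
      init := init
      init_norm := by rw [← vnorm_sq, hinit]; norm_num
      step := step
      Out := Out
      povm := E
      povm_posSemidef := fun o => Matrix.PosSemidef.diagonal fun q => by
        simp only [Pi.zero_apply]; split_ifs <;> simp
      povm_sum := by
        ext q r
        simp only [E, Matrix.sum_apply, Matrix.diagonal_apply, Matrix.one_apply]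
        by_cases hqr : q = r <;> simp [hqr]
      guess := guess }
  have hprob : ∀ U o, A.prob U o = ∑ x, ∑ b, ‖ψ U (x, (o, b))‖ ^ 2 +
      ∑ x, ∑ f, if o₀ = o then ‖A.state U T (x, Sum.inr f)‖ ^ 2 else 0 := by
    intro U o
    have hst : A.state U T = embedOp n ι *ᵥ ψ U := by
      rw [A.state_eq_runState]; exact hrun U
    have h1 : A.prob U o = ∑ q, if label q = o then ‖A.state U T q‖ ^ 2 else 0 := by
      change (star (A.state U T) ⬝ᵥ (E o *ᵥ A.state U T)).re = _
      rw [dotProduct, Complex.re_sum]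
      refine Finset.sum_congr rfl fun q _ => ?_
      simp only [E, Matrix.mulVec_diagonal, Pi.star_apply]
      split_ifs
      · rw [one_mul, Complex.star_def, ← Complex.normSq_eq_conj_mul_self, Complex.normSq_eq_norm_sq,
          Complex.ofReal_re]
      · simp
    rw [h1, Fintype.sum_prod_type, ← Finset.sum_add_distrib]
    refine Finset.sum_congr rfl fun x _ => ?_
    rw [Fintype.sum_sum_type, Fintype.sum_prod_type]
    congr 1
    rw [Finset.sum_eq_single o]
    · refine Finset.sum_congr rfl fun b _ => ?_
      have hl : label (x, Sum.inl (o, b)) = o := rfl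
      rw [if_pos hl, hst]
      exact congrArg (fun z => ‖z‖ ^ 2) (embedOp_mulVec_apply ι (ψ U) x (o, b))
    · intro o' _ ho'
      refine Finset.sum_eq_zero fun b _ => if_neg ho'
    · simp
  refine ⟨A, rfl, fun ε U V S hS => ?_⟩
  have hle : ∑ o ∈ S, p V o ≤ ∑ o ∈ S, A.prob V o := by
    refine Finset.sum_le_sum fun o _ => ?_
    rw [hprob, hp]
    refine le_add_of_nonneg_right (Finset.sum_nonneg fun x _ => Finset.sum_nonneg fun f _ => ?_)
    split_ifs <;> positivity
  have hVU : ∑ o ∈ S, A.prob V o - ∑ o ∈ S, A.prob U o ≤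
      2 * vnorm (A.state V T - A.state U T) :=
    sum_prob_sub_le A.povm A.povm_posSemidef A.povm_sum S (A.vnorm_state V T) (A.vnorm_state U T)
  have hdist : vnorm (A.state V T - A.state U T) ≤
      T * ‖(V : Matrix (Qubits n) (Qubits n) ℂ) - U‖ := by
    rw [A.state_eq_runState, A.state_eq_runState]
    refine (vnorm_runState_sub_le _ _ V U T).trans ?_
    refine (Finset.sum_le_card_nsmul _ _ ‖(V : Matrix (Qubits n) (Qubits n) ℂ) - U‖
      fun s _ => ?_).trans (le_of_eq (by rw [Finset.card_range, nsmul_eq_mul]))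
    refine (vnorm_mulVec_le _ _).trans ?_
    rw [← A.state_eq_runState, A.vnorm_state, mul_one]
    exact opNorm_kronecker_one_le _
  have hsucc : ∑ o ∈ S, A.prob U o ≤ A.successProb ε U := by
    rw [QueryAlgorithm.successProb_eq]
    refine Finset.sum_le_sum_of_subset_of_nonneg (fun o ho => ?_) fun o _ _ => A.prob_nonneg U o
    exact Finset.mem_filter.2 ⟨Finset.mem_univ _, hS o ho⟩
  linarith

end Simulation
end UnitaryLearning

namespace UnitaryLearning
open scoped Matrix Kronecker ComplexOrder Matrix.Norms.L2Operator

/-! ### Moments of random fourth roots of unity -/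

section RandomPhases
set_option linter.unusedSectionVars false

variable {ι : Type} [Fintype ι] [DecidableEq ι]

/-- The character of `(ℤ/4)^ι` with frequency `e`. -/
noncomputable def phase (e f : ι → ZMod 4) : ℂ := ZMod.stdAddChar (e ⬝ᵥ f)

lemma phase_add (e e' f : ι → ZMod 4) : phase (e + e') f = phase e f * phase e' f := by
  rw [phase, add_dotProduct, AddChar.map_add_eq_mul]; rfl

lemma star_phase (e f : ι → ZMod 4) : star (phase e f) = phase (-e) f := by
  rw [phase, phase, neg_dotProduct, AddChar.map_neg_eq_conj]; rfl

lemma sum_phase (e : ι → ZMod 4) :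
    ∑ f, phase e f = if e = 0 then (Fintype.card (ι → ZMod 4) : ℂ) else 0 := by
  classical
  let φ : (ι → ZMod 4) →+ ZMod 4 :=
    { toFun := fun f => e ⬝ᵥ f, map_zero' := dotProduct_zero e, map_add' := dotProduct_add e }
  let ψ : AddChar (ι → ZMod 4) ℂ := (ZMod.stdAddChar (N := 4)).compAddMonoidHom φ
  have hψ : ψ = 0 ↔ e = 0 := by
    constructor
    · intro h
      funext x
      have h1 : ψ (Pi.single x 1) = 1 := by rw [h]; rfl
      have h2 : (ZMod.stdAddChar (e x) : ℂ) = ZMod.stdAddChar (0 : ZMod 4) := by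
        rw [AddChar.map_zero_eq_one, ← h1]
        simp [ψ, φ]
      exact ZMod.injective_stdAddChar h2
    · rintro rfl
      ext f
      simp [ψ, φ]
  have h := AddChar.sum_eq_ite ψ
  simp only [hψ] at h
  exact h

lemma sum_phase_mul_star (e e' : ι → ZMod 4) :
    ∑ f, phase e f * star (phase e' f) = if e = e' then (Fintype.card (ι → ZMod 4) : ℂ) else 0 := by
  simp only [star_phase, ← phase_add, sum_phase]
  simp only [← sub_eq_add_neg, sub_eq_zero]

variable {κ : Type} [Fintype κ] [DecidableEq κ]

lemma sum_norm_sq_phase (c : κ → ℂ) (e : κ → ι → ZMod 4) :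
    ((∑ f, ‖∑ k, c k * phase (e k) f‖ ^ 2 : ℝ) : ℂ) =
      ∑ k, ∑ l, c k * star (c l) * ∑ f, phase (e k) f * star (phase (e l) f) := by
  have h : ∀ f, ((‖∑ k, c k * phase (e k) f‖ : ℝ) : ℂ) ^ 2 =
      ∑ k, ∑ l, c k * star (c l) * (phase (e k) f * star (phase (e l) f)) := by
    intro f
    rw [← Complex.ofReal_pow, ← Complex.normSq_eq_norm_sq, ← Complex.mul_conj, map_sum,
      Finset.sum_mul_sum]
    refine Finset.sum_congr rfl fun k _ => Finset.sum_congr rfl fun l _ => ?_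
    simp only [map_mul, Complex.star_def]
    ring
  push_cast
  simp only [h, Finset.mul_sum]
  rw [Finset.sum_comm]
  refine Finset.sum_congr rfl fun k _ => ?_
  rw [Finset.sum_comm]

/-- Second moment of a trigonometric polynomial with distinct frequencies. -/
lemma sum_norm_sq_phase_of_injective (c : κ → ℂ) (e : κ → ι → ZMod 4)
    (h : ∀ k l, c k ≠ 0 → c l ≠ 0 → e k = e l → k = l) :
    ∑ f, ‖∑ k, c k * phase (e k) f‖ ^ 2 = Fintype.card (ι → ZMod 4) * ∑ k, ‖c k‖ ^ 2 := by
  have hexp := sum_norm_sq_phase c e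
  refine Complex.ofReal_injective ?_
  rw [hexp, Complex.ofReal_mul, Complex.ofReal_sum, Finset.mul_sum]
  refine Finset.sum_congr rfl fun k _ => ?_
  rw [Finset.sum_eq_single k]
  · rw [sum_phase_mul_star, if_pos rfl, Complex.star_def, Complex.mul_conj,
      Complex.normSq_eq_norm_sq]
    push_cast
    ring
  · intro l _ hl
    by_cases hk0 : c k = 0
    · simp [hk0]
    by_cases hl0 : c l = 0
    · simp [hl0]
    rw [sum_phase_mul_star, if_neg, mul_zero]
    exact fun he => hl (h k l hk0 hl0 he).symm
  · simp

/-- Second moment of a trigonometric polynomial whose frequencies agree at most in pairs. -/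
lemma sum_norm_sq_phase_le_of_pairs (c : κ → ℂ) (e : κ → ι → ZMod 4) (σ : Equiv.Perm κ)
    (h : ∀ k l, c k ≠ 0 → c l ≠ 0 → e k = e l → l = k ∨ l = σ k) :
    ∑ f, ‖∑ k, c k * phase (e k) f‖ ^ 2 ≤ 2 * (Fintype.card (ι → ZMod 4) * ∑ k, ‖c k‖ ^ 2) := by
  set N : ℝ := (Fintype.card (ι → ZMod 4) : ℝ) with hN
  have hN0 : 0 ≤ N := Nat.cast_nonneg _
  have hexp := sum_norm_sq_phase c e
  have hbound : ∀ k, ‖∑ l, c k * star (c l) * ∑ f, phase (e k) f * star (phase (e l) f)‖ ≤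
      N * (‖c k‖ * ‖c k‖ + ‖c k‖ * ‖c (σ k)‖) := by
    intro k
    have hterm : ∀ l, ‖c k * star (c l) * ∑ f, phase (e k) f * star (phase (e l) f)‖ ≤
        (if l = k then N * (‖c k‖ * ‖c l‖) else 0) + (if l = σ k then N * (‖c k‖ * ‖c l‖) else 0) := by
      intro l
      have hpos : 0 ≤ N * (‖c k‖ * ‖c l‖) := by positivity
      by_cases hk0 : c k = 0
      · simp [hk0]
      by_cases hl0 : c l = 0
      · simp [hl0]
      rw [sum_phase_mul_star]
      split_ifs with he h1 h2 h2 <;> simp only [norm_mul, norm_star, norm_zero, mul_zero]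
      · simp only [Complex.norm_natCast, ← hN]; nlinarith
      · simp only [Complex.norm_natCast, ← hN]; nlinarith
      · simp only [Complex.norm_natCast, ← hN]; nlinarith
      · rcases h k l hk0 hl0 he with h3 | h3
        · exact absurd h3 h1
        · exact absurd h3 (by assumption)
      all_goals positivity
    refine (norm_sum_le _ _).trans ((Finset.sum_le_sum fun l _ => hterm l).trans (le_of_eq ?_))
    rw [Finset.sum_add_distrib]
    simp only [Finset.sum_ite_eq', Finset.mem_univ, if_true]
    ring
  have h1 : ∑ f, ‖∑ k, c k * phase (e k) f‖ ^ 2 ≤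
      ∑ k, N * (‖c k‖ * ‖c k‖ + ‖c k‖ * ‖c (σ k)‖) := by
    have h2 : ∑ f, ‖∑ k, c k * phase (e k) f‖ ^ 2 =
        ‖((∑ f, ‖∑ k, c k * phase (e k) f‖ ^ 2 : ℝ) : ℂ)‖ := by
      rw [Complex.norm_real, Real.norm_of_nonneg (Finset.sum_nonneg fun _ _ => by positivity)]
    rw [h2, hexp]
    exact (norm_sum_le _ _).trans (Finset.sum_le_sum fun k _ => hbound k)
  refine h1.trans ?_
  have h3 : ∑ k, ‖c (σ k)‖ ^ 2 = ∑ k, ‖c k‖ ^ 2 := Equiv.sum_comp σ fun k => ‖c k‖ ^ 2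
  calc _ ≤ ∑ k, N * (3 / 2 * ‖c k‖ ^ 2 + 1 / 2 * ‖c (σ k)‖ ^ 2) := by
        refine Finset.sum_le_sum fun k _ => mul_le_mul_of_nonneg_left ?_ hN0
        nlinarith [sq_nonneg (‖c k‖ - ‖c (σ k)‖)]
    _ = _ := by
      rw [← Finset.mul_sum, Finset.sum_add_distrib, ← Finset.mul_sum, ← Finset.mul_sum, h3]
      ring

end RandomPhases
end UnitaryLearning

namespace UnitaryLearning
open scoped Matrix Kronecker ComplexOrder Matrix.Norms.L2Operator

/-! ### A measurement that separates pure states without dimension loss -/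

section RandomPhaseMeasurement
set_option linter.unusedSectionVars false

variable {ι : Type} [Fintype ι] [DecidableEq ι]

lemma eq_of_single_sub_single {x y x' y' : ι} (hxy : x ≠ y)
    (h : (Pi.single x 1 - Pi.single y 1 : ι → ZMod 4) = Pi.single x' 1 - Pi.single y' 1) :
    x = x' ∧ y = y' := by
  have h1 := congrFun h x
  have h2 := congrFun h y
  simp only [Pi.sub_apply, Pi.single_apply, if_true, if_neg hxy, if_neg hxy.symm] at h1 h2
  constructor
  · by_contra hne
    rw [if_neg hne] at h1
    split_ifs at h1 <;> revert h1 <;> decide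
  · by_contra hne
    rw [if_neg hne] at h2
    split_ifs at h2 <;> revert h2 <;> decide

/-- The entry at `y` is `-1`, while two positive unit vectors can only produce `0`, `1` or `2`
there. Modulo 4 these four values differ; modulo 3 the value 2 would be confused with `-1`, which is
why fourth roots of unity are used. -/
lemma eq_or_eq_of_single_sub_single_add_single {x y z x' y' z' : ι} (hxy : x ≠ y) (hzy : z ≠ y)
    (h : (Pi.single x 1 - Pi.single y 1 + Pi.single z 1 : ι → ZMod 4) =
      Pi.single x' 1 - Pi.single y' 1 + Pi.single z' 1) :
    y' = y ∧ ((x' = x ∧ z' = z) ∨ (x' = z ∧ z' = x)) := by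
  have hy : y' = y := by
    by_contra hne
    have h1 := congrFun h y
    simp only [Pi.sub_apply, Pi.add_apply, Pi.single_apply, if_true, if_neg hxy.symm,
      if_neg hzy.symm, if_neg (Ne.symm hne)] at h1
    split_ifs at h1 <;> revert h1 <;> decide
  subst hy
  have hs : (Pi.single x 1 + Pi.single z 1 : ι → ZMod 4) = Pi.single x' 1 + Pi.single z' 1 := by
    have : ∀ a b c : ι → ZMod 4, a + c = (a - b + c) + b := fun a b c => by abel
    rw [this _ (Pi.single y' 1), h]
    abel
  have hinj : ∀ a b : ι, (Pi.single a 1 : ι → ZMod 4) = Pi.single b 1 → b = a := by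
    intro a b hab
    by_contra hne
    have := congrFun hab a
    rw [Pi.single_eq_same, Pi.single_eq_of_ne (Ne.symm hne)] at this
    revert this
    decide
  refine ⟨rfl, ?_⟩
  by_cases h1 : x' = x
  · subst h1
    exact Or.inl ⟨rfl, hinj _ _ (add_left_cancel hs)⟩
  · by_cases h2 : z' = x
    · subst h2
      rw [add_comm] at hs
      exact Or.inr ⟨hinj _ _ (add_right_cancel hs), rfl⟩
    · have h3 := congrFun hs x
      simp only [Pi.add_apply, Pi.single_apply, if_true, if_neg (Ne.symm h1),
        if_neg (Ne.symm h2)] at h3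
      exfalso
      split_ifs at h3 <;> revert h3 <;> decide

/-- The amplitude of `u` at the phase vector given by `f`. -/
noncomputable def amplitude (u : ι → ℂ) (f : ι → ZMod 4) : ℂ :=
  ∑ x, u x * phase (Pi.single x 1) f

lemma sum_norm_sq_amplitude {u : ι → ℂ} (hu : vnorm u = 1) :
    ∑ f, ‖amplitude u f‖ ^ 2 = Fintype.card (ι → ZMod 4) := by
  have h := sum_norm_sq_phase_of_injective u (fun x => (Pi.single x 1 : ι → ZMod 4)) (by
    intro k l _ _ hkl
    by_contra hne
    have := congrFun hkl k
    rw [Pi.single_eq_same, Pi.single_eq_of_ne hne] at this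
    revert this
    decide)
  rw [← vnorm_sq u, hu] at h
  simpa [amplitude] using h

/-- The off-diagonal part of the difference of the projections onto `u` and `w`. -/
noncomputable def offDiag (u w : ι → ℂ) (p : ι × ι) : ℂ :=
  if p.1 = p.2 then 0 else u p.1 * star (u p.2) - w p.1 * star (w p.2)

/-- The difference of the outcome weights of `u` and `w`, as a trigonometric polynomial. -/
noncomputable def weightDiff (u w : ι → ℂ) (f : ι → ZMod 4) : ℂ :=
  ∑ p, offDiag u w p * phase (Pi.single p.1 1 - Pi.single p.2 1) f

lemma norm_sq_amplitude (u : ι → ℂ) (f : ι → ZMod 4) :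
    ((‖amplitude u f‖ ^ 2 : ℝ) : ℂ) =
      ∑ p : ι × ι, u p.1 * star (u p.2) * phase (Pi.single p.1 1 - Pi.single p.2 1) f := by
  rw [← Complex.normSq_eq_norm_sq, ← Complex.mul_conj, amplitude, map_sum, Finset.sum_mul_sum,
    Fintype.sum_prod_type]
  refine Finset.sum_congr rfl fun x _ => Finset.sum_congr rfl fun y _ => ?_
  rw [sub_eq_add_neg, phase_add, ← star_phase, map_mul]
  simp only [Complex.star_def]
  ring

/-- All diagonal terms have frequency zero, and their sum is the difference of two squared norms,
which are both 1. So random phases see only the off-diagonal part. -/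
lemma weightDiff_eq {u w : ι → ℂ} (hu : vnorm u = 1) (hw : vnorm w = 1) (f : ι → ZMod 4) :
    weightDiff u w f = ((‖amplitude u f‖ ^ 2 - ‖amplitude w f‖ ^ 2 : ℝ) : ℂ) := by
  have hdiag : ∀ v : ι → ℂ, vnorm v = 1 → ∑ x, v x * star (v x) = 1 := by
    intro v hv
    have h := dotProduct_self_eq v
    rw [hv, dotProduct_comm] at h
    simpa [dotProduct] using h
  rw [Complex.ofReal_sub, norm_sq_amplitude, norm_sq_amplitude, ← Finset.sum_sub_distrib, weightDiff]
  have hz : ∑ p : ι × ι, (if p.1 = p.2 then u p.1 * star (u p.2) - w p.1 * star (w p.2) else 0) = 0 := by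
    rw [Fintype.sum_prod_type]
    simp only [Finset.sum_ite_eq, Finset.mem_univ, if_true]
    rw [Finset.sum_sub_distrib, hdiag u hu, hdiag w hw, sub_self]
  rw [← sub_eq_zero, ← Finset.sum_sub_distrib, ← neg_eq_zero, ← Finset.sum_neg_distrib, ← hz]
  refine Finset.sum_congr rfl fun p _ => ?_
  rw [offDiag]
  split_ifs with h
  · have h0 : phase (0 : ι → ZMod 4) f = 1 := by simp [phase]
    rw [h, sub_self, h0]
    ring
  · ring

lemma sum_norm_sq_weightDiff (u w : ι → ℂ) :
    ∑ f, ‖weightDiff u w f‖ ^ 2 = Fintype.card (ι → ZMod 4) * ∑ p, ‖offDiag u w p‖ ^ 2 := by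
  refine sum_norm_sq_phase_of_injective (offDiag u w) _ fun k l hk _ hkl => ?_
  have hk' : k.1 ≠ k.2 := fun h => hk (if_pos h)
  have := eq_of_single_sub_single hk' hkl
  exact Prod.ext this.1 this.2

/-- A hypercontractive estimate by counting frequencies. Terms with `z = y` collapse to a linear
polynomial `L`, bounded by Cauchy–Schwarz; in the rest, `R`, frequencies coincide only under the
swap of `x` and `z`, at a cost of 2. The constant is `6 = 2 · 1 + 2 · 2`. -/
lemma sum_norm_sq_weightDiff_mul_amplitude_le (u w : ι → ℂ) {v : ι → ℂ} (hv : vnorm v = 1) :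
    ∑ f, ‖weightDiff u w f * amplitude v f‖ ^ 2 ≤
      6 * (Fintype.card (ι → ZMod 4) * ∑ p, ‖offDiag u w p‖ ^ 2) := by
  set N : ℝ := (Fintype.card (ι → ZMod 4) : ℝ) with hN
  set S := ∑ p, ‖offDiag u w p‖ ^ 2 with hS
  have hN0 : 0 ≤ N := Nat.cast_nonneg _
  set L : ι → ℂ := fun x => ∑ y, offDiag u w (x, y) * v y with hL
  set R : ι × ι × ι → ℂ := fun k => if k.2.2 = k.2.1 then 0 else offDiag u w (k.1, k.2.1) * v k.2.2
    with hR
  have hdec : ∀ f, weightDiff u w f * amplitude v f = ∑ x, L x * phase (Pi.single x 1) f +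
      ∑ k, R k * phase (Pi.single k.1 1 - Pi.single k.2.1 1 + Pi.single k.2.2 1) f := by
    intro f
    rw [weightDiff, amplitude, Finset.sum_mul_sum, Fintype.sum_prod_type, Fintype.sum_prod_type]
    simp only [Fintype.sum_prod_type]
    rw [← Finset.sum_add_distrib]
    refine Finset.sum_congr rfl fun x _ => ?_
    rw [hL]
    simp only
    rw [Finset.sum_mul, ← Finset.sum_add_distrib]
    refine Finset.sum_congr rfl fun y _ => ?_
    have e : offDiag u w (x, y) * v y * phase (Pi.single x 1) f =
        ∑ z, if z = y then offDiag u w (x, y) * v z *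
          phase (Pi.single x 1 - Pi.single y 1 + Pi.single z 1) f else 0 := by
      rw [Finset.sum_ite_eq']
      simp
    rw [e, ← Finset.sum_add_distrib]
    refine Finset.sum_congr rfl fun z _ => ?_
    rw [hR, phase_add]
    simp only
    split_ifs <;> ring
  have hL2 : ∑ f, ‖∑ x, L x * phase (Pi.single x 1) f‖ ^ 2 ≤ N * S := by
    have h := sum_norm_sq_phase_of_injective L (fun x => (Pi.single x 1 : ι → ZMod 4)) (by
      intro k l _ _ hkl
      by_contra hne
      have := congrFun hkl k
      rw [Pi.single_eq_same, Pi.single_eq_of_ne hne] at this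
      revert this
      decide)
    rw [h]
    refine mul_le_mul_of_nonneg_left ?_ hN0
    rw [hS, Fintype.sum_prod_type]
    refine Finset.sum_le_sum fun x _ => ?_
    have h1 : ‖L x‖ ≤ ∑ y, ‖offDiag u w (x, y)‖ * ‖v y‖ := by
      refine (norm_sum_le _ _).trans (le_of_eq ?_)
      simp only [norm_mul]
    have h2 := Finset.sum_mul_sq_le_sq_mul_sq Finset.univ (fun y => ‖offDiag u w (x, y)‖)
      fun y => ‖v y‖
    rw [← vnorm_sq v, hv, one_pow, mul_one] at h2
    exact (pow_le_pow_left₀ (norm_nonneg _) h1 2).trans h2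
  have hR2 : ∑ f, ‖∑ k, R k * phase (Pi.single k.1 1 - Pi.single k.2.1 1 + Pi.single k.2.2 1) f‖ ^ 2 ≤
      2 * (N * S) := by
    let σ : Equiv.Perm (ι × ι × ι) :=
      { toFun := fun k => (k.2.2, k.2.1, k.1)
        invFun := fun k => (k.2.2, k.2.1, k.1)
        left_inv := fun _ => rfl
        right_inv := fun _ => rfl }
    have h := sum_norm_sq_phase_le_of_pairs R (fun k =>
      (Pi.single k.1 1 - Pi.single k.2.1 1 + Pi.single k.2.2 1 : ι → ZMod 4)) σ (by
      rintro ⟨x, y, z⟩ ⟨x', y', z'⟩ hk _ hkl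
      have hzy : z ≠ y := fun h => hk (if_pos h)
      have hxy : x ≠ y := by
        rintro rfl
        refine hk ?_
        simp [hR, offDiag]
      obtain ⟨rfl, ⟨rfl, rfl⟩ | ⟨rfl, rfl⟩⟩ := eq_or_eq_of_single_sub_single_add_single hxy hzy
        (show (Pi.single x 1 - Pi.single y 1 + Pi.single z 1 : ι → ZMod 4) =
          Pi.single x' 1 - Pi.single y' 1 + Pi.single z' 1 from hkl)
      · exact Or.inl rfl
      · exact Or.inr rfl)
    refine h.trans (mul_le_mul_of_nonneg_left (mul_le_mul_of_nonneg_left ?_ hN0) (by norm_num))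
    rw [hS, Fintype.sum_prod_type, Fintype.sum_prod_type]
    refine Finset.sum_le_sum fun x _ => ?_
    rw [Fintype.sum_prod_type]
    refine Finset.sum_le_sum fun y _ => ?_
    calc ∑ z, ‖R (x, y, z)‖ ^ 2 ≤ ∑ z, ‖offDiag u w (x, y)‖ ^ 2 * ‖v z‖ ^ 2 := by
          refine Finset.sum_le_sum fun z _ => ?_
          simp only [hR]
          split_ifs
          · rw [norm_zero, zero_pow two_ne_zero]; positivity
          · rw [norm_mul, mul_pow]
      _ = _ := by rw [← Finset.mul_sum, ← vnorm_sq, hv, one_pow, mul_one]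
  calc _ ≤ ∑ f, (2 * ‖∑ x, L x * phase (Pi.single x 1) f‖ ^ 2 + 2 *
        ‖∑ k, R k * phase (Pi.single k.1 1 - Pi.single k.2.1 1 + Pi.single k.2.2 1) f‖ ^ 2) := by
        refine Finset.sum_le_sum fun f _ => ?_
        rw [hdec]
        refine (pow_le_pow_left₀ (norm_nonneg _) (norm_add_le _ _) 2).trans ?_
        nlinarith [sq_nonneg (‖∑ x, L x * phase (Pi.single x 1) f‖ -
          ‖∑ k, R k * phase (Pi.single k.1 1 - Pi.single k.2.1 1 + Pi.single k.2.2 1) f‖)]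
    _ ≤ _ := by
        rw [Finset.sum_add_distrib, ← Finset.mul_sum, ← Finset.mul_sum]
        linarith

/-- Passes from squared moduli to moduli. With `H` the difference and `Y` the sum of moduli, `Q = ∑
(HY)² = ∑ H · (Y · HY)`, so `Q² ≤ (∑ H²) (∑ Y² (HY)²)`; the last factor is at most `24 Q` by the
previous estimate for `u` and `w`, and one `Q` cancels. -/
lemma offDiag_le_sum_sq_sub {u w : ι → ℂ} (hu : vnorm u = 1) (hw : vnorm w = 1) :
    Fintype.card (ι → ZMod 4) * ∑ p, ‖offDiag u w p‖ ^ 2 ≤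
      24 * ∑ f, (‖amplitude u f‖ - ‖amplitude w f‖) ^ 2 := by
  set Q := (Fintype.card (ι → ZMod 4) : ℝ) * ∑ p, ‖offDiag u w p‖ ^ 2 with hQ
  set H : (ι → ZMod 4) → ℝ := fun f => ‖amplitude u f‖ - ‖amplitude w f‖ with hH
  set Y : (ι → ZMod 4) → ℝ := fun f => ‖amplitude u f‖ + ‖amplitude w f‖ with hY
  have hX : ∀ f, ‖weightDiff u w f‖ ^ 2 = (H f * Y f) ^ 2 := by
    intro f
    rw [weightDiff_eq hu hw, Complex.norm_real, Real.norm_eq_abs, sq_abs, hH, hY]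
    ring
  have h1 : ∑ f, (H f * Y f) ^ 2 = Q := by
    rw [hQ, ← sum_norm_sq_weightDiff]
    exact Finset.sum_congr rfl fun f _ => (hX f).symm
  have h2 : ∑ f, (Y f * (H f * Y f)) ^ 2 ≤ 24 * Q := by
    have ha := sum_norm_sq_weightDiff_mul_amplitude_le u w hu
    have hb := sum_norm_sq_weightDiff_mul_amplitude_le u w hw
    rw [← hQ] at ha hb
    calc _ ≤ ∑ f, (2 * ‖weightDiff u w f * amplitude u f‖ ^ 2 +
          2 * ‖weightDiff u w f * amplitude w f‖ ^ 2) := by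
          refine Finset.sum_le_sum fun f _ => ?_
          have e1 : ∀ a : ℂ, ‖weightDiff u w f * a‖ ^ 2 = (H f * Y f) ^ 2 * ‖a‖ ^ 2 := fun a => by
            rw [norm_mul, mul_pow, hX]
          rw [e1, e1, mul_pow (Y f)]
          have : Y f ^ 2 ≤ 2 * ‖amplitude u f‖ ^ 2 + 2 * ‖amplitude w f‖ ^ 2 := by
            rw [hY]
            nlinarith [sq_nonneg (‖amplitude u f‖ - ‖amplitude w f‖)]
          nlinarith [sq_nonneg (H f * Y f)]
      _ ≤ _ := by
          rw [Finset.sum_add_distrib, ← Finset.mul_sum, ← Finset.mul_sum]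
          linarith
  have h3 := Finset.sum_mul_sq_le_sq_mul_sq Finset.univ H fun f => Y f * (H f * Y f)
  have h4 : ∑ f, H f * (Y f * (H f * Y f)) = Q := by
    rw [← h1]
    exact Finset.sum_congr rfl fun f _ => by ring
  rw [h4] at h3
  have h5 : 0 ≤ ∑ f, H f ^ 2 := Finset.sum_nonneg fun _ _ => sq_nonneg _
  have hQ0 : 0 ≤ Q := by rw [← h1]; exact Finset.sum_nonneg fun _ _ => sq_nonneg _
  rcases hQ0.eq_or_lt with h0 | h0
  · rw [← h0]; positivity
  · have h6 : Q ^ 2 ≤ (∑ f, H f ^ 2) * (24 * Q) := h3.trans (mul_le_mul_of_nonneg_left h2 h5)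
    nlinarith

lemma sum_norm_sq_projection_sub {u w : ι → ℂ} (hu : vnorm u = 1) (hw : vnorm w = 1) :
    ∑ p : ι × ι, ‖u p.1 * star (u p.2) - w p.1 * star (w p.2)‖ ^ 2 =
      2 * (1 - ‖star u ⬝ᵥ w‖ ^ 2) := by
  have hsq : ∀ v : ι → ℂ, vnorm v = 1 → ∑ x, ‖v x‖ ^ 2 = 1 := fun v hv => by
    rw [← vnorm_sq, hv, one_pow]
  have hexp : ∀ a b : ℂ, ‖a - b‖ ^ 2 = ‖a‖ ^ 2 + ‖b‖ ^ 2 - 2 * (star a * b).re := by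
    intro a b
    rw [← Complex.normSq_eq_norm_sq, ← Complex.normSq_eq_norm_sq, ← Complex.normSq_eq_norm_sq,
      Complex.normSq_sub]
    congr 2
    simp [Complex.mul_re]
  simp only [hexp, norm_mul, norm_star, mul_pow]
  rw [Finset.sum_sub_distrib, Finset.sum_add_distrib, ← Finset.mul_sum, ← Complex.re_sum]
  simp only [Fintype.sum_prod_type]
  rw [← Finset.sum_mul_sum, ← Finset.sum_mul_sum, hsq u hu, hsq w hw]
  have ht : ∑ x, ∑ y, star (u x * star (u y)) * (w x * star (w y)) =
      ((‖star u ⬝ᵥ w‖ ^ 2 : ℝ) : ℂ) := by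
    rw [← Complex.normSq_eq_norm_sq, ← Complex.mul_conj, dotProduct, map_sum, Finset.sum_mul_sum]
    refine Finset.sum_congr rfl fun x _ => Finset.sum_congr rfl fun y _ => ?_
    simp only [Pi.star_apply, Complex.star_def, map_mul, Complex.conj_conj]
    ring
  rw [ht, Complex.ofReal_re]
  ring

/-- Measure either in the computational basis or along a random phase vector. -/
noncomputable def phaseMeasurement (ι : Type) [Fintype ι] [DecidableEq ι] :
    Matrix (ι ⊕ (ι → ZMod 4)) ι ℂ :=
  Matrix.of fun o i => Sum.elim (fun z => if z = i then ((√(1 / 2) : ℝ) : ℂ) else 0)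
    (fun f => ((√(1 / (2 * Fintype.card (ι → ZMod 4))) : ℝ) : ℂ) * phase (Pi.single i 1) f) o

lemma phaseMeasurement_isometry :
    (phaseMeasurement ι)ᴴ * phaseMeasurement ι = 1 := by
  have hN : (Fintype.card (ι → ZMod 4) : ℝ) ≠ 0 := Nat.cast_ne_zero.2 Fintype.card_ne_zero
  ext i j
  rw [Matrix.mul_apply, Fintype.sum_sum_type]
  simp only [phaseMeasurement, Matrix.conjTranspose_apply, Matrix.of_apply, Sum.elim_inl,
    Sum.elim_inr]
  have h1 : ∑ z, star (if z = i then ((√(1 / 2) : ℝ) : ℂ) else 0) *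
      (if z = j then ((√(1 / 2) : ℝ) : ℂ) else 0) = if i = j then 1 / 2 else 0 := by
    rw [Finset.sum_eq_single i]
    · rw [if_pos rfl]
      split_ifs
      · rw [Complex.star_def, Complex.conj_ofReal, ← Complex.ofReal_mul,
          Real.mul_self_sqrt (by norm_num)]
        push_cast; rfl
      · simp
    · intro z _ hz
      simp [hz]
    · simp
  have h2 : ∑ f, star (((√(1 / (2 * Fintype.card (ι → ZMod 4))) : ℝ) : ℂ) * phase (Pi.single i 1) f) *
      (((√(1 / (2 * Fintype.card (ι → ZMod 4))) : ℝ) : ℂ) * phase (Pi.single j 1) f) =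
      if i = j then 1 / 2 else 0 := by
    have h3 : ∀ f, star (((√(1 / (2 * Fintype.card (ι → ZMod 4))) : ℝ) : ℂ) * phase (Pi.single i 1) f) *
      (((√(1 / (2 * Fintype.card (ι → ZMod 4))) : ℝ) : ℂ) * phase (Pi.single j 1) f) =
      ((1 / (2 * Fintype.card (ι → ZMod 4)) : ℝ) : ℂ) *
        (phase (Pi.single j 1) f * star (phase (Pi.single i 1) f)) := by
      intro f
      have h5 : ((1 / (2 * Fintype.card (ι → ZMod 4)) : ℝ) : ℂ) =
          ((√(1 / (2 * Fintype.card (ι → ZMod 4))) : ℝ) : ℂ) *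
            ((√(1 / (2 * Fintype.card (ι → ZMod 4))) : ℝ) : ℂ) := by
        rw [← Complex.ofReal_mul, Real.mul_self_sqrt (by positivity)]
      rw [h5]
      simp only [Complex.star_def, map_mul, Complex.conj_ofReal]
      ring
    simp only [h3]
    rw [← Finset.mul_sum, sum_phase_mul_star]
    have h4 : ((Pi.single j 1 : ι → ZMod 4) = Pi.single i 1) ↔ i = j := by
      constructor
      · intro h
        by_contra hne
        have := congrFun h i
        rw [Pi.single_eq_same, Pi.single_eq_of_ne hne] at this
        revert this
        decide
      · rintro rfl; rfl
    simp only [h4]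
    split_ifs
    · rw [← Complex.ofReal_natCast, ← Complex.ofReal_mul]
      have : 1 / (2 * (Fintype.card (ι → ZMod 4) : ℝ)) * Fintype.card (ι → ZMod 4) = 1 / 2 := by
        field_simp
      rw [this]
      push_cast; rfl
    · simp
  rw [h1, h2, Matrix.one_apply]
  split_ifs <;> norm_num

/-- The Bhattacharyya coefficient of the outcome distributions of two states. -/
lemma bhattacharyya_phaseMeasurement_le {u w : ι → ℂ} (hu : vnorm u = 1) (hw : vnorm w = 1) :
    ∑ o, ‖(phaseMeasurement ι *ᵥ u) o‖ * ‖(phaseMeasurement ι *ᵥ w) o‖ ≤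
      1 - (1 - ‖star u ⬝ᵥ w‖ ^ 2) / 48 := by
  set N : ℝ := (Fintype.card (ι → ZMod 4) : ℝ) with hN
  have hNpos : 0 < N := by
    rw [hN]
    exact_mod_cast Fintype.card_pos
  have hinl : ∀ v : ι → ℂ, ∀ z, ‖(phaseMeasurement ι *ᵥ v) (Sum.inl z)‖ = √(1 / 2) * ‖v z‖ := by
    intro v z
    have : (phaseMeasurement ι *ᵥ v) (Sum.inl z) = ((√(1 / 2) : ℝ) : ℂ) * v z := by
      simp [Matrix.mulVec, dotProduct, phaseMeasurement]
    rw [this, norm_mul, Complex.norm_real, Real.norm_of_nonneg (Real.sqrt_nonneg _)]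
  have hinr : ∀ v : ι → ℂ, ∀ f, ‖(phaseMeasurement ι *ᵥ v) (Sum.inr f)‖ =
      √(1 / (2 * N)) * ‖amplitude v f‖ := by
    intro v f
    have : (phaseMeasurement ι *ᵥ v) (Sum.inr f) = ((√(1 / (2 * N)) : ℝ) : ℂ) * amplitude v f := by
      simp only [Matrix.mulVec, dotProduct, phaseMeasurement, amplitude, Matrix.of_apply,
        Sum.elim_inr, Finset.mul_sum, ← hN]
      refine Finset.sum_congr rfl fun x _ => ?_
      ring
    rw [this, norm_mul, Complex.norm_real, Real.norm_of_nonneg (Real.sqrt_nonneg _)]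
  have hprod : ∀ s a b : ℝ, 0 ≤ s → √s * a * (√s * b) = s * (a * b) := by
    intro s a b hs
    rw [mul_mul_mul_comm, Real.mul_self_sqrt hs]
  rw [Fintype.sum_sum_type]
  simp only [hinl, hinr]
  simp only [hprod (1 / 2) _ _ (by norm_num), hprod (1 / (2 * N)) _ _ (by positivity)]
  rw [← Finset.mul_sum, ← Finset.mul_sum]
  have hab : ∀ a b : ℝ, a * b = (a ^ 2 + b ^ 2 - (a - b) ^ 2) / 2 := fun a b => by ring
  have hsq : ∀ v : ι → ℂ, vnorm v = 1 → ∑ x, ‖v x‖ ^ 2 = 1 := fun v hv => by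
    rw [← vnorm_sq, hv, one_pow]
  have e1 : ∑ z, ‖u z‖ * ‖w z‖ = 1 - (∑ z, (‖u z‖ - ‖w z‖) ^ 2) / 2 := by
    simp only [hab ‖u _‖ ‖w _‖]
    rw [← Finset.sum_div, Finset.sum_sub_distrib, Finset.sum_add_distrib, hsq u hu, hsq w hw]
    ring
  have e2 : ∑ f, ‖amplitude u f‖ * ‖amplitude w f‖ =
      N - (∑ f, (‖amplitude u f‖ - ‖amplitude w f‖) ^ 2) / 2 := by
    simp only [hab ‖amplitude u _‖ ‖amplitude w _‖]
    rw [← Finset.sum_div, Finset.sum_sub_distrib, Finset.sum_add_distrib, sum_norm_sq_amplitude hu,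
      sum_norm_sq_amplitude hw]
    ring
  rw [e1, e2]
  have hoff := offDiag_le_sum_sq_sub hu hw
  rw [← hN] at hoff
  -- The diagonal part, missed by the random phases, is what the computational-basis half detects.
  -- The final constant: the coefficient is `1 - D/4 - H/(4N)`, while twice the infidelity is at
  -- most `4D + 24 H/N`.
  have hdiag : ∑ x, ‖u x * star (u x) - w x * star (w x)‖ ^ 2 ≤ 4 * ∑ x, (‖u x‖ - ‖w x‖) ^ 2 := by
    rw [Finset.mul_sum]
    refine Finset.sum_le_sum fun x _ => ?_
    have hle : ∀ v : ι → ℂ, vnorm v = 1 → ‖v x‖ ≤ 1 := by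
      intro v hv
      have h1 : ‖v x‖ ^ 2 ≤ 1 := by
        rw [← hsq v hv]
        exact Finset.single_le_sum (f := fun x => ‖v x‖ ^ 2) (fun _ _ => sq_nonneg _)
          (Finset.mem_univ x)
      nlinarith [norm_nonneg (v x)]
    have e : u x * star (u x) - w x * star (w x) = ((‖u x‖ ^ 2 - ‖w x‖ ^ 2 : ℝ) : ℂ) := by
      rw [Complex.star_def, Complex.mul_conj, Complex.mul_conj,
        Complex.normSq_eq_norm_sq, Complex.normSq_eq_norm_sq, Complex.ofReal_sub]
    rw [e, Complex.norm_real, Real.norm_eq_abs, sq_abs]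
    have h1 := hle u hu
    have h2 := hle w hw
    have h3 : (‖u x‖ ^ 2 - ‖w x‖ ^ 2) ^ 2 = (‖u x‖ - ‖w x‖) ^ 2 * (‖u x‖ + ‖w x‖) ^ 2 := by ring
    have h4 : (‖u x‖ + ‖w x‖) ^ 2 ≤ 4 := by
      nlinarith [norm_nonneg (u x), norm_nonneg (w x)]
    rw [h3]
    nlinarith [sq_nonneg (‖u x‖ - ‖w x‖)]
  have htot : ∑ x, ‖u x * star (u x) - w x * star (w x)‖ ^ 2 + ∑ p, ‖offDiag u w p‖ ^ 2 =
      2 * (1 - ‖star u ⬝ᵥ w‖ ^ 2) := by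
    rw [← sum_norm_sq_projection_sub hu hw]
    have : ∑ x, ‖u x * star (u x) - w x * star (w x)‖ ^ 2 = ∑ p : ι × ι,
        if p.1 = p.2 then ‖u p.1 * star (u p.2) - w p.1 * star (w p.2)‖ ^ 2 else 0 := by
      rw [Fintype.sum_prod_type]
      simp only [Finset.sum_ite_eq, Finset.mem_univ, if_true]
    rw [this, ← Finset.sum_add_distrib]
    refine Finset.sum_congr rfl fun p _ => ?_
    rw [offDiag]
    split_ifs <;> simp
  set H := ∑ f, (‖amplitude u f‖ - ‖amplitude w f‖) ^ 2
  set D := ∑ x, (‖u x‖ - ‖w x‖) ^ 2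
  have hD0 : 0 ≤ D := Finset.sum_nonneg fun _ _ => sq_nonneg _
  have hoff' : ∑ p, ‖offDiag u w p‖ ^ 2 ≤ 24 * (H / N) := by
    rw [← mul_div_assoc, le_div_iff₀ hNpos]
    linarith
  have e3 : 1 / (2 * N) * (N - H / 2) = 1 / 2 - H / N / 4 := by
    field_simp
    ring
  rw [e3]
  linarith

end RandomPhaseMeasurement
end UnitaryLearning

namespace UnitaryLearning
open scoped Matrix Kronecker ComplexOrder Matrix.Norms.L2Operator

/-! ### Choi states and closeness up to phase -/

section Choi
variable {ι : Type} [Fintype ι]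

/-- The normalized vectorization of a matrix. -/
noncomputable def choi (W : Matrix ι ι ℂ) : ι × ι → ℂ :=
  fun p => ((√(Fintype.card ι) : ℝ) : ℂ)⁻¹ * W p.1 p.2

lemma choi_sub (A B : Matrix ι ι ℂ) : choi (A - B) = choi A - choi B := by
  funext p
  simp [choi, mul_sub]

lemma choi_smul (c : ℂ) (A : Matrix ι ι ℂ) : choi (c • A) = c • choi A := by
  funext p
  simp only [choi, Matrix.smul_apply, smul_eq_mul, Pi.smul_apply]
  ring

lemma card_mul_vnorm_choi_sq [Nonempty ι] (A : Matrix ι ι ℂ) :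
    Fintype.card ι * vnorm (choi A) ^ 2 = ∑ x, ∑ y, ‖A x y‖ ^ 2 := by
  have hd : (0 : ℝ) < Fintype.card ι := Nat.cast_pos.2 Fintype.card_pos
  rw [vnorm_sq, Fintype.sum_prod_type, Finset.mul_sum]
  refine Finset.sum_congr rfl fun x _ => ?_
  rw [Finset.mul_sum]
  refine Finset.sum_congr rfl fun y _ => ?_
  rw [choi, norm_mul, mul_pow, norm_inv, Complex.norm_real, Real.norm_of_nonneg (Real.sqrt_nonneg _),
    inv_pow, Real.sq_sqrt hd.le, mul_inv_cancel_left₀ hd.ne']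

lemma exists_phase_mul_eq_norm (t : ℂ) : ∃ c : ℂ, ‖c‖ = 1 ∧ star c * t = (‖t‖ : ℂ) := by
  rcases eq_or_ne t 0 with rfl | ht
  · exact ⟨1, by simp, by simp⟩
  · have h : (‖t‖ : ℂ) ≠ 0 := by exact_mod_cast norm_ne_zero_iff.2 ht
    refine ⟨t / ‖t‖, by simp [ht], ?_⟩
    rw [Complex.star_def, map_div₀, Complex.conj_ofReal, div_mul_eq_mul_div,
      ← Complex.normSq_eq_conj_mul_self, Complex.normSq_eq_norm_sq]
    push_cast
    field_simp

lemma exists_phase_vnorm_sub_sq {u w : ι → ℂ} (hu : vnorm u = 1) (hw : vnorm w = 1) :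
    ∃ c : ℂ, ‖c‖ = 1 ∧ vnorm (u - c • w) ^ 2 = 2 * (1 - ‖star u ⬝ᵥ w‖) := by
  obtain ⟨c, hc, hct⟩ := exists_phase_mul_eq_norm (star w ⬝ᵥ u)
  refine ⟨c, hc, ?_⟩
  have h1 : vnorm (u - c • w) ^ 2 = vnorm u ^ 2 - 2 * (star (c • w) ⬝ᵥ u).re + vnorm (c • w) ^ 2 := by
    rw [dotProduct_eq_inner, ← inner_conj_symm, Complex.conj_re]
    exact norm_sub_sq (𝕜 := ℂ) (WithLp.toLp 2 u : EuclideanSpace ℂ ι) (WithLp.toLp 2 (c • w))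
  have h2 : ‖star w ⬝ᵥ u‖ = ‖star u ⬝ᵥ w‖ := by
    rw [← norm_star (star w ⬝ᵥ u), ← Matrix.star_dotProduct_star, star_star]
  rw [h1, vnorm_smul, hc, hu, hw, star_smul, smul_dotProduct, smul_eq_mul, hct, Complex.ofReal_re, h2]
  ring

variable [DecidableEq ι]

lemma kronecker_one_mulVec_choi (A W : Matrix ι ι ℂ) :
    (A ⊗ₖ (1 : Matrix ι ι ℂ)) *ᵥ choi W = choi (A * W) := by
  funext ⟨x, y⟩
  simp only [choi, Matrix.mulVec, dotProduct, Fintype.sum_prod_type, Matrix.mul_apply,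
    Matrix.kroneckerMap_apply, Finset.mul_sum]
  refine Finset.sum_congr rfl fun z _ => ?_
  rw [Finset.sum_eq_single y]
  · simp only [Matrix.one_apply_eq]; ring
  · intro b _ hb
    simp [Matrix.one_apply_ne hb.symm]
  · simp

lemma vnorm_choi [Nonempty ι] (U : Matrix.unitaryGroup ι ℂ) :
    vnorm (choi (U : Matrix ι ι ℂ)) = 1 := by
  have hd : (0 : ℝ) < Fintype.card ι := Nat.cast_pos.2 Fintype.card_pos
  have h1 := card_mul_vnorm_choi_sq (U : Matrix ι ι ℂ)
  have h2 : ∀ y, ∑ x, ‖(U : Matrix ι ι ℂ) x y‖ ^ 2 = 1 := by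
    intro y
    have h := congrFun (congrFun (unitary_conjTranspose_mul U) y) y
    rw [Matrix.mul_apply, Matrix.one_apply_eq] at h
    have h3 : ((∑ x, ‖(U : Matrix ι ι ℂ) x y‖ ^ 2 : ℝ) : ℂ) = 1 := by
      rw [← h]
      push_cast
      refine Finset.sum_congr rfl fun x _ => ?_
      rw [Matrix.conjTranspose_apply, Complex.star_def, ← Complex.normSq_eq_conj_mul_self,
        Complex.normSq_eq_norm_sq]
      push_cast; rfl
    exact_mod_cast h3
  rw [Finset.sum_comm] at h1
  simp only [h2, Finset.sum_const, Finset.card_univ, nsmul_eq_mul, mul_one] at h1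
  have h3 : vnorm (choi (U : Matrix ι ι ℂ)) ^ 2 = 1 := by
    have := mul_left_cancel₀ hd.ne' (h1.trans (mul_one _).symm)
    exact this
  nlinarith [vnorm_nonneg (choi (U : Matrix ι ι ℂ))]

lemma opNorm_sq_le_card_mul_vnorm_choi_sq [Nonempty ι] (A : Matrix ι ι ℂ) :
    ‖A‖ ^ 2 ≤ Fintype.card ι * vnorm (choi A) ^ 2 := by
  rw [card_mul_vnorm_choi_sq]
  set F := ∑ x, ∑ y, ‖A x y‖ ^ 2
  have hF : 0 ≤ F := Finset.sum_nonneg fun _ _ => Finset.sum_nonneg fun _ _ => sq_nonneg _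
  have h : ‖A‖ ≤ √F := by
    refine opNorm_le_of_vnorm A (Real.sqrt_nonneg _) fun v => ?_
    refine abs_le_of_sq_le_sq' ?_ (mul_nonneg (Real.sqrt_nonneg _) (vnorm_nonneg _)) |>.2
    rw [mul_pow, Real.sq_sqrt hF, vnorm_sq, vnorm_sq, Finset.sum_mul]
    refine Finset.sum_le_sum fun x _ => ?_
    have h1 : ‖(A *ᵥ v) x‖ ≤ ∑ y, ‖A x y‖ * ‖v y‖ :=
      (norm_sum_le _ _).trans (le_of_eq (by simp only [norm_mul]))
    exact (pow_le_pow_left₀ (norm_nonneg _) h1 2).trans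
      (Finset.sum_mul_sq_le_sq_mul_sq Finset.univ _ _)
  calc ‖A‖ ^ 2 ≤ √F ^ 2 := pow_le_pow_left₀ (norm_nonneg _) h 2
    _ = F := Real.sq_sqrt hF

/-- `A` and `B` are within operator norm `r` up to a global phase. -/
def PhaseClose (r : ℝ) (A B : Matrix ι ι ℂ) : Prop := ∃ c : ℂ, ‖c‖ = 1 ∧ ‖A - c • B‖ ≤ r

/-- Align the phase so that the overlap is its modulus `t`; then the Frobenius norm gives `‖A - c
B‖² ≤ 2d(1 - t) ≤ 2d(1 - t²)`. The dimension lost here is the source of `2^n` in the query count. -/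
lemma phaseClose_of_two_mul_card_mul_le [Nonempty ι] (A B : Matrix.unitaryGroup ι ℂ) {r : ℝ} (hr : 0 ≤ r)
    (h : 2 * Fintype.card ι * (1 - ‖star (choi (A : Matrix ι ι ℂ)) ⬝ᵥ choi (B : Matrix ι ι ℂ)‖ ^ 2) ≤ r ^ 2) :
    PhaseClose r (A : Matrix ι ι ℂ) (B : Matrix ι ι ℂ) := by
  have hA := vnorm_choi A
  have hB := vnorm_choi B
  obtain ⟨c, hc, hcn⟩ := exists_phase_vnorm_sub_sq hA hB
  refine ⟨c, hc, abs_le_of_sq_le_sq' ?_ hr |>.2⟩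
  have h1 := opNorm_sq_le_card_mul_vnorm_choi_sq ((A : Matrix ι ι ℂ) - c • (B : Matrix ι ι ℂ))
  rw [choi_sub, choi_smul, hcn] at h1
  have ht := norm_dotProduct_le (choi (A : Matrix ι ι ℂ)) (choi (B : Matrix ι ι ℂ))
  rw [hA, hB, mul_one] at ht
  set t := ‖star (choi (A : Matrix ι ι ℂ)) ⬝ᵥ choi (B : Matrix ι ι ℂ)‖
  have ht0 : 0 ≤ t := norm_nonneg _
  have hd : (0 : ℝ) ≤ Fintype.card ι := Nat.cast_nonneg _
  have : (Fintype.card ι : ℝ) * (2 * (1 - t)) ≤ 2 * Fintype.card ι * (1 - t ^ 2) := by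
    nlinarith [mul_nonneg hd (mul_nonneg ht0 (sub_nonneg.2 ht))]
  linarith

/-- Unitaries that differ by more than `r` have distinguishable Choi states. -/
lemma bhattacharyya_choi_le [Nonempty ι] (A B : Matrix.unitaryGroup ι ℂ) {r : ℝ} (hr : 0 ≤ r)
    (h : ¬ PhaseClose r (A : Matrix ι ι ℂ) (B : Matrix ι ι ℂ)) :
    ∑ o, ‖(phaseMeasurement (ι × ι) *ᵥ choi (A : Matrix ι ι ℂ)) o‖ *
      ‖(phaseMeasurement (ι × ι) *ᵥ choi (B : Matrix ι ι ℂ)) o‖ ≤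
        1 - r ^ 2 / (96 * Fintype.card ι) := by
  refine (bhattacharyya_phaseMeasurement_le (vnorm_choi A) (vnorm_choi B)).trans ?_
  have hd : (0 : ℝ) < Fintype.card ι := Nat.cast_pos.2 Fintype.card_pos
  have h1 := lt_of_not_ge (mt (phaseClose_of_two_mul_card_mul_le A B hr) h)
  set X := 1 - ‖star (choi (A : Matrix ι ι ℂ)) ⬝ᵥ choi (B : Matrix ι ι ℂ)‖ ^ 2
  have h2 : r ^ 2 / (96 * Fintype.card ι) ≤ X / 48 := by
    rw [div_le_div_iff₀ (by positivity) (by norm_num)]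
    linarith
  linarith

end Choi

/-! ### Powers amplify small differences -/

section Amplification
variable {ι : Type} [Fintype ι] [DecidableEq ι]

lemma PhaseClose.symm {r : ℝ} {A B : Matrix ι ι ℂ} (h : PhaseClose r A B) : PhaseClose r B A := by
  obtain ⟨c, hc, h⟩ := h
  have hc0 : c ≠ 0 := by rintro rfl; simp at hc
  refine ⟨c⁻¹, by rw [norm_inv, hc, inv_one], ?_⟩
  have : B - c⁻¹ • A = -(c⁻¹ • (A - c • B)) := by
    rw [smul_sub, smul_smul, inv_mul_cancel₀ hc0, one_smul, neg_sub]
  rw [this, norm_neg, norm_smul, norm_inv, hc, inv_one, one_mul]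
  exact h

lemma PhaseClose.refl {r : ℝ} (hr : 0 ≤ r) (A : Matrix ι ι ℂ) : PhaseClose r A A :=
  ⟨1, by simp, by simpa using hr⟩

lemma phaseClose_unitary_mul_iff {r : ℝ} (V : Matrix.unitaryGroup ι ℂ) {A B : Matrix ι ι ℂ} :
    PhaseClose r ((V : Matrix ι ι ℂ) * A) ((V : Matrix ι ι ℂ) * B) ↔ PhaseClose r A B := by
  have hle : ∀ (V : Matrix.unitaryGroup ι ℂ) (A B : Matrix ι ι ℂ), PhaseClose r A B →
      PhaseClose r ((V : Matrix ι ι ℂ) * A) ((V : Matrix ι ι ℂ) * B) := by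
    rintro V A B ⟨c, hc, h⟩
    refine ⟨c, hc, ?_⟩
    rw [← Matrix.mul_smul, ← Matrix.mul_sub]
    refine (norm_mul_le _ _).trans ?_
    exact (mul_le_of_le_one_left (norm_nonneg _) (opNorm_unitary_le V)).trans h
  refine ⟨fun h => ?_, hle V A B⟩
  have h1 := hle V⁻¹ _ _ h
  have h2 : ((V⁻¹ : Matrix.unitaryGroup ι ℂ) : Matrix ι ι ℂ) * (V : Matrix ι ι ℂ) = 1 :=
    unitary_conjTranspose_mul V
  rwa [← Matrix.mul_assoc, ← Matrix.mul_assoc, h2, Matrix.one_mul, Matrix.one_mul] at h1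

lemma norm_pow_sub_one_le {A : Matrix ι ι ℂ} {s : ℝ} (hA : ‖A‖ ≤ 1) (hs : ‖A - 1‖ ≤ s) (k : ℕ) :
    ‖A ^ k - 1‖ ≤ k * s := by
  induction k with
  | zero => simp
  | succ k ih =>
    have e : A ^ (k + 1) - 1 = A * (A ^ k - 1) + (A - 1) := by rw [pow_succ']; noncomm_ring
    rw [e]
    refine (norm_add_le _ _).trans ?_
    have := (norm_mul_le A (A ^ k - 1)).trans (mul_le_of_le_one_left (norm_nonneg _) hA)
    push_cast
    linarith

/-- Near the identity `A^k - B^k` is `k (A - B)` to first order. The error is relative to `‖A - B‖`,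
so it can be absorbed when `k s` is small. -/
lemma norm_pow_sub_pow_sub_le {A B : Matrix ι ι ℂ} {s : ℝ} (hA : ‖A‖ ≤ 1) (hB : ‖B‖ ≤ 1)
    (hAs : ‖A - 1‖ ≤ s) (hBs : ‖B - 1‖ ≤ s) (k : ℕ) :
    ‖A ^ k - B ^ k - (k : ℂ) • (A - B)‖ ≤ k ^ 2 * s * ‖A - B‖ := by
  have hs : 0 ≤ s := (norm_nonneg _).trans hAs
  induction k with
  | zero => simp
  | succ k ih =>
    have e : A ^ (k + 1) - B ^ (k + 1) - ((k + 1 : ℕ) : ℂ) • (A - B) =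
        (A ^ k - 1) * (A - B) + (A ^ k - B ^ k - (k : ℂ) • (A - B)) * B +
          (k : ℂ) • ((A - B) * (B - 1)) := by
      rw [sub_mul _ ((k : ℂ) • (A - B)), Matrix.smul_mul, mul_sub (A - B),
        smul_sub (k : ℂ) ((A - B) * B), pow_succ, pow_succ]
      push_cast
      rw [add_smul, one_smul, mul_one]
      generalize (k : ℂ) • ((A - B) * B) = X
      generalize (k : ℂ) • (A - B) = Y
      noncomm_ring
    rw [e]
    have h1 : ‖(A ^ k - 1) * (A - B)‖ ≤ k * s * ‖A - B‖ :=
      (norm_mul_le _ _).trans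
        (mul_le_mul_of_nonneg_right (norm_pow_sub_one_le hA hAs k) (norm_nonneg _))
    have h2 : ‖(A ^ k - B ^ k - (k : ℂ) • (A - B)) * B‖ ≤ k ^ 2 * s * ‖A - B‖ :=
      (norm_mul_le _ _).trans ((mul_le_of_le_one_right (norm_nonneg _) hB).trans ih)
    have h3 : ‖(k : ℂ) • ((A - B) * (B - 1))‖ ≤ k * (‖A - B‖ * s) := by
      rw [norm_smul, Complex.norm_natCast]
      exact mul_le_mul_of_nonneg_left ((norm_mul_le _ _).trans
        (mul_le_mul_of_nonneg_left hBs (norm_nonneg _))) (Nat.cast_nonneg _)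
    refine (norm_add₃_le).trans ?_
    push_cast
    nlinarith [mul_nonneg hs (norm_nonneg (A - B))]

/-- A unit complex number near `1` has a `P`-th root at distance `O(1 / P)` of `1`. -/
lemma exists_root_near_one {c : ℂ} (hc : ‖c‖ = 1) {P : ℕ} (hP : 0 < P) :
    ∃ γ : ℂ, ‖γ‖ = 1 ∧ γ ^ P = c ∧ ‖γ - 1‖ ≤ 2 * ‖c - 1‖ / P := by
  have hP' : (0 : ℝ) < P := Nat.cast_pos.2 hP
  have hPc : (P : ℂ) ≠ 0 := Nat.cast_ne_zero.2 hP.ne'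
  have hc0 : c ≠ 0 := by rintro rfl; simp at hc
  have harg : |c.arg| ≤ 2 * ‖c - 1‖ := by
    have h := Complex.angle_le_mul_norm_sub hc norm_one
    rw [InnerProductGeometry.angle_comm, Complex.angle_one_left hc0] at h
    refine h.trans (mul_le_mul_of_nonneg_right ?_ (norm_nonneg _))
    linarith [Real.pi_le_four]
  refine ⟨Complex.exp ((c.arg / P : ℝ) * Complex.I), Complex.norm_exp_ofReal_mul_I _, ?_, ?_⟩
  · rw [← Complex.exp_nat_mul]
    have : (P : ℂ) * (((c.arg / P : ℝ) : ℂ) * Complex.I) = c.arg * Complex.I := by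
      push_cast
      field_simp
    rw [this]
    have h := Complex.norm_mul_exp_arg_mul_I c
    rwa [hc, Complex.ofReal_one, one_mul] at h
  · rw [mul_comm ((c.arg / P : ℝ) : ℂ)]
    refine (Real.norm_exp_I_mul_ofReal_sub_one_le).trans ?_
    rw [Real.norm_eq_abs, abs_div, Nat.abs_cast]
    exact div_le_div_of_nonneg_right harg hP'.le

/-- The phase relating the powers must be near 1, because both powers are; so it has a `P`-th root
within `O(1/P)` of 1. Moving this root into `B` reduces to linearizing two powers near the identity.
-/
lemma exists_phase_of_pow_close [Nonempty ι] {A B : Matrix ι ι ℂ} {r : ℝ} {c : ℂ} {P : ℕ} (hP : 0 < P)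
    (hA : ‖A‖ ≤ 1) (hB : ‖B‖ ≤ 1) (hAr : ‖A - 1‖ ≤ r) (hBr : ‖B - 1‖ ≤ r) (hPr : P * r ≤ 1 / 20)
    (hc : ‖c‖ = 1) (h : ‖A ^ P - c • B ^ P‖ ≤ 1 / 80) :
    ∃ γ : ℂ, ‖γ‖ = 1 ∧ ‖A - γ • B‖ ≤ 1 / (40 * P) := by
  have hP' : (0 : ℝ) < P := Nat.cast_pos.2 hP
  have hone : ‖(1 : Matrix ι ι ℂ)‖ = 1 := CStarRing.norm_one
  -- `1/20 + 1/80 + 1/20`, the distances from `c` times the identity to `c • B ^ P`, to `A ^ P` and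
  -- to the identity.
  have hc1 : ‖c - 1‖ ≤ 9 / 80 := by
    have e : (c - 1) • (1 : Matrix ι ι ℂ) = -(c • (B ^ P - 1)) - (A ^ P - c • B ^ P) + (A ^ P - 1) := by
      rw [sub_smul, one_smul, smul_sub]
      abel
    have h1 : ‖(c - 1) • (1 : Matrix ι ι ℂ)‖ = ‖c - 1‖ := by rw [norm_smul, hone, mul_one]
    have h2 : ‖c • (B ^ P - 1)‖ ≤ P * r := by
      rw [norm_smul, hc, one_mul]
      exact norm_pow_sub_one_le hB hBr P
    have h3 := norm_pow_sub_one_le hA hAr P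
    rw [← h1, e]
    refine (norm_add_le _ _).trans ?_
    have h4 := norm_sub_le (-(c • (B ^ P - 1))) (A ^ P - c • B ^ P)
    rw [norm_neg] at h4
    linarith
  obtain ⟨γ, hγ, hγP, hγ1⟩ := exists_root_near_one hc hP
  refine ⟨γ, hγ, ?_⟩
  -- `1/20` from `P r` plus `2 · 9/80` from the root, both divided by `P`.
  set s : ℝ := 11 / 40 / P with hs
  have hPs : P * s = 11 / 40 := by rw [hs]; field_simp
  have hrP : r ≤ 1 / 20 / P := by rw [le_div_iff₀ hP']; linarith
  have hγ2 : ‖γ - 1‖ ≤ 9 / 40 / P :=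
    hγ1.trans (div_le_div_of_nonneg_right (by linarith) hP'.le)
  have hsum : 1 / 20 / (P : ℝ) + 9 / 40 / P = s := by rw [hs]; ring
  have hpos : 0 ≤ 9 / 40 / (P : ℝ) := by positivity
  have hAs : ‖A - 1‖ ≤ s := by linarith
  have hγB : ‖γ • B‖ ≤ 1 := by rw [norm_smul, hγ, one_mul]; exact hB
  have hBs : ‖γ • B - 1‖ ≤ s := by
    have e : γ • B - 1 = γ • (B - 1) + (γ - 1) • (1 : Matrix ι ι ℂ) := by
      rw [smul_sub, sub_smul, one_smul]; abel
    rw [e]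
    refine (norm_add_le _ _).trans ?_
    rw [norm_smul, norm_smul, hγ, one_mul, hone, mul_one]
    linarith
  have h1 := norm_pow_sub_pow_sub_le hA hγB hAs hBs P
  rw [smul_pow, hγP] at h1
  set x := ‖A - γ • B‖ with hx
  have hx0 : 0 ≤ x := norm_nonneg _
  have h2 : P * x ≤ ‖A ^ P - c • B ^ P‖ + P ^ 2 * s * x := by
    have h3 : (P : ℂ) • (A - γ • B) =
        (A ^ P - c • B ^ P) - (A ^ P - c • B ^ P - (P : ℂ) • (A - γ • B)) := by abel
    have h4 : ‖(P : ℂ) • (A - γ • B)‖ = P * x := by rw [norm_smul, Complex.norm_natCast]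
    rw [← h4, h3]
    exact (norm_sub_le _ _).trans (by linarith)
  have h5 : (P : ℝ) ^ 2 * s * x = 11 / 40 * (P * x) := by
    rw [sq, mul_assoc (P : ℝ), hPs]; ring
  -- Here `(1 - 11/40) P x ≤ 1/80`, so `P x ≤ 1/58`, below the required `1/40`.
  rw [le_div_iff₀ (by positivity)]
  rw [h5] at h2
  linarith

/-- If two unitaries are close to the identity and their `P`-th powers are close, then they are
themselves closer by a factor of order `P`. -/
lemma phaseClose_of_pow [Nonempty ι] (A B : Matrix.unitaryGroup ι ℂ) {r : ℝ} {P : ℕ} (hP : 0 < P)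
    (hPr : P * r ≤ 1 / 20) (hA : PhaseClose r (A : Matrix ι ι ℂ) 1)
    (hB : PhaseClose r (B : Matrix ι ι ℂ) 1)
    (h : PhaseClose (1 / 80) ((A : Matrix ι ι ℂ) ^ P) ((B : Matrix ι ι ℂ) ^ P)) :
    PhaseClose (1 / (40 * P)) (A : Matrix ι ι ℂ) (B : Matrix ι ι ℂ) := by
  obtain ⟨a, ha, hA⟩ := hA
  obtain ⟨b, hb, hB⟩ := hB
  obtain ⟨c, hc, h⟩ := h
  have hne : ∀ z : ℂ, ‖z‖ = 1 → z ≠ 0 := by rintro z hz rfl; simp at hz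
  have hnorm : ∀ (z : ℂ) (M : Matrix ι ι ℂ), ‖z‖ = 1 → ‖z⁻¹ • M‖ = ‖M‖ := by
    intro z M hz
    rw [norm_smul, norm_inv, hz, inv_one, one_mul]
  have hnear : ∀ (z : ℂ) (M : Matrix ι ι ℂ), ‖z‖ = 1 → ‖M - z • 1‖ ≤ r → ‖z⁻¹ • M - 1‖ ≤ r := by
    intro z M hz hM
    rw [← hnorm z _ hz, smul_sub, smul_smul, inv_mul_cancel₀ (hne z hz), one_smul] at hM
    exact hM
  have hpow : ‖(a⁻¹ • (A : Matrix ι ι ℂ)) ^ P -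
      (a⁻¹ ^ P * c * b ^ P) • (b⁻¹ • (B : Matrix ι ι ℂ)) ^ P‖ ≤ 1 / 80 := by
    have hb' := pow_ne_zero P (hne b hb)
    have e : (a⁻¹ • (A : Matrix ι ι ℂ)) ^ P -
        (a⁻¹ ^ P * c * b ^ P) • (b⁻¹ • (B : Matrix ι ι ℂ)) ^ P =
        (a ^ P)⁻¹ • ((A : Matrix ι ι ℂ) ^ P - c • (B : Matrix ι ι ℂ) ^ P) := by
      rw [smul_pow, smul_pow, smul_smul, smul_sub, smul_smul, inv_pow, inv_pow,
        mul_assoc _ (b ^ P), mul_inv_cancel₀ hb', mul_one]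
    rw [e, hnorm _ _ (by rw [norm_pow, ha, one_pow])]
    exact h
  obtain ⟨γ, hγ, hγ'⟩ := exists_phase_of_pow_close hP
    ((hnorm a _ ha).trans_le (opNorm_unitary_le A)) ((hnorm b _ hb).trans_le (opNorm_unitary_le B))
    (hnear a _ ha hA) (hnear b _ hb hB) hPr
    (by rw [norm_mul, norm_mul, norm_pow, norm_pow, norm_inv, ha, hb, hc]; simp) hpow
  refine ⟨a * γ * b⁻¹, by rw [norm_mul, norm_mul, norm_inv, ha, hb, hγ]; simp, ?_⟩
  rw [← hnorm a _ ha, smul_sub, smul_smul, mul_assoc a, inv_mul_cancel_left₀ (hne a ha), ← smul_smul]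
  exact hγ'

end Amplification
end UnitaryLearning

namespace UnitaryLearning
open scoped Matrix Kronecker ComplexOrder Matrix.Norms.L2Operator

/-! ### Maximum likelihood estimation -/

section MaximumLikelihood
variable {N Ω : Type} [Fintype N] [Fintype Ω]

/-- The probability that the maximum likelihood estimate, from `m` independent samples, is a given
kind of wrong candidate. Here `a w o` is the square root of the probability of `o` under `w`. -/
lemma sum_maximumLikelihood_le (S : Finset N) {u : N} (hu : u ∈ S) {a : N → Ω → ℝ}
    (ha : ∀ w o, 0 ≤ a w o) (bad : N → Prop) [DecidablePred bad] {β : ℝ} (hβ0 : 0 ≤ β)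
    (hβ : ∀ w ∈ S, bad w → ∑ o, a w o * a u o ≤ β) {m : ℕ} (sel : (Fin m → Ω) → N)
    (hsel : ∀ h, sel h ∈ S ∧ ∀ w ∈ S, ∏ i, a w (h i) ≤ ∏ i, a (sel h) (h i)) :
    ∑ h with bad (sel h), ∏ i, a u (h i) ^ 2 ≤ Fintype.card N * β ^ m := by
  have hprod : ∀ w (h : Fin m → Ω), 0 ≤ ∏ i, a w (h i) := fun w h =>
    Finset.prod_nonneg fun i _ => ha w (h i)
  calc ∑ h with bad (sel h), ∏ i, a u (h i) ^ 2
      ≤ ∑ h with bad (sel h), ∑ w ∈ S with bad w, ∏ i, a w (h i) * a u (h i) := by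
        refine Finset.sum_le_sum fun h hh => ?_
        have hb := (Finset.mem_filter.1 hh).2
        -- The winner has at least the likelihood of `u`, so one factor of `∏ a u` may be replaced
        -- by that of the winner. Enlarging to all bad candidates makes the sum over histories
        -- factor into `m`-th powers of Bhattacharyya coefficients.
        refine le_trans ?_ (Finset.single_le_sum (f := fun w => ∏ i, a w (h i) * a u (h i))
          (fun w _ => Finset.prod_nonneg fun i _ => mul_nonneg (ha _ _) (ha _ _))
          (Finset.mem_filter.2 ⟨(hsel h).1, hb⟩))
        rw [Finset.prod_pow, Finset.prod_mul_distrib, sq]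
        exact mul_le_mul_of_nonneg_right ((hsel h).2 u hu) (hprod u h)
    _ ≤ ∑ h : Fin m → Ω, ∑ w ∈ S with bad w, ∏ i, a w (h i) * a u (h i) :=
        Finset.sum_le_sum_of_subset_of_nonneg (Finset.filter_subset _ _) fun h _ _ =>
          Finset.sum_nonneg fun w _ => Finset.prod_nonneg fun i _ => mul_nonneg (ha _ _) (ha _ _)
    _ = ∑ w ∈ S with bad w, (∑ o, a w o * a u o) ^ m := by
        rw [Finset.sum_comm]
        exact Finset.sum_congr rfl fun w _ => (Fintype.sum_pow (fun o => a w o * a u o) m).symm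
    _ ≤ ∑ w ∈ S with bad w, β ^ m := by
        refine Finset.sum_le_sum fun w hw => ?_
        obtain ⟨hwS, hb⟩ := Finset.mem_filter.1 hw
        exact pow_le_pow_left₀ (Finset.sum_nonneg fun o _ => mul_nonneg (ha _ _) (ha _ _))
          (hβ w hwS hb) m
    _ ≤ _ := by
        rw [Finset.sum_const, nsmul_eq_mul]
        refine mul_le_mul_of_nonneg_right ?_ (pow_nonneg hβ0 m)
        exact_mod_cast Finset.card_le_univ _

end MaximumLikelihood

/-! ### Iterative refinement of a candidate -/

section Refinement
variable {n : ℕ}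

/-- `W ⊗ I` as a unitary. -/
def unitaryKroneckerOne {ι κ : Type} [Fintype ι] [DecidableEq ι] [Fintype κ] [DecidableEq κ]
    (W : Matrix.unitaryGroup ι ℂ) : Matrix.unitaryGroup (ι × κ) ℂ :=
  ⟨(W : Matrix ι ι ℂ) ⊗ₖ (1 : Matrix κ κ ℂ),
    Matrix.mem_unitaryGroup_iff'.2 (kronecker_one_isometry (unitary_conjTranspose_mul W))⟩

/-- Start from the maximally entangled state, the Choi state of the identity; a query followed by
`V⁻¹` multiplies the encoded matrix on the left by `V⁻¹ * U`. -/
lemma runState_choi (V U : QUnitary n) (P : ℕ) :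
    runState (choi (1 : Matrix (Qubits n) (Qubits n) ℂ)) (fun _ => unitaryKroneckerOne V⁻¹) U P =
      choi (((V⁻¹ * U : QUnitary n) : Matrix (Qubits n) (Qubits n) ℂ) ^ P) := by
  induction P with
  | zero => rw [runState, pow_zero]
  | succ P ih =>
    rw [runState, ih, kronecker_one_mulVec_choi]
    refine (kronecker_one_mulVec_choi _ _).trans ?_
    rw [← Matrix.mul_assoc, pow_succ']
    rfl

variable {N : Type} [Fintype N] [DecidableEq N]

/-- One refinement step: knowing `U` up to `r`, learn it up to `r'` from `m` repetitions, each
with `P` queries. -/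
lemma Simulable.refine {T : ℕ} {cand : N → QUnitary n} {p : QUnitary n → N → ℝ}
    (hsim : Simulable T p) (hp : ∀ U v, 0 ≤ p U v) {r r' : ℝ} (hr : 0 ≤ r) {P : ℕ}
    (hamp : ∀ u v w, PhaseClose r (cand u : Matrix (Qubits n) (Qubits n) ℂ) (cand v) →
      PhaseClose r (cand w : Matrix (Qubits n) (Qubits n) ℂ) (cand v) →
      PhaseClose (1 / 80) ((((cand v)⁻¹ * cand w) ^ P : QUnitary n) : Matrix (Qubits n) (Qubits n) ℂ)
        (((cand v)⁻¹ * cand u) ^ P : QUnitary n) →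
      PhaseClose r' (cand w : Matrix (Qubits n) (Qubits n) ℂ) (cand u)) {m : ℕ} {δ : ℝ}
    (hδ : Fintype.card N * (1 - 1 / (614400 * 2 ^ n)) ^ m ≤ δ) :
    ∃ p' : QUnitary n → N → ℝ, Simulable (T + m * P) p' ∧ (∀ U v, 0 ≤ p' U v) ∧
      ∀ (u : N) (S S' : Finset N),
        (∀ v ∈ S, PhaseClose r (cand u : Matrix (Qubits n) (Qubits n) ℂ) (cand v)) →
        (∀ w, PhaseClose r' (cand w : Matrix (Qubits n) (Qubits n) ℂ) (cand u) → w ∈ S') →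
        (∑ v ∈ S, p (cand u) v) * (1 - δ) ≤ ∑ w ∈ S', p' (cand u) w := by
  classical
  let Ω := (Qubits n × Qubits n) ⊕ (Qubits n × Qubits n → ZMod 4)
  let Φ : Matrix Ω (Qubits n × Qubits n) ℂ := phaseMeasurement (Qubits n × Qubits n)
  let amp : N → QUnitary n → Ω → ℝ := fun v U o =>
    ‖(Φ *ᵥ choi (((((cand v)⁻¹ * U) ^ P : QUnitary n) : Matrix (Qubits n) (Qubits n) ℂ))) o‖
  -- Only candidates near the previous estimate compete: amplification is valid only there, since
  -- far from `V` a power may agree by accident.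
  let C : N → Finset N := fun v =>
    Finset.univ.filter fun w => PhaseClose r (cand w : Matrix (Qubits n) (Qubits n) ℂ) (cand v)
  have hex : ∀ (v : N) (h : Fin m → Ω), ∃ w ∈ C v, ∀ w' ∈ C v,
      ∏ i, amp v (cand w') (h i) ≤ ∏ i, amp v (cand w) (h i) := fun v h =>
    Finset.exists_max_image (C v) (fun w => ∏ i, amp v (cand w) (h i))
      ⟨v, Finset.mem_filter.2 ⟨Finset.mem_univ _, PhaseClose.refl hr _⟩⟩
  choose sel hselC hsel using hex
  have hone : vnorm (choi (1 : Matrix (Qubits n) (Qubits n) ℂ)) = 1 :=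
    vnorm_choi (1 : QUnitary n)
  have hΦ : Φᴴ * Φ = 1 := phaseMeasurement_isometry
  have hamp1 : ∀ v U, ∑ o, amp v U o ^ 2 = 1 := by
    intro v U
    rw [← vnorm_sq, vnorm_mulVec_of_isometry hΦ, vnorm_choi, one_pow]
  have h1 := (hsim.bind_iterate hone (fun v _ => unitaryKroneckerOne (cand v)⁻¹) P hΦ m).map
    fun o : N × (Fin m → Ω) => sel o.1 o.2
  have hrun : ∀ v U o, ‖(Φ *ᵥ runState (choi (1 : Matrix (Qubits n) (Qubits n) ℂ))
      (fun _ => unitaryKroneckerOne (cand v)⁻¹) U P) o‖ = amp v U o := by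
    intro v U o
    rw [runState_choi]
    rfl
  simp only [hrun] at h1
  refine ⟨_, h1, fun U v => Finset.sum_nonneg fun o _ => ?_, fun u S S' hS hS' => ?_⟩
  · split_ifs
    · exact mul_nonneg (hp _ _) (Finset.prod_nonneg fun i _ => sq_nonneg _)
    · exact le_rfl
  rw [Finset.sum_comm, Fintype.sum_prod_type]
  have hnn : ∀ v (h : Fin m → Ω), 0 ≤ ∏ i, amp v (cand u) (h i) ^ 2 := fun v h =>
    Finset.prod_nonneg fun i _ => sq_nonneg _
  have hpoint : ∀ v, ∀ h : Fin m → Ω, (∑ w ∈ S', if sel v h = w then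
      p (cand u) v * ∏ i, amp v (cand u) (h i) ^ 2 else 0) =
      p (cand u) v * if sel v h ∈ S' then ∏ i, amp v (cand u) (h i) ^ 2 else 0 := by
    intro v h
    rw [Finset.sum_ite_eq]
    split_ifs <;> simp
  simp only [hpoint, ← Finset.mul_sum]
  rw [Finset.sum_mul]
  refine le_trans (Finset.sum_le_sum fun v hv => ?_) (Finset.sum_le_sum_of_subset_of_nonneg
    (Finset.subset_univ S) fun v _ _ => mul_nonneg (hp _ _) (Finset.sum_nonneg fun h _ => ?_))
  · refine mul_le_mul_of_nonneg_left ?_ (hp _ _)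
    have htot : ∑ h : Fin m → Ω, ∏ i, amp v (cand u) (h i) ^ 2 = 1 := by
      rw [← Fintype.sum_pow (fun o => amp v (cand u) o ^ 2), hamp1, one_pow]
    have hcard : (Fintype.card (Qubits n) : ℝ) = 2 ^ n := by simp
    have hd : (1 : ℝ) ≤ 2 ^ n := one_le_pow₀ (by norm_num)
    have hβ0 : (0 : ℝ) ≤ 1 - 1 / (614400 * 2 ^ n) := by
      rw [sub_nonneg, div_le_one (by positivity)]
      linarith
    have hu : u ∈ C v := Finset.mem_filter.2 ⟨Finset.mem_univ _, hS v hv⟩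
    have hbad := sum_maximumLikelihood_le (C v) hu (a := fun w o => amp v (cand w) o)
      (fun w o => norm_nonneg _) (fun w => w ∉ S') hβ0 (fun w hw hwb => by
        have hnot : ¬ PhaseClose (1 / 80)
            ((((cand v)⁻¹ * cand w) ^ P : QUnitary n) : Matrix (Qubits n) (Qubits n) ℂ)
            (((cand v)⁻¹ * cand u) ^ P : QUnitary n) := fun hc =>
          hwb (hS' w (hamp u v w (hS v hv) (Finset.mem_filter.1 hw).2 hc))
        -- With `r = 1/80` the gap is `1 / (96 · 80² · 2^n)`, and `96 · 6400 = 614400`.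
        refine (bhattacharyya_choi_le _ _ (by norm_num) hnot).trans (le_of_eq ?_)
        rw [hcard]
        congr 1
        field_simp
        norm_num) (sel v) fun h => ⟨hselC v h, hsel v h⟩
    have hsplit := Finset.sum_filter_add_sum_filter_not Finset.univ (fun h => sel v h ∈ S')
      fun h : Fin m → Ω => ∏ i, amp v (cand u) (h i) ^ 2
    rw [← Finset.sum_filter]
    linarith
  · split_ifs
    · exact hnn v h
    · exact le_rfl

/-- Learning an element of a finite set of candidates. -/
lemma exists_simulable_candidate [Nonempty N] (cand : N → QUnitary n) {m : ℕ} {δ : ℝ} (hδ1 : δ ≤ 1)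
    (hδ : Fintype.card N * (1 - 1 / (614400 * 2 ^ n)) ^ m ≤ δ) (J : ℕ) :
    ∃ p : QUnitary n → N → ℝ, Simulable (m * 2 ^ J) p ∧ (∀ U v, 0 ≤ p U v) ∧
      ∀ (u : N) (S : Finset N), (∀ w, PhaseClose (1 / (20 * 2 ^ J))
          (cand w : Matrix (Qubits n) (Qubits n) ℂ) (cand u) → w ∈ S) →
        (1 - δ) ^ (J + 1) ≤ ∑ w ∈ S, p (cand u) w := by
  classical
  induction J with
  | zero =>
    obtain ⟨w₀⟩ := ‹Nonempty N›
    -- An arbitrary first guess works, since any two unitaries are within 2. No amplification is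
    -- needed to reach radius `1/20`.
    obtain ⟨p, hsim, hp, hgood⟩ := (simulable_const (n := n) w₀).refine (cand := cand) (r := 2)
      (r' := 1 / (20 * 2 ^ 0)) (P := 1) (fun U v => by split_ifs <;> norm_num) (by norm_num)
      (fun u v w _ _ h => by
        rw [pow_one, pow_one] at h
        obtain ⟨c, hc, h⟩ := (phaseClose_unitary_mul_iff (cand v)⁻¹).1 h
        exact ⟨c, hc, h.trans (by norm_num)⟩) hδ
    refine ⟨p, by simpa using hsim, hp, fun u S hS => ?_⟩
    have h := hgood u {w₀} S (fun v _ => ⟨1, norm_one, ?_⟩) hS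
    · simpa using h
    · rw [one_smul]
      refine (norm_sub_le _ _).trans ?_
      linarith [opNorm_unitary_le (cand u), opNorm_unitary_le (cand v)]
  | succ J ih =>
    obtain ⟨p, hsim, hp, hgood⟩ := ih
    -- Here `P r = 1/20` exactly, and `1/(40 P)` is the next radius. This stage adds `m * 2 ^ J`
    -- queries to the `m * 2 ^ J` already spent, so the cost doubles as the radius halves.
    obtain ⟨p', hsim', hp', hgood'⟩ := hsim.refine (cand := cand) hp (r := 1 / (20 * 2 ^ J))
      (r' := 1 / (20 * 2 ^ (J + 1))) (P := 2 ^ J) (by positivity)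
      (fun u v w hu hw h => by
        have hone : ∀ x : N, PhaseClose (1 / (20 * 2 ^ J))
            (cand x : Matrix (Qubits n) (Qubits n) ℂ) (cand v) → PhaseClose (1 / (20 * 2 ^ J))
              (((cand v)⁻¹ * cand x : QUnitary n) : Matrix (Qubits n) (Qubits n) ℂ) 1 := by
          intro x hx
          have := (phaseClose_unitary_mul_iff (cand v)⁻¹).2 hx
          rwa [← Submonoid.coe_mul, ← Submonoid.coe_mul, inv_mul_cancel] at this
        have h2 := phaseClose_of_pow _ _ (pow_pos two_pos J) (by
          push_cast
          apply le_of_eq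
          field_simp) (hone w hw) (hone u hu) h
        have h3 := (phaseClose_unitary_mul_iff (cand v)⁻¹).1 h2
        convert h3 using 1
        push_cast
        rw [pow_succ]
        ring) hδ
    refine ⟨p', ?_, hp', fun u S hS => ?_⟩
    · convert hsim' using 1
      ring
    · have h := hgood' u (Finset.univ.filter fun w => PhaseClose (1 / (20 * 2 ^ J))
        (cand w : Matrix (Qubits n) (Qubits n) ℂ) (cand u)) S
        (fun v hv => (Finset.mem_filter.1 hv).2.symm) hS
      refine le_trans ?_ h
      rw [pow_succ]
      exact mul_le_mul_of_nonneg_right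
        (hgood u _ fun w hw => Finset.mem_filter.2 ⟨Finset.mem_univ _, hw⟩) (by linarith)

end Refinement
end UnitaryLearning

namespace UnitaryLearning
open scoped Matrix Kronecker ComplexOrder Matrix.Norms.L2Operator

/-! ### Two-qubit gates as an algebra embedding -/

section PairEmbedding
variable {n : ℕ}

/-- Split off the qubits `i` and `j`. -/
def splitPair {i j : Fin n} (hij : i ≠ j) :
    Qubits n ≃ (Fin 2 × Fin 2) × ({k : Fin n // k ≠ i ∧ k ≠ j} → Fin 2) where
  toFun x := ((x i, x j), fun k => x k)
  invFun p := fun k => if hi : k = i then p.1.1 else if hj : k = j then p.1.2 else p.2 ⟨k, hi, hj⟩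
  left_inv x := by
    funext k
    dsimp only
    split_ifs with h1 h2
    · rw [h1]
    · rw [h2]
    · rfl
  right_inv p := by
    refine Prod.ext (Prod.ext ?_ ?_) (funext fun k => ?_)
    · simp
    · simp [hij.symm]
    · simp [k.2.1, k.2.2]

/-- `onPair` as a homomorphism of star algebras. -/
noncomputable def onPairHom {i j : Fin n} (hij : i ≠ j) :
    Matrix (Fin 2 × Fin 2) (Fin 2 × Fin 2) ℂ →⋆ₐ[ℂ] Matrix (Qubits n) (Qubits n) ℂ where
  toFun g := (kroneckerOneHom (Fin 2 × Fin 2) ({k : Fin n // k ≠ i ∧ k ≠ j} → Fin 2) g).submatrix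
    (splitPair hij) (splitPair hij)
  map_one' := by rw [map_one, Matrix.submatrix_one_equiv]
  map_mul' A B := by rw [map_mul, Matrix.submatrix_mul_equiv]
  map_zero' := by rw [map_zero, Matrix.submatrix_zero]; rfl
  map_add' A B := by rw [map_add, Matrix.submatrix_add]; rfl
  commutes' c := by
    rw [AlgHomClass.commutes, Algebra.algebraMap_eq_smul_one, Algebra.algebraMap_eq_smul_one,
      Matrix.submatrix_smul, Pi.smul_apply, Pi.smul_apply, Matrix.submatrix_one_equiv]
  map_star' A := by rw [map_star]; rfl

lemma onPairHom_apply {i j : Fin n} (hij : i ≠ j) (g : Matrix (Fin 2 × Fin 2) (Fin 2 × Fin 2) ℂ) :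
    onPairHom hij g = onPair i j g := by
  ext x y
  change g (x i, x j) (y i, y j) * (1 : Matrix ({k : Fin n // k ≠ i ∧ k ≠ j} → Fin 2) ({k : Fin n // k ≠ i ∧ k ≠ j} → Fin 2) ℂ)
    (fun k : {k : Fin n // k ≠ i ∧ k ≠ j} => x k)
    (fun k => y k) =
      if ∀ k : Fin n, k ≠ i → k ≠ j → x k = y k then _ else _
  rw [Matrix.one_apply, mul_ite, mul_one, mul_zero]
  refine if_congr ⟨fun h k hi hj => congrFun h ⟨k, hi, hj⟩, fun h => funext fun k => ?_⟩ rfl rfl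
  exact h k k.2.1 k.2.2

/-- Homomorphisms of C⋆-algebras are contractive, so rounding a gate costs the same on any number of
qubits. -/
lemma norm_onPair_sub_le {i j : Fin n} (hij : i ≠ j) (g h : Matrix (Fin 2 × Fin 2) (Fin 2 × Fin 2) ℂ) :
    ‖onPair i j g - onPair i j h‖ ≤ ‖g - h‖ := by
  rw [← onPairHom_apply hij, ← onPairHom_apply hij, ← map_sub]
  exact NonUnitalStarAlgHom.norm_apply_le (onPairHom hij) (g - h)

/-- `onPair` on unitaries. -/
noncomputable def onPairUnitary {i j : Fin n} (hij : i ≠ j)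
    (g : Matrix.unitaryGroup (Fin 2 × Fin 2) ℂ) : QUnitary n :=
  ⟨onPair i j (g : Matrix (Fin 2 × Fin 2) (Fin 2 × Fin 2) ℂ), by
    rw [Matrix.mem_unitaryGroup_iff', ← onPairHom_apply hij, ← map_star, ← map_mul]
    rw [Matrix.mem_unitaryGroup_iff'.1 g.2, map_one]⟩

end PairEmbedding

/-! ### A finite net of circuits -/

section Net

lemma norm_entry_le_one {ι : Type} [Fintype ι] [DecidableEq ι] (U : Matrix.unitaryGroup ι ℂ) (x y : ι) :
    ‖(U : Matrix ι ι ℂ) x y‖ ≤ 1 :=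
  entry_norm_bound_of_unitary U.2 x y

/-- The cell of a complex number in a grid of mesh `1 / k` on the square `[-1, 1]²`. -/
noncomputable def gridCell (k : ℕ) (z : ℂ) : Fin (2 * k + 1) × Fin (2 * k + 1) :=
  (Fin.ofNat _ ⌊(z.re + 1) * k⌋₊, Fin.ofNat _ ⌊(z.im + 1) * k⌋₊)

lemma abs_sub_le_of_floor_eq {k : ℕ} (hk : 0 < k) {a b : ℝ} (ha : |a| ≤ 1) (hb : |b| ≤ 1)
    (h : Fin.ofNat (2 * k + 1) ⌊(a + 1) * k⌋₊ = Fin.ofNat (2 * k + 1) ⌊(b + 1) * k⌋₊) :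
    |a - b| ≤ 1 / k := by
  have hk' : (0 : ℝ) < k := Nat.cast_pos.2 hk
  rw [abs_le] at ha hb
  have hlt : ∀ c : ℝ, -1 ≤ c → c ≤ 1 → ⌊(c + 1) * k⌋₊ < 2 * k + 1 := by
    intro c h1 h2
    rw [Nat.lt_succ_iff]
    refine Nat.floor_le_of_le ?_
    push_cast
    nlinarith
  have h1 : ⌊(a + 1) * k⌋₊ = ⌊(b + 1) * k⌋₊ := by
    have := congrArg Fin.val h
    rwa [Fin.val_ofNat, Fin.val_ofNat, Nat.mod_eq_of_lt (hlt a ha.1 ha.2),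
      Nat.mod_eq_of_lt (hlt b hb.1 hb.2)] at this
  have ha0 : 0 ≤ (a + 1) * k := mul_nonneg (by linarith) hk'.le
  have hb0 : 0 ≤ (b + 1) * k := mul_nonneg (by linarith) hk'.le
  have h2 := Nat.floor_le ha0
  have h3 := Nat.lt_floor_add_one ((a + 1) * k)
  have h4 := Nat.floor_le hb0
  have h5 := Nat.lt_floor_add_one ((b + 1) * k)
  rw [h1] at h2 h3
  rw [abs_le, ← neg_div, div_le_iff₀ hk', le_div_iff₀ hk']
  constructor <;> linarith

lemma norm_sub_le_of_gridCell_eq {k : ℕ} (hk : 0 < k) {z w : ℂ} (hz : ‖z‖ ≤ 1) (hw : ‖w‖ ≤ 1)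
    (h : gridCell k z = gridCell k w) : ‖z - w‖ ≤ 2 / k := by
  have h1 := abs_sub_le_of_floor_eq hk ((Complex.abs_re_le_norm z).trans hz)
    ((Complex.abs_re_le_norm w).trans hw) (congrArg Prod.fst h)
  have h2 := abs_sub_le_of_floor_eq hk ((Complex.abs_im_le_norm z).trans hz)
    ((Complex.abs_im_le_norm w).trans hw) (congrArg Prod.snd h)
  have h3 := Complex.norm_le_abs_re_add_abs_im (z - w)
  rw [Complex.sub_re, Complex.sub_im] at h3
  have h4 : (2 : ℝ) / k = 1 / k + 1 / k := by ring
  linarith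

/-- A finite net of the two-qubit unitaries. -/
lemma exists_unitary_net {k : ℕ} (hk : 0 < k) :
    ∃ rep : ((Fin 2 × Fin 2) × (Fin 2 × Fin 2) → Fin (2 * k + 1) × Fin (2 * k + 1)) →
      Matrix.unitaryGroup (Fin 2 × Fin 2) ℂ, ∀ g : Matrix.unitaryGroup (Fin 2 × Fin 2) ℂ, ∃ a,
        ‖(g : Matrix (Fin 2 × Fin 2) (Fin 2 × Fin 2) ℂ) - rep a‖ ≤ 8 / k := by
  classical
  have hk' : (0 : ℝ) < k := Nat.cast_pos.2 hk
  let code : Matrix.unitaryGroup (Fin 2 × Fin 2) ℂ →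
      ((Fin 2 × Fin 2) × (Fin 2 × Fin 2) → Fin (2 * k + 1) × Fin (2 * k + 1)) := fun g p =>
    gridCell k ((g : Matrix (Fin 2 × Fin 2) (Fin 2 × Fin 2) ℂ) p.1 p.2)
  -- Each occupied cell is represented by a unitary inside it, so the net stays in the unitary
  -- group. The radius is `√(16 · (2/k)²) = 8/k`.
  refine ⟨Function.invFun code, fun g => ⟨code g, ?_⟩⟩
  have hcode : code (Function.invFun code (code g)) = code g := Function.invFun_eq ⟨g, rfl⟩
  set h := Function.invFun code (code g)
  refine abs_le_of_sq_le_sq' ?_ (by positivity) |>.2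
  refine (opNorm_sq_le_card_mul_vnorm_choi_sq _).trans ?_
  rw [card_mul_vnorm_choi_sq]
  calc _ ≤ ∑ _x : Fin 2 × Fin 2, ∑ _y : Fin 2 × Fin 2, (2 / (k : ℝ)) ^ 2 := by
        refine Finset.sum_le_sum fun x _ => Finset.sum_le_sum fun y _ => ?_
        refine pow_le_pow_left₀ (norm_nonneg _) ?_ 2
        exact norm_sub_le_of_gridCell_eq hk (norm_entry_le_one g x y) (norm_entry_le_one h x y)
          (congrFun hcode (x, y)).symm
    _ = _ := by
        simp only [Finset.sum_const, Finset.card_univ, Fintype.card_prod, Fintype.card_fin,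
          nsmul_eq_mul]
        push_cast
        ring

variable {n : ℕ}

/-- A finite net of the unitaries composed of `G` two-qubit gates. -/
lemma exists_circuit_net (hn : 2 ≤ n) (G : ℕ) {k : ℕ} (hk : 0 < k) :
    ∃ (N : Type) (_ : Fintype N) (_ : DecidableEq N) (_ : Nonempty N) (cand : N → QUnitary n),
      Fintype.card N = (n ^ 2 * (2 * k + 1) ^ 32) ^ G ∧ ∀ U : QUnitary n, IsCircuit G U →
        ∃ u, ‖(U : Matrix (Qubits n) (Qubits n) ℂ) - cand u‖ ≤ G * (8 / k) := by
  classical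
  obtain ⟨rep, hrep⟩ := exists_unitary_net hk
  let D := (Fin 2 × Fin 2) × (Fin 2 × Fin 2) → Fin (2 * k + 1) × Fin (2 * k + 1)
  let E := (Fin n × Fin n) × D
  -- Labels with equal qubits are kept, with the identity as a default, so that the count is simply
  -- `n²` pairs times 32 grid coordinates.
  let gate : E → QUnitary n := fun e =>
    if h : e.1.1 ≠ e.1.2 then onPairUnitary h (rep e.2) else 1
  have hlist : ∀ gates : List (Matrix (Qubits n) (Qubits n) ℂ), (∀ W ∈ gates, IsTwoQubitGate W) →
      ∃ l : List E, l.length = gates.length ∧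
        ‖gates.prod - ((l.map gate).prod : QUnitary n)‖ ≤ gates.length * (8 / k) := by
    intro gates
    induction gates with
    | nil => exact fun _ => ⟨[], rfl, by simp⟩
    | cons W gates ih =>
      intro hW
      obtain ⟨l, hl, hlp⟩ := ih fun V hV => hW V (List.mem_cons_of_mem _ hV)
      obtain ⟨i, j, hij, g, hg⟩ := hW W List.mem_cons_self
      obtain ⟨a, ha⟩ := hrep g
      have hgate : (gate ((i, j), a) : Matrix (Qubits n) (Qubits n) ℂ) =
          onPair i j (rep a : Matrix (Fin 2 × Fin 2) (Fin 2 × Fin 2) ℂ) := by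
        simp only [gate, dif_pos hij]
        rfl
      have hW1 : ‖W‖ ≤ 1 := by
        rw [hg]
        exact opNorm_unitary_le (onPairUnitary hij g)
      have hWd : ‖W - gate ((i, j), a)‖ ≤ 8 / k := by
        rw [hg, hgate]
        exact (norm_onPair_sub_le hij _ _).trans ha
      refine ⟨((i, j), a) :: l, by simp [hl], ?_⟩
      rw [List.prod_cons, List.map_cons, List.prod_cons, Submonoid.coe_mul]
      set Q : QUnitary n := (l.map gate).prod
      set R : QUnitary n := gate ((i, j), a)
      -- Telescoping: rounding errors of contractions add up.
      have e : W * gates.prod - (R : Matrix (Qubits n) (Qubits n) ℂ) * Q =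
          W * (gates.prod - Q) + (W - R) * Q := by noncomm_ring
      rw [e, List.length_cons]
      refine (norm_add_le _ _).trans ?_
      have h1 := (norm_mul_le W (gates.prod - Q)).trans (mul_le_of_le_one_left (norm_nonneg _) hW1)
      have h2 := (norm_mul_le (W - R) (Q : Matrix (Qubits n) (Qubits n) ℂ)).trans
        (mul_le_of_le_one_right (norm_nonneg _) (opNorm_unitary_le Q))
      push_cast
      linarith
  have : Nonempty (Fin n) := ⟨⟨0, by omega⟩⟩
  refine ⟨List.Vector E G, inferInstance, inferInstance,
    ⟨List.Vector.replicate G (Classical.arbitrary E)⟩, fun v => (v.toList.map gate).prod, ?_, ?_⟩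
  · rw [card_vector]
    refine congrArg (· ^ G) ?_
    change Fintype.card ((Fin n × Fin n) × ((Fin 2 × Fin 2) × (Fin 2 × Fin 2) →
      Fin (2 * k + 1) × Fin (2 * k + 1))) = _
    rw [Fintype.card_prod, Fintype.card_prod, Fintype.card_fun]
    simp only [Fintype.card_prod, Fintype.card_fin]
    generalize 2 * k + 1 = q
    rw [← sq n, ← sq q, ← pow_mul]
  · rintro U ⟨gates, hlen, hgates, hprod⟩
    obtain ⟨l, hl, hlp⟩ := hlist gates hgates
    refine ⟨⟨l, hl.trans hlen⟩, ?_⟩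
    rw [hprod, hlen] at hlp
    exact hlp

end Net
end UnitaryLearning

namespace UnitaryLearning
open scoped Matrix Kronecker ComplexOrder Matrix.Norms.L2Operator

/-! ### The query upper bound -/

section UpperBound
variable {n : ℕ}

/-- Learning a unitary from a net of candidates. -/
lemma exists_queryAlgorithm_of_net {N : Type} [Fintype N] [DecidableEq N] [Nonempty N]
    (cand : N → QUnitary n) {G m J : ℕ} {δ ε ν : ℝ} (hδ1 : δ ≤ 1)
    (hδ : Fintype.card N * (1 - 1 / (614400 * 2 ^ n)) ^ m ≤ δ) (hJ : 1 / ε ≤ 2 ^ J) (hε : 0 < ε)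
    (hnet : ∀ U : QUnitary n, IsCircuit G U →
      ∃ u, ‖(U : Matrix (Qubits n) (Qubits n) ℂ) - cand u‖ ≤ ν) (hν : ν ≤ ε / 4)
    (hsucc : 2 / 3 ≤ (1 - δ) ^ (J + 1) - 2 * ((m * 2 ^ J : ℕ) * ν)) :
    ∃ A : QueryAlgorithm n, A.Learns G ε ∧ A.queries = m * 2 ^ J := by
  classical
  obtain ⟨p, hsim, -, hgood⟩ := exists_simulable_candidate cand hδ1 hδ J
  obtain ⟨A, hA, hA'⟩ := hsim.exists_queryAlgorithm (Classical.arbitrary N) cand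
  refine ⟨A, fun U hU => ?_, hA⟩
  obtain ⟨u, hu⟩ := hnet U hU
  have h1 := hgood u (Finset.univ.filter fun w => PhaseClose (1 / (20 * 2 ^ J))
    (cand w : Matrix (Qubits n) (Qubits n) ℂ) (cand u)) fun w hw =>
      Finset.mem_filter.2 ⟨Finset.mem_univ _, hw⟩
  -- The analysis is run at the net point `cand u`, while the queries are to `U`. An estimate near
  -- `cand u` is within `2(ε/20 + ε/4) ≤ ε` of `U`.
  have h2 := hA' ε U (cand u) (Finset.univ.filter fun w => PhaseClose (1 / (20 * 2 ^ J))
    (cand w : Matrix (Qubits n) (Qubits n) ℂ) (cand u)) fun w hw => by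
      obtain ⟨c, hc, hcw⟩ := (Finset.mem_filter.1 hw).2
      refine (dDiamond_le _ _ hc).trans ?_
      have e : (cand w : Matrix (Qubits n) (Qubits n) ℂ) - c • (U : Matrix (Qubits n) (Qubits n) ℂ) =
          ((cand w : Matrix (Qubits n) (Qubits n) ℂ) - c • (cand u : Matrix (Qubits n) (Qubits n) ℂ)) -
            c • ((U : Matrix (Qubits n) (Qubits n) ℂ) - cand u) := by
        rw [smul_sub]; abel
      have h3 : ‖(cand w : Matrix (Qubits n) (Qubits n) ℂ) -
          c • (U : Matrix (Qubits n) (Qubits n) ℂ)‖ ≤ 1 / (20 * 2 ^ J) + ν := by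
        rw [e]
        refine (norm_sub_le _ _).trans (add_le_add hcw ?_)
        rw [norm_smul, hc, one_mul]
        exact hu
      have h4 : (1 : ℝ) / (20 * 2 ^ J) ≤ ε / 20 := by
        rw [div_le_iff₀ hε] at hJ
        rw [div_le_div_iff₀ (by positivity) (by norm_num)]
        linarith
      linarith
  rw [norm_sub_rev] at hu
  have h5 : ((m * 2 ^ J : ℕ) : ℝ) * ‖(cand u : Matrix (Qubits n) (Qubits n) ℂ) - U‖ ≤
      ((m * 2 ^ J : ℕ) : ℝ) * ν := mul_le_mul_of_nonneg_left hu (Nat.cast_nonneg _)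
  linarith

/-- The number of candidates is polynomial in the accuracy, for each gate. -/
lemma circuit_net_card_le {x : ℝ} (hx8 : 8 ≤ x) (hdx : (2 : ℝ) ^ n ≤ x ^ 2) {k : ℕ}
    (hkx' : (k : ℝ) ≤ x ^ 20 + 1) (G : ℕ) :
    ((n : ℝ) ^ 2 * (2 * (k : ℝ) + 1) ^ 32) ^ G ≤ x ^ (676 * G) := by
  rw [pow_mul]
  refine pow_le_pow_left₀ (by positivity) ?_ G
  have h1 : (n : ℝ) ≤ x ^ 2 := by
    refine le_trans ?_ hdx
    exact_mod_cast Nat.lt_two_pow_self.le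
  have h2 : (2 * (k : ℝ) + 1) ≤ x ^ 21 := by
    have h3 : (1 : ℝ) ≤ x ^ 20 := one_le_pow₀ (by linarith)
    rw [pow_succ]
    nlinarith
  calc (n : ℝ) ^ 2 * (2 * (k : ℝ) + 1) ^ 32 ≤ (x ^ 2) ^ 2 * (x ^ 21) ^ 32 :=
        mul_le_mul (pow_le_pow_left₀ (Nat.cast_nonneg _) h1 2)
          (pow_le_pow_left₀ (by positivity) h2 32) (by positivity) (by positivity)
    _ = x ^ 676 := by rw [← pow_mul, ← pow_mul, ← pow_add]

lemma one_sub_inv_pow_le {x d : ℝ} (hx0 : 0 < x) (hd4 : 4 ≤ d) {m G : ℕ}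
    (hmY : 614400 * 679 * (d * G * Real.log x) ≤ m) :
    (1 - 1 / (614400 * d)) ^ m ≤ (x ^ (679 * G))⁻¹ := by
  have h1 : 1 - 1 / (614400 * d) ≤ Real.exp (-(1 / (614400 * d))) := by
    linarith [Real.add_one_le_exp (-(1 / (614400 * d)))]
  have h0 : 0 ≤ 1 - 1 / (614400 * d) := by
    rw [sub_nonneg, div_le_one (by positivity)]
    linarith
  refine (pow_le_pow_left₀ h0 h1 m).trans ?_
  rw [← Real.exp_nat_mul, ← Real.exp_log (pow_pos hx0 (679 * G)), ← Real.exp_neg, Real.log_pow,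
    Real.exp_le_exp]
  push_cast
  rw [mul_neg, neg_le_neg_iff, mul_one_div, le_div_iff₀ (by positivity)]
  linarith

/-- The net contributes exponent `676 G = (4 + 21 · 32) G`; sampling for exponent `679 G` leaves the
spare `x⁻³`, small enough for all stages together. -/
lemma card_mul_one_sub_inv_pow_le {x d c : ℝ} (hx8 : 8 ≤ x) (hd4 : 4 ≤ d) {m G : ℕ} (hG : 1 ≤ G)
    (hcardx : c ≤ x ^ (676 * G)) (hmY : 614400 * 679 * (d * G * Real.log x) ≤ m) :
    c * (1 - 1 / (614400 * d)) ^ m ≤ (x ^ 3)⁻¹ := by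
  have hx0 : 0 < x := by linarith
  have hβ := one_sub_inv_pow_le hx0 hd4 hmY
  calc c * (1 - 1 / (614400 * d)) ^ m
      ≤ x ^ (676 * G) * (x ^ (679 * G))⁻¹ := by
        refine mul_le_mul hcardx hβ ?_ (by positivity)
        refine pow_nonneg ?_ m
        rw [sub_nonneg, div_le_one (by positivity)]
        linarith
    _ = (x ^ (3 * G))⁻¹ := by
        rw [show 679 * G = 676 * G + 3 * G by ring, pow_add, mul_inv, mul_inv_cancel_left₀ (by positivity)]
    _ ≤ (x ^ 3)⁻¹ := inv_anti₀ (by positivity) (pow_le_pow_right₀ (by linarith) (by omega))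

lemma rounding_error_le {x ε : ℝ} (hx8 : 8 ≤ x) (hε : 0 < ε) (hεx : 1 / ε ≤ x) {G k : ℕ}
    (hGx : (G : ℝ) ≤ x) (hkx : x ^ 20 ≤ k) :
    (G : ℝ) * (8 / k) ≤ 1 / x ^ 18 ∧ (G : ℝ) * (8 / k) ≤ ε / 4 := by
  have hx0 : 0 < x := by linarith
  have hν : (G : ℝ) * (8 / k) ≤ 1 / x ^ 18 := by
    calc (G : ℝ) * (8 / k) ≤ x * (x / x ^ 20) :=
          mul_le_mul hGx (div_le_div₀ hx0.le hx8 (by positivity) hkx) (by positivity) hx0.le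
      _ = 1 / x ^ 18 := by field_simp
  have hνε : (G : ℝ) * (8 / k) ≤ ε / 4 := by
    refine hν.trans ?_
    rw [div_le_div_iff₀ (by positivity) (by norm_num)]
    have h1 : 1 ≤ ε * x := by rwa [div_le_iff₀ hε, mul_comm] at hεx
    have h2 : 8 ≤ x ^ 17 := hx8.trans (le_self_pow₀ (by linarith) (by norm_num))
    rw [pow_succ]
    nlinarith
  exact ⟨hν, hνε⟩

lemma mul_rounding_error_le {x T ν : ℝ} (hx8 : 8 ≤ x) (hν0 : 0 ≤ ν) (hν : ν ≤ 1 / x ^ 18)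
    (hTx : T ≤ 4 * (614400 * 679) * x ^ 5) : 2 * (T * ν) ≤ 1 / 4 := by
  have hx0 : 0 < x := by linarith
  have h1 : T * ν ≤ 4 * (614400 * 679) * x ^ 5 * (1 / x ^ 18) :=
    mul_le_mul hTx hν (by positivity) (by positivity)
  have h2 : ∀ K : ℝ, K * x ^ 5 * (1 / x ^ 18) = K / x ^ 13 := fun K => by
    rw [show x ^ 18 = x ^ 5 * x ^ 13 by rw [← pow_add], mul_one_div,
      mul_comm K, mul_div_mul_left _ _ (by positivity)]
  have h3 : (8 : ℝ) ^ 13 ≤ x ^ 13 := pow_le_pow_left₀ (by norm_num) hx8 13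
  have h4 : 4 * (614400 * 679) / x ^ 13 ≤ 1 / 8 := by
    rw [div_le_div_iff₀ (by positivity) (by norm_num)]
    linarith
  rw [h2] at h1
  linarith

lemma one_sub_inv_pow_ge {x : ℝ} (hx8 : 8 ≤ x) {J : ℕ} (hJ : (2 : ℝ) ^ J ≤ x) :
    1 - 1 / 64 ≤ (1 - (x ^ 3)⁻¹) ^ (J + 1) := by
  have hx0 : 0 < x := by linarith
  have hδ1 : (x ^ 3)⁻¹ ≤ 1 := inv_le_one_of_one_le₀ (one_le_pow₀ (by linarith))
  have h1 := one_add_mul_le_pow (show -2 ≤ -(x ^ 3)⁻¹ by linarith) (J + 1)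
  rw [← sub_eq_add_neg] at h1
  refine le_trans ?_ h1
  have h2 : ((J + 1 : ℕ) : ℝ) ≤ x := by
    refine le_trans ?_ hJ
    exact_mod_cast Nat.lt_two_pow_self
  have h3 : ((J + 1 : ℕ) : ℝ) * (x ^ 3)⁻¹ ≤ x * (x ^ 3)⁻¹ :=
    mul_le_mul_of_nonneg_right h2 (by positivity)
  have h4 : x * (x ^ 3)⁻¹ = 1 / x ^ 2 := by field_simp
  have h5 : 1 / x ^ 2 ≤ 1 / 64 := one_div_le_one_div_of_le (by norm_num) (by nlinarith)
  rw [mul_neg]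
  linarith

/-- Every unitary composed of `G` two-qubit gates can be learned with
`O(2 ^ n * G * log (√(2 ^ n) * G / ε) / ε)` queries. -/
theorem query_upper_bound {G : ℕ} {ε : ℝ} (hn : 2 ≤ n) (hG : 1 ≤ G) (hε : 0 < ε)
    (hε' : ε ≤ 1 / 4) : ∃ A : QueryAlgorithm n, A.Learns G ε ∧
      (A.queries : ℝ) ≤ 4 * (614400 * 679) *
        ((2 : ℝ) ^ n * (G : ℝ) * Real.log (√((2 : ℝ) ^ n) * (G : ℝ) / ε) / ε) := by
  set x : ℝ := √((2 : ℝ) ^ n) * (G : ℝ) / ε with hx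
  set L : ℝ := Real.log x with hL
  set d : ℝ := (2 : ℝ) ^ n with hd
  have hG1 : (1 : ℝ) ≤ G := by exact_mod_cast hG
  have hd4 : (4 : ℝ) ≤ d := by
    calc (4 : ℝ) = 2 ^ 2 := by norm_num
      _ ≤ d := pow_le_pow_right₀ (by norm_num) hn
  have hsd : 2 ≤ √d := Real.le_sqrt_of_sq_le (by linarith)
  have hiε : 4 ≤ 1 / ε := by rw [le_div_iff₀ hε]; linarith
  have hxe : x = √d * G * (1 / ε) := by rw [hx]; ring
  have hsdG : √d ≤ √d * G := le_mul_of_one_le_right (Real.sqrt_nonneg _) hG1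
  have hx2 : 2 * (1 / ε) ≤ x := by
    rw [hxe]
    exact mul_le_mul_of_nonneg_right (hsd.trans hsdG) (by linarith)
  have hx8 : 8 ≤ x := by linarith
  have hx0 : 0 < x := by linarith
  have hdx : d ≤ x ^ 2 := by
    have h1 : √d ≤ x := by
      rw [hxe]
      nlinarith
    calc d = √d ^ 2 := (Real.sq_sqrt (by linarith)).symm
      _ ≤ x ^ 2 := pow_le_pow_left₀ (Real.sqrt_nonneg _) h1 2
  have hGx : (G : ℝ) ≤ x := by
    have h1 : (G : ℝ) ≤ √d * G := le_mul_of_one_le_left (by linarith) (by linarith)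
    rw [hxe]
    nlinarith
  have hεx : 1 / ε ≤ x := by linarith
  have hL1 : 1 ≤ L := by
    rw [hL, Real.le_log_iff_exp_le hx0]
    linarith [Real.exp_one_lt_d9]
  have hLx : L ≤ x := (Real.log_le_sub_one_of_pos hx0).trans (by linarith)
  -- The number of halvings is `j + 1`, so that `1/ε < 2^(j+1) ≤ 2/ε`.
  obtain ⟨j, hj1, hj2⟩ := exists_nat_pow_near (show 1 ≤ 1 / ε by linarith) (one_lt_two (α := ℝ))
  have hJ2 : (2 : ℝ) ^ (j + 1) ≤ 2 * (1 / ε) := by rw [pow_succ]; linarith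
  -- The net error must be small against the inverse of the number of queries, which is `O(x⁵)`. Any
  -- large enough power of `x` does, as it only affects a constant in front of the logarithm.
  set k : ℕ := ⌈x ^ 20⌉₊ with hk
  have hkx : x ^ 20 ≤ k := Nat.le_ceil _
  have hk0 : 0 < k := by
    have : (0 : ℝ) < k := lt_of_lt_of_le (by positivity) hkx
    exact_mod_cast this
  have hkx' : (k : ℝ) ≤ x ^ 20 + 1 := (Nat.ceil_lt_add_one (by positivity)).le
  have hY1 : 1 ≤ d * G * L := by
    have h1 : 1 ≤ d * G := by nlinarith
    nlinarith
  set m : ℕ := ⌈614400 * 679 * (d * G * L)⌉₊ with hm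
  have hmY : 614400 * 679 * (d * G * L) ≤ m := Nat.le_ceil _
  have hmY' : (m : ℝ) ≤ 2 * (614400 * 679) * (d * G * L) := by
    have := (Nat.ceil_lt_add_one (show 0 ≤ 614400 * 679 * (d * G * L) by positivity)).le
    rw [← hm] at this
    linarith
  have hT : ((m * 2 ^ (j + 1) : ℕ) : ℝ) ≤ 4 * (614400 * 679) * (d * G * L / ε) := by
    push_cast
    calc (m : ℝ) * 2 ^ (j + 1) ≤ 2 * (614400 * 679) * (d * G * L) * (2 * (1 / ε)) :=
          mul_le_mul hmY' hJ2 (by positivity) (by positivity)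
      _ = _ := by ring
  obtain ⟨N, _, _, _, cand, hcard, hnet⟩ := exists_circuit_net hn G hk0
  have hδ : Fintype.card N * (1 - 1 / (614400 * d)) ^ m ≤ (x ^ 3)⁻¹ := by
    refine card_mul_one_sub_inv_pow_le hx8 hd4 hG ?_ hmY
    rw [hcard]
    push_cast
    exact circuit_net_card_le hx8 hdx hkx' G
  have hδ1 : (x ^ 3)⁻¹ ≤ 1 := inv_le_one_of_one_le₀ (one_le_pow₀ (by linarith))
  obtain ⟨hν, hνε⟩ := rounding_error_le hx8 hε hεx hGx hkx
  have hTx : ((m * 2 ^ (j + 1) : ℕ) : ℝ) ≤ 4 * (614400 * 679) * x ^ 5 := by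
    refine hT.trans (mul_le_mul_of_nonneg_left ?_ (by norm_num))
    calc d * G * L / ε = d * G * L * (1 / ε) := by ring
      _ ≤ x ^ 2 * x * x * x := by gcongr
      _ = x ^ 5 := by ring
  have hpert := mul_rounding_error_le hx8 (by positivity) hν hTx
  have hbern := one_sub_inv_pow_ge hx8 (hJ2.trans hx2)
  -- Success probability at least `63/64 - 1/4`, which exceeds `2/3`.
  obtain ⟨A, hA, hAq⟩ := exists_queryAlgorithm_of_net cand hδ1 hδ hj2.le hε hnet hνε (by linarith)
  refine ⟨A, hA, ?_⟩
  rw [hAq]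
  exact hT

end UpperBound
end UnitaryLearning

theorem theorem3 :
    -- lower bound
    (∃ C : ℝ, 0 < C ∧ ∃ c : ℝ, 0 < c ∧
      ∀ n G : ℕ, 2 ≤ n → 1 ≤ G → ∀ ε : ℝ, 0 < ε → ε ≤ 1 / 4 →
        ∀ A : UnitaryLearning.QueryAlgorithm n, A.Learns G ε →
          c * ((2 : ℝ) ^ min ((G : ℝ) / (2 * C)) ((n : ℝ) / 2) / ε) ≤ (A.queries : ℝ)) ∧
    -- upper bound
    (∃ K : ℝ, 0 < K ∧
      ∀ n G : ℕ, 2 ≤ n → 1 ≤ G → ∀ ε : ℝ, 0 < ε → ε ≤ 1 / 4 →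
        ∃ A : UnitaryLearning.QueryAlgorithm n, A.Learns G ε ∧
          (A.queries : ℝ) ≤
            K * ((2 : ℝ) ^ n * (G : ℝ) * Real.log (√((2 : ℝ) ^ n) * (G : ℝ) / ε) / ε)) := by
  refine ⟨⟨62, by norm_num, 1 / 96, by norm_num, fun n G hn hG ε hε hε' A hA =>
      UnitaryLearning.query_lower_bound hn hG hε hε' A hA⟩,
    ⟨4 * (614400 * 679), by norm_num, fun n G hn hG ε hε hε' =>
      UnitaryLearning.query_upper_bound hn hG hε hε'⟩⟩
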